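/- **Setting.** Let $a_1,\dots,a_n\in\mathbb R^d$ be distinct points ($n\ge 1$), let $X$ be a set and ${\rm cost}:\mathbb R^d\times X\to\mathbb R_{\ge 0}$. For a finite weighted point set $B$ (a point $b$ having weight $B(b)\ge 0$) put ${\rm cost}(B,x)=\sum_b B(b)\,{\rm cost}(b,x)$; unweighted sets have weights $1$. Write $A_S=\{a_i:i\in S\}$ for $S\subseteq[n]$ and $A=A_{[n]}$. A weighted subset $B$ of $A_S$ is an *$\epsilon$-coreset* of $A_S$ if $(1-\epsilon)\,{\rm cost}(A_S,x)\le {\rm cost}(B,x)\le(1+\epsilon)\,{\rm cost}(A_S,x)$ for all $x\in X$. A weight function assigns to a point $p$ and a weighted set $B$ a number $w(p,B)\ge 0$, the weight of $p$ with respect to $B$; write $w_i(A,B)=w(a_i,B)$. Let $g(\epsilon,n,d)$ and ${\rm sum}(w)$ be real numbers and $\delta\in(0,1)$. **Conditions on $w$.** 1. (Consistent total weights) $\sum_{i\in S}w(a_i,A_S)\le{\rm sum}(w)$ for all $S\subseteq[n]$. 2. (Uniform sampling bound) $w(a_i,A_{S'}\cup\{a_i\})\ge w(a_i,A_S)$ for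 all $S'\subseteq S\subseteq[n]$ and $i\in S$. 3. (Importance sampling bound) For all $\epsilon\in(0,1)$, $S\subseteq[n]$ and $u_i\ge w(a_i,A_S)$ $(i\in S)$: if each $i\in S$ is kept independently with probability $q_i=\min\{1,g(\epsilon,n,d)\,u_i\}$ and, if kept, $a_i$ gets the weight $1/q_i$, then the result is an $\epsilon$-coreset of $A_S$ with probability at least $1-\delta$. 4. (Coresets preserve weights) If $B$ is an $\epsilon$-coreset of $A_S$, $\epsilon\in(0,1)$, then $(1-\epsilon)\,w(c,A_S)\le w(c,B)\le\frac1{1-\epsilon}\,w(c,A_S)$ for every point $c\in\mathbb R^d$. **Computation model.** A machine has a classical control, a quantum work space and a quantum-read/classical-write memory (QRAM). It can apply a unitary to the work space, measure the work space, read the QRAM in superposition, write a word to the QRAM, and write a pair (index, fixed-point weight) to a list that represents a weighted subset of $A$; each of these steps takes one unit of time. Its only access to $(A,w)$ is a classical weight oracle: handing over a weighted subset $Y$ of $A$ for preprocessing takes time $\mathcal T_{\rm prep}(|Y|,d)$; after that, a query, which may be made in superposition, returns $w_i(A,Y)$ or, if so requested, $w_i(A,Y\cup\{a_i\})$ as a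 fixed-point number, rounded up and cut off at the largest word, and takes time $\mathcal T_{\rm query}(|Y|,d)\ge1$. Here $\mathcal T_{\rm prep}$ and $\mathcal T_{\rm query}$ are nondecreasing in $|Y|$. A randomized quantum algorithm is a finite probability distribution on such machines that does not depend on $X$, ${\rm cost}$, $w$, $A$ or the oracle; it may depend on $n,d,\epsilon,\delta,g,{\rm sum}(w)$. **Theorem.** There is a universal constant $K$ such that the following holds. Let $\epsilon,\delta\in(0,1)$, $s=g(\epsilon,n,d)\cdot{\rm sum}(w)\ge 1$ and $s'=g(0.01,n,d)\cdot{\rm sum}(w)\ge1$. There is a randomized quantum algorithm, whose machines have at most $(2n/\delta)^K$ control states, memory cells, machine words and dimensions of the work space (so that control, words and work space consist of $O(\log(n/\delta))$ bits, respectively qubits), such that for all $X$, ${\rm cost}$, $A$ and $w$ that satisfy conditions 1–4 and for all $\mathcal T_{\rm prep},\mathcal T_{\rm query}$ as above: * the output is an $\epsilon$-coreset of $A$ with probability at least $1-K\log_2(2n)^K\,\delta$; * the expected size of the output is at most $K\,s=O(g(\epsilon,n,d)\cdot{\rm sum}(w))$; * the algorithm halts (with probability one) within time $$K\log_2(2n/\delta)^K\cdot\Bigl(\mathcal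 T_{\rm prep}(\lceil Ks'\rceil,d)+\sqrt{n\max\{s,s'\}}\cdot\mathcal T_{\rm query}(\lceil Ks'\rceil,d)\Bigr).$$ In particular, if $g(0.01,n,d)\le g(\epsilon,n,d)$, the time is $\widetilde O\bigl(\mathcal T_{\rm prep}(s'',d)+\sqrt{ns}\cdot\mathcal T_{\rm query}(s'',d)\bigr)$ with $s''=O(g(0.01,n,d)\cdot{\rm sum}(w))$. -/

import Mathlib

open scoped NNReal BigOperators

noncomputable section

/-! ## Weighted point sets, costs, coresets -/

/-- Points of `ℝ^d`. -/
abbrev Pt (d : ℕ) : Type := EuclideanSpace ℝ (Fin d)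

/-- A finite weighted set of points of `ℝ^d` (a point of weight `0` is not in the set). -/
abbrev WSet (d : ℕ) : Type := Pt d →₀ ℝ≥0

/-- The set `{a_i : i ∈ S}`, every point with weight one. -/
def unitSet {n d : ℕ} (a : Fin n → Pt d) (S : Finset (Fin n)) : WSet d :=
  ∑ i ∈ S, Finsupp.single (a i) 1

/-- The weighted set in which `a_i` has weight `v i`. -/
def weightedSet {n d : ℕ} (a : Fin n → Pt d) (v : Fin n → ℝ≥0) : WSet d :=
  ∑ i, Finsupp.single (a i) (v i)

/-- `cost(B, x) = ∑_{b ∈ B} B(b) * cost(b, x)`. -/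
def totalCost {d : ℕ} {X : Type*} (cost : Pt d → X → ℝ≥0) (B : WSet d) (x : X) : ℝ :=
  B.sum fun p c => (c : ℝ) * (cost p x : ℝ)

/-- The weighted set `B` is a (strong) `ε`-coreset of the point set `{a_i : i ∈ S}`: it is
supported on this set and `cost(B, x) = (1 ± ε) cost({a_i : i ∈ S}, x)` for all `x`. -/
def IsCoreset {n d : ℕ} {X : Type*} (cost : Pt d → X → ℝ≥0) (a : Fin n → Pt d) (ε : ℝ)
    (S : Finset (Fin n)) (B : WSet d) : Prop :=
  (B.support : Set (Pt d)) ⊆ a '' (S : Set (Fin n)) ∧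
    ∀ x, (1 - ε) * totalCost cost (unitSet a S) x ≤ totalCost cost B x ∧
      totalCost cost B x ≤ (1 + ε) * totalCost cost (unitSet a S) x

/-! ## The conditions on the weights -/

/-- Probability that independent sampling from `S`, keeping `i` with probability `q i`, returns
exactly the set `R ⊆ S`. -/
def sampleProb {n : ℕ} (q : Fin n → ℝ) (S R : Finset (Fin n)) : ℝ :=
  (∏ i ∈ R, q i) * ∏ i ∈ S \ R, (1 - q i)

/-- The sample `R`, where `a_i` is reweighted by `1 / q i`. -/
def reweighted {n d : ℕ} (a : Fin n → Pt d) (q : Fin n → ℝ) (R : Finset (Fin n)) : WSet d :=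
  ∑ i ∈ R, Finsupp.single (a i) (Real.toNNReal (1 / q i))

open Classical in
/-- The conditions on a weight function `w`, where `w p B` is the weight of the point `p` with
respect to the weighted set `B`. They are required for the subsets of a ground set of `n` points
`a_1, …, a_n` of `ℝ^d`. The number `δ` is the failure probability meant by
"with high probability". -/
structure WeightConditions {n d : ℕ} {X : Type*} (a : Fin n → Pt d) (cost : Pt d → X → ℝ≥0)
    (w : Pt d → WSet d → ℝ≥0) (g : ℝ → ℕ → ℕ → ℝ) (sumw δ : ℝ) : Prop where
  /-- Consistent total weights. -/
  consistent_total : ∀ S : Finset (Fin n), ∑ i ∈ S, (w (a i) (unitSet a S) : ℝ) ≤ sumw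
  /-- Uniform sampling bound: the weight of `a_i` with respect to `A'` (if `a_i ∈ A'`), or to
  `A' ∪ {a_i}` (if not), is at least its weight with respect to the whole set. -/
  uniform_sampling : ∀ S' S : Finset (Fin n), S' ⊆ S → ∀ i ∈ S,
    w (a i) (unitSet a S) ≤ w (a i) (unitSet a (insert i S'))
  /-- Importance sampling bound. -/
  importance_sampling : ∀ ε : ℝ, 0 < ε → ε < 1 → ∀ (S : Finset (Fin n)) (u : Fin n → ℝ),
    (∀ i ∈ S, (w (a i) (unitSet a S) : ℝ) ≤ u i) →
      1 - δ ≤ ∑ R ∈ S.powerset with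
        IsCoreset cost a ε S (reweighted a (fun i => min 1 (g ε n d * u i)) R),
          sampleProb (fun i => min 1 (g ε n d * u i)) S R
  /-- Coresets preserve weights: the two weights agree up to a factor in
  `[1 - ε, 1 / (1 - ε)]`. This interval contains `1 ± ε`. -/
  coreset_preserves : ∀ ε : ℝ, 0 < ε → ε < 1 → ∀ (S : Finset (Fin n)) (B : WSet d),
    IsCoreset cost a ε S B → ∀ c : Pt d,
      (1 - ε) * (w c (unitSet a S) : ℝ) ≤ w c B ∧ (1 - ε) * (w c B : ℝ) ≤ w c (unitSet a S)

/-! ## Quantum machines with QRAM and a weight oracle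

A machine consists of a classical control with finitely many states, a quantum work space, a
quantum-read / classical-write memory (QRAM), a list of weighted indices that is being written,
and a weight oracle. The control states, the memory cells, the words and the dimension of the work
space are bounded separately (see `QMachine.SizeAtMost`); `poly(n)` bounds mean that control, words
and work space consist of `O(log n)` bits, respectively qubits. The machine is fixed before the
input is known, and the weight oracle is its only access to the input. -/

/-- The sizes of a machine: number of control states, of memory cells, largest word, dimension of
the ancilla register. -/
structure Shape where
  states : ℕ
  cells : ℕ
  maxWord : ℕ
  anc : ℕ

/-- A machine word, with addition modulo the number of words. -/
abbrev Shape.Word (σ : Shape) : Type := Fin (σ.maxWord + 1)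

/-- The computational basis of the work space: an index `i ∈ [n]`, a flag, a memory address, a
word, and the ancilla. -/
abbrev Shape.Basis (n : ℕ) (σ : Shape) : Type :=
  Fin n × Bool × Fin σ.cells × σ.Word × Fin σ.anc

/-- Instructions. Every instruction but `halt` and `measure` names the next control state;
after `measure` it depends on the outcome. -/
inductive Instr (n : ℕ) (σ : Shape) : Type
  /-- Apply a unitary to the work space. -/
  | gate (U : Matrix.unitaryGroup (σ.Basis n) ℂ) (next : Fin σ.states)
  /-- Measure the work space in the computational basis. -/
  | measure (next : σ.Basis n → Fin σ.states)
  /-- Quantum read: `|i, f, r, z, x⟩ ↦ |i, f, r, z + mem[r], x⟩`. -/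
  | read (next : Fin σ.states)
  /-- Classical write to the memory. -/
  | write (r : Fin σ.cells) (v : σ.Word) (next : Fin σ.states)
  /-- Give the index `i` the weight `v` in the current list (`v = 0` removes it). -/
  | emit (i : Fin n) (v : σ.Word) (next : Fin σ.states)
  /-- Hand the current list to the weight oracle for preprocessing and start an empty list. -/
  | prep (next : Fin σ.states)
  /-- Quantum query to the weight oracle:
  `|i, f, r, z, x⟩ ↦ |i, f, r, z + answer(i, f), x⟩`. -/
  | query (next : Fin σ.states)
  /-- Stop; the current list is the output. -/
  | halt

/-- Whether an instruction is `halt`. -/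
def Instr.IsHalt {n : ℕ} {σ : Shape} : Instr n σ → Prop
  | .halt => True
  | _ => False

/-- A machine. Weights in lists are fixed-point numbers: the word `v` stands for `v / scale`.
Answers of the weight oracle are rounded up to multiples of `unit`. -/
structure QMachine (n : ℕ) where
  shape : Shape
  scale : ℕ
  scale_pos : 0 < scale
  unit : ℝ
  unit_pos : 0 < unit
  start : Fin shape.states
  initBasis : shape.Basis n
  code : Fin shape.states → Instr n shape

/-- At most `b` control states, memory cells, words, and dimension of the work space. -/
def QMachine.SizeAtMost {n : ℕ} (m : QMachine n) (b : ℝ) : Prop :=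
  (m.shape.states : ℝ) ≤ b ∧ (m.shape.cells : ℝ) ≤ b ∧ ((m.shape.maxWord + 1 : ℕ) : ℝ) ≤ b ∧
    (Fintype.card (m.shape.Basis n) : ℝ) ≤ b

/-- The weight oracle, as seen by a machine. After preprocessing of the list `Y`, which takes time
`prepTime |Y|`, a query with index `i` and flag `f` has the answer `answer Y i f` and takes time
`queryTime |Y|`. -/
structure WeightOracle (n : ℕ) where
  answer : (Fin n → ℝ≥0) → Fin n → Bool → ℝ≥0
  prepTime : ℕ → ℕ
  queryTime : ℕ → ℕ

/-- The oracle of the weight function `w` on the points `a_1, …, a_n`: for the weighted subset `Y`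
it returns `w_i(A, Y)`, or, if the flag is set, `w_i(A, Y ∪ {a_i})`. -/
def weightOracle {n d : ℕ} (a : Fin n → Pt d) (w : Pt d → WSet d → ℝ≥0)
    (Tprep Tquery : ℕ → ℕ → ℕ) : WeightOracle n where
  answer Y i f := w (a i) (weightedSet a Y + if f then Finsupp.single (a i) 1 else 0)
  prepTime s := Tprep s d
  queryTime s := Tquery s d

/-- A configuration. `loaded` is the list that was preprocessed last, if there is one, and `time`
is the time that has elapsed. -/
structure Config (n : ℕ) (σ : Shape) where
  pc : Fin σ.states
  mem : Fin σ.cells → σ.Word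
  list : Fin n → σ.Word
  loaded : Option (Fin n → σ.Word)
  psi : σ.Basis n → ℂ
  time : ℕ

/-- The number of points in a list. -/
def listSize {n : ℕ} {σ : Shape} (v : Fin n → σ.Word) : ℕ :=
  (Finset.univ.filter fun i => v i ≠ 0).card

namespace QMachine

variable {n : ℕ} (m : QMachine n)

/-- The weights that a list stands for. -/
def decode (v : Fin n → m.shape.Word) : Fin n → ℝ≥0 :=
  fun i => ((v i : ℕ) : ℝ≥0) / (m.scale : ℝ≥0)

/-- A nonnegative real number, rounded up to a multiple of `unit` and cut off at the largest
word. -/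
def encode (y : ℝ≥0) : m.shape.Word :=
  ⟨min ⌈(y : ℝ) / m.unit⌉₊ m.shape.maxWord, Nat.lt_succ_of_le (min_le_right _ _)⟩

/-- The word that a query adds to the word register (zero before the first preprocessing). -/
def queryWord (O : WeightOracle n) (loaded : Option (Fin n → m.shape.Word)) (i : Fin n)
    (f : Bool) : m.shape.Word :=
  match loaded with
  | none => 0
  | some Y => m.encode (O.answer (m.decode Y) i f)

/-- The time of a query. -/
def queryCost (O : WeightOracle n) (loaded : Option (Fin n → m.shape.Word)) : ℕ :=
  match loaded with
  | none => 1
  | some Y => O.queryTime (listSize Y)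

/-- The initial configuration. -/
def initConfig : Config n m.shape where
  pc := m.start
  mem := fun _ => 0
  list := fun _ => 0
  loaded := none
  psi := Pi.single m.initBasis 1
  time := 0

/-- Expected value of the quantity `F` of the configuration after `N` steps (or at the halt, if
this is earlier), from a given configuration. Preprocessing and queries take the time of the
oracle, every other instruction takes one unit of time. -/
def expect (O : WeightOracle n) (F : Config n m.shape → ℝ) : ℕ → Config n m.shape → ℝ
  | 0, c => F c
  | N + 1, c =>
    match m.code c.pc with
    | .halt => F c
    | .gate U next =>
        expect O F N { c with
          pc := next
          psi := (U : Matrix (m.shape.Basis n) (m.shape.Basis n) ℂ).mulVec c.psi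
          time := c.time + 1 }
    | .measure next =>
        ∑ b, ‖c.psi b‖ ^ 2 *
          expect O F N { c with pc := next b, psi := Pi.single b 1, time := c.time + 1 }
    | .read next =>
        expect O F N { c with
          pc := next
          psi := fun (i, f, r, z, x) => c.psi (i, f, r, z - c.mem r, x)
          time := c.time + 1 }
    | .write r v next =>
        expect O F N { c with pc := next, mem := Function.update c.mem r v, time := c.time + 1 }
    | .emit i v next =>
        expect O F N { c with pc := next, list := Function.update c.list i v, time := c.time + 1 }
    | .prep next =>
        expect O F N { c with
          pc := next
          list := fun _ => 0
          loaded := some c.list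
          time := c.time + O.prepTime (listSize c.list) }
    | .query next =>
        expect O F N { c with
          pc := next
          psi := fun (i, f, r, z, x) => c.psi (i, f, r, z - m.queryWord O c.loaded i f, x)
          time := c.time + m.queryCost O c.loaded }

end QMachine

/-- A randomized quantum algorithm: a machine drawn from a finite probability distribution, which
does not depend on the input. -/
structure RandQAlgorithm (n : ℕ) where
  Ω : Type
  fintype : Fintype Ω
  prob : Ω → ℝ
  prob_nonneg : ∀ ω, 0 ≤ prob ω
  prob_sum : ∑ ω, prob ω = 1
  machine : Ω → QMachine n

namespace RandQAlgorithm

variable {n : ℕ} (alg : RandQAlgorithm n)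

/-- Every machine that can be drawn has the size at most `b`. -/
def SizeAtMost (b : ℝ) : Prop := ∀ ω, (alg.machine ω).SizeAtMost b

/-- Expected value of a quantity of the machine and of its configuration after `N` steps. -/
def expect (O : WeightOracle n) (N : ℕ) (F : (m : QMachine n) → Config n m.shape → ℝ) : ℝ :=
  letI := alg.fintype
  ∑ ω, alg.prob ω *
    (alg.machine ω).expect O (F (alg.machine ω)) N (alg.machine ω).initConfig

open Classical in
/-- Probability of an event in the configuration after `N` steps. -/
def probability (O : WeightOracle n) (N : ℕ) (P : (m : QMachine n) → Config n m.shape → Prop) :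
    ℝ :=
  alg.expect O N fun m c => if P m c then 1 else 0

end RandQAlgorithm

end

/-!
The algorithm keeps a set `T` of indices together with a `1 / 100`-coreset of `{a_i : i ∈ T}`, which
is loaded into the weight oracle, and a number `j`. A *try* adds to `T` a random set `D` that
contains every index with probability `2 ^ -j`, and takes an importance sample of `T ∪ D`. The
sampling probabilities come from the answers of the oracle for the loaded coreset, with `a_i` added
if `i ∉ T`: by the conditions on the weights these answers are, up to a constant factor, at least
the weights with respect to `T ∪ D`, so that the sample is a coreset of `T ∪ D` with probability
`1 - δ` (`Scheme.Fits.le_expect_isCoreset`). If the sample has at most `1000` times the intended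
size, it is accepted, loaded, and `j` decreases; otherwise `j` increases. At `j = 0` the set `T`
becomes everything, and the last try samples the output with the precision `ε`.

*Expected number of tries.* For a uniformly random set `D`, the weights of the points outside
`T ∪ D` (each with respect to `T ∪ D` and the point itself) have at most `2 ^ j` times the total
weight in expectation (`mul_expect_sum_compl_le`), because the point `i` could be in `D` as well.
Hence samples of `T ∪ D` are rarely too large. Quantitatively, `potential` decreases by the factor
`0.9` in expectation in every try (`Scheme.Fits.expect_potential_le`), and it starts at `O(√n)`.
Up to a constant factor it bounds the probability that the algorithm is not done, which is therefore
at most `δ` after `O(log (n / δ))` tries. As more than `O(log n)` tries are rarely needed, the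
failures of single tries add up to `O(δ * log n)` only (`Scheme.Fits.le_expect_ideal`,
`failBound_le`).

*Randomness without memory.* All random bits of the sampling are part of the machine that is drawn:
the seeds contain uniformly random numbers `< 2 ^ bits`, and an index is kept if its number is
below a threshold. The sampling probabilities are powers of two, so that the weights are integers.
Given the seeds, `T`, `D` and `j` are functions of the outcomes (acceptance or rejection) of the
tries so far, and there are only polynomially many sequences of outcomes; they are the states of
the classical control.

*One try.* The indices of the sample are marked by a predicate that takes one query to evaluate.
`Search.machine` finds all of them, or more than the cap, by Grover search: for each order of
magnitude `2 ^ a` of the number of marked indices, it makes `min (2 ^ a) cap` draws, up to a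
logarithmic factor, with about `√(n / 2 ^ a) / 2` iterations each (`schedule`). A draw gives
every marked index with the same probability (`groverAmp_sq_of_mem`).
Found indices are recognized by stamps in the memory. A search fails with probability at most `δ`
(`Search.le_valAt_draw`, `le_findProb_schedule`) and makes `O(√(n * cap))` queries up to logarithmic
factors (`sum_schedule_le`).

The bounds on the time and on the sizes of lists hold in every branch of the computation, also after
failures: they are invariants of the transitions (`Search.inv_succ`), and the control graph is
acyclic (`Search.ranked`). When the tries are used up before the output has been sampled, the output
is empty.
-/

noncomputable section

/-! ### Runs of machines whose control graph has no cycle -/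

namespace QMachine

variable {n : ℕ} {m : QMachine n}

/-- The possible successors of a configuration, over all measurement outcomes (those of
probability zero included). A halted configuration has none. -/
def succs (m : QMachine n) (O : WeightOracle n) (c : Config n m.shape) :
    Set (Config n m.shape) :=
  match m.code c.pc with
  | .halt => ∅
  | .gate U next => {{ c with
      pc := next
      psi := (U : Matrix (m.shape.Basis n) (m.shape.Basis n) ℂ).mulVec c.psi
      time := c.time + 1 }}
  | .measure next =>
      Set.range fun b => { c with pc := next b, psi := Pi.single b 1, time := c.time + 1 }
  | .read next => {{ c with
      pc := next
      psi := fun (i, f, r, z, x) => c.psi (i, f, r, z - c.mem r, x)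
      time := c.time + 1 }}
  | .write r v next =>
      {{ c with pc := next, mem := Function.update c.mem r v, time := c.time + 1 }}
  | .emit i v next =>
      {{ c with pc := next, list := Function.update c.list i v, time := c.time + 1 }}
  | .prep next => {{ c with
      pc := next
      list := fun _ => 0
      loaded := some c.list
      time := c.time + O.prepTime (listSize c.list) }}
  | .query next => {{ c with
      pc := next
      psi := fun (i, f, r, z, x) => c.psi (i, f, r, z - m.queryWord O c.loaded i f, x)
      time := c.time + m.queryCost O c.loaded }}

/-- The function `rk` on control states decreases in every step, so that the machine halts after
at most `rk` steps. -/
def Ranked (m : QMachine n) (rk : Fin m.shape.states → ℕ) : Prop :=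
  ∀ p, match m.code p with
  | .halt => True
  | .gate _ nx => rk nx < rk p
  | .measure nx => ∀ b, rk (nx b) < rk p
  | .read nx => rk nx < rk p
  | .write _ _ nx => rk nx < rk p
  | .emit _ _ nx => rk nx < rk p
  | .prep nx => rk nx < rk p
  | .query nx => rk nx < rk p

variable {rk : Fin m.shape.states → ℕ} (O : WeightOracle n) (F : Config n m.shape → ℝ)

/-- With enough fuel the expected value does not depend on the fuel. -/
lemma Ranked.expect_eq (h : m.Ranked rk) {N N' : ℕ} {c : Config n m.shape}
    (hN : rk c.pc ≤ N) (hN' : rk c.pc ≤ N') : m.expect O F N c = m.expect O F N' c := by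
  induction N generalizing N' c with
  | zero =>
    have hp := h c.pc
    cases N' with
    | zero => rfl
    | succ N' =>
      simp only [expect]
      generalize m.code c.pc = ins at hp
      cases ins <;> simp only at hp ⊢
      case measure next => have := hp m.initBasis; omega
      all_goals omega
  | succ N ih =>
    cases N' with
    | zero =>
      have hp := h c.pc
      simp only [expect]
      generalize m.code c.pc = ins at hp
      cases ins <;> simp only at hp ⊢
      case measure next => have := hp m.initBasis; omega
      all_goals omega
    | succ N' =>
      have hp := h c.pc
      simp only [expect]
      generalize m.code c.pc = ins at hp
      cases ins <;> simp only at hp ⊢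
      case measure next =>
        refine Finset.sum_congr rfl fun b _ => ?_
        rw [ih (N' := N')] <;> simp only <;> have := hp b <;> omega
      all_goals (apply ih <;> simp only <;> omega)

/-- The expected value of `F` at the halt, for a machine ranked by `rk`. -/
def val (m : QMachine n) (rk : Fin m.shape.states → ℕ) (O : WeightOracle n)
    (F : Config n m.shape → ℝ) (c : Config n m.shape) : ℝ :=
  m.expect O F (rk c.pc) c

variable {O F}

lemma Ranked.expect_eq_val (h : m.Ranked rk) {N : ℕ} {c : Config n m.shape}
    (hN : rk c.pc ≤ N) : m.expect O F N c = m.val rk O F c :=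
  h.expect_eq O F hN le_rfl

lemma Ranked.val_eq (h : m.Ranked rk) (c : Config n m.shape) :
    m.val rk O F c = match m.code c.pc with
    | .halt => F c
    | .gate U next => m.val rk O F { c with
          pc := next
          psi := (U : Matrix (m.shape.Basis n) (m.shape.Basis n) ℂ).mulVec c.psi
          time := c.time + 1 }
    | .measure next => ∑ b, ‖c.psi b‖ ^ 2 *
          m.val rk O F { c with pc := next b, psi := Pi.single b 1, time := c.time + 1 }
    | .read next => m.val rk O F { c with
          pc := next
          psi := fun (i, f, r, z, x) => c.psi (i, f, r, z - c.mem r, x)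
          time := c.time + 1 }
    | .write r v next => m.val rk O F
        { c with pc := next, mem := Function.update c.mem r v, time := c.time + 1 }
    | .emit i v next => m.val rk O F
        { c with pc := next, list := Function.update c.list i v, time := c.time + 1 }
    | .prep next => m.val rk O F { c with
          pc := next
          list := fun _ => 0
          loaded := some c.list
          time := c.time + O.prepTime (listSize c.list) }
    | .query next => m.val rk O F { c with
          pc := next
          psi := fun (i, f, r, z, x) => c.psi (i, f, r, z - m.queryWord O c.loaded i f, x)
          time := c.time + m.queryCost O c.loaded } := by
  have hp := h c.pc
  conv_lhs => rw [val, h.expect_eq O F le_rfl (Nat.le_succ _), expect]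
  generalize m.code c.pc = ins at hp
  cases ins <;> simp only at hp ⊢
  case measure next =>
    refine Finset.sum_congr rfl fun b _ => ?_
    rw [h.expect_eq_val]; exact (hp b).le
  all_goals (apply h.expect_eq_val; exact hp.le)

lemma expect_nonneg (hF : ∀ c, 0 ≤ F c) (N : ℕ) (c : Config n m.shape) :
    0 ≤ m.expect O F N c := by
  induction N generalizing c with
  | zero => exact hF c
  | succ N ih =>
    rw [expect]
    generalize m.code c.pc = ins
    cases ins <;> simp only
    case halt => exact hF c
    case measure next => exact Finset.sum_nonneg fun b _ => mul_nonneg (sq_nonneg _) (ih _)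
    all_goals exact ih _

lemma val_nonneg (hF : ∀ c, 0 ≤ F c) (c : Config n m.shape) : 0 ≤ m.val rk O F c :=
  expect_nonneg hF _ _

/-- The state of the work space is a unit vector. -/
def Normalized {σ : Shape} (c : Config n σ) : Prop := ∑ b, ‖c.psi b‖ ^ 2 = 1

lemma sum_norm_sq_mulVec {ι : Type*} [Fintype ι] [DecidableEq ι] (U : Matrix.unitaryGroup ι ℂ)
    (v : ι → ℂ) : ∑ b, ‖(U : Matrix ι ι ℂ).mulVec v b‖ ^ 2 = ∑ b, ‖v b‖ ^ 2 := by
  have key : ∀ w : ι → ℂ, ((∑ b, ‖w b‖ ^ 2 : ℝ) : ℂ) = dotProduct (star w) w := by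
    intro w
    simp only [dotProduct, Pi.star_apply, RCLike.star_def, Complex.ofReal_sum,
      ← Complex.normSq_eq_norm_sq, Complex.normSq_eq_conj_mul_self]
  apply Complex.ofReal_injective
  rw [key, key, Matrix.star_mulVec, Matrix.dotProduct_mulVec, Matrix.vecMul_vecMul]
  have h : (U : Matrix ι ι ℂ).conjTranspose * (U : Matrix ι ι ℂ) = 1 :=
    Matrix.UnitaryGroup.star_mul_self U
  rw [h, Matrix.vecMul_one]

/-- Adding a word that depends on the other registers permutes the basis of the work space. -/
lemma sum_shift {σ : Shape} (g : Fin n → Bool → Fin σ.cells → σ.Word)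
    (G : σ.Basis n → ℝ) :
    ∑ b : σ.Basis n, G (b.1, b.2.1, b.2.2.1, b.2.2.2.1 - g b.1 b.2.1 b.2.2.1, b.2.2.2.2) =
      ∑ b, G b := by
  refine Fintype.sum_equiv
    ⟨fun b => (b.1, b.2.1, b.2.2.1, b.2.2.2.1 - g b.1 b.2.1 b.2.2.1, b.2.2.2.2),
     fun b => (b.1, b.2.1, b.2.2.1, b.2.2.2.1 + g b.1 b.2.1 b.2.2.1, b.2.2.2.2), ?_, ?_⟩ _ _ ?_
  · rintro ⟨i, f, r, z, x⟩; simp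
  · rintro ⟨i, f, r, z, x⟩; simp
  · rintro ⟨i, f, r, z, x⟩; rfl

lemma Normalized.succ {c c' : Config n m.shape} (hc : Normalized c) (h : c' ∈ m.succs O c) :
    Normalized c' := by
  unfold succs at h
  generalize m.code c.pc = ins at h
  cases ins <;> simp only [Set.mem_singleton_iff, Set.mem_range, Set.mem_empty_iff_false] at h
  case gate U next => subst h; exact (sum_norm_sq_mulVec U c.psi).trans hc
  case measure next =>
    obtain ⟨b, rfl⟩ := h
    simp only [Normalized]
    rw [Finset.sum_eq_single b] <;> simp +contextual
  case read next =>
    subst h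
    exact (sum_shift (fun _ _ r => c.mem r) (fun b => ‖c.psi b‖ ^ 2)).trans hc
  case query next =>
    subst h
    exact (sum_shift (fun i f _ => m.queryWord O c.loaded i f) (fun b => ‖c.psi b‖ ^ 2)).trans hc
  all_goals (subst h; exact hc)

/-- A property of configurations that holds along all branches of a run may be used at the halt. -/
lemma Ranked.expect_mem_Icc (h : m.Ranked rk) {Inv : Config n m.shape → Prop}
    (hInv : ∀ c, Inv c → ∀ c' ∈ m.succs O c, Inv c') {a b : ℝ}
    (hF : ∀ c, Inv c → (m.code c.pc).IsHalt → F c ∈ Set.Icc a b) {N : ℕ}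
    {c : Config n m.shape} (hN : rk c.pc ≤ N) (hc : Normalized c) (hi : Inv c) :
    m.expect O F N c ∈ Set.Icc a b := by
  induction N generalizing c with
  | zero =>
    refine hF c hi ?_
    have hp := h c.pc
    generalize m.code c.pc = ins at hp
    cases ins <;> simp only at hp
    case halt => trivial
    case measure next => have := hp m.initBasis; omega
    all_goals omega
  | succ N ih =>
    have hp := h c.pc
    have hn := fun c' => hc.succ (O := O) (c' := c')
    have hs := hInv c hi
    have hF' := hF c hi
    rw [expect]
    unfold succs at hn hs
    generalize m.code c.pc = ins at hp hn hs hF'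
    cases ins <;> simp only [Set.mem_singleton_iff, forall_eq, Set.mem_range,
      forall_exists_index, forall_apply_eq_imp_iff] at hp hn hs hF' ⊢
    case halt => exact hF' trivial
    case measure next =>
      have key : ∀ b', m.expect O F N
          { c with pc := next b', psi := Pi.single b' 1, time := c.time + 1 } ∈ Set.Icc a b :=
        fun b' => ih (by have := hp b'; simp only; omega) (hn b') (hs b')
      constructor
      · calc a = ∑ b', ‖c.psi b'‖ ^ 2 * a := by rw [← Finset.sum_mul, hc, one_mul]
          _ ≤ _ := Finset.sum_le_sum fun b' _ =>
            mul_le_mul_of_nonneg_left (key b').1 (sq_nonneg _)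
      · calc _ ≤ ∑ b', ‖c.psi b'‖ ^ 2 * b := Finset.sum_le_sum fun b' _ =>
            mul_le_mul_of_nonneg_left (key b').2 (sq_nonneg _)
          _ = b := by rw [← Finset.sum_mul, hc, one_mul]
    all_goals exact ih (by simp only; omega) hn hs

end QMachine

/-! ### Unitaries -/

section Unitaries

variable {ι : Type*} [Fintype ι] [DecidableEq ι]

/-- The unitary `ψ ↦ (b ↦ e b * ψ (τ b))` of a permutation `τ` and phases `e`. -/
def permPhase (τ : ι ≃ ι) (e : ι → ℂ) (he : ∀ b, ‖e b‖ = 1) : Matrix.unitaryGroup ι ℂ :=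
  ⟨Matrix.of fun b b' => if b' = τ b then e b else 0, by
    rw [Matrix.mem_unitaryGroup_iff]
    ext b b'
    rw [Matrix.mul_apply, Finset.sum_eq_single (τ b)]
    · rw [Matrix.star_apply, Matrix.one_apply, Matrix.of_apply, Matrix.of_apply]
      by_cases hb : b = b'
      · subst hb
        simp only [if_true, RCLike.star_def, Complex.mul_conj, Complex.normSq_eq_norm_sq, he]
        norm_num
      · rw [if_neg hb, if_neg (fun h => hb (τ.injective h))]
        simp
    · intro c _ hc; simp [hc]
    · simp⟩

@[simp] lemma permPhase_mulVec (τ : ι ≃ ι) (e : ι → ℂ) (he : ∀ b, ‖e b‖ = 1) (ψ : ι → ℂ)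
    (b : ι) : (permPhase τ e he : Matrix ι ι ℂ).mulVec ψ b = e b * ψ (τ b) := by
  simp [permPhase, Matrix.mulVec, dotProduct]

/-- The transposition of two basis states. -/
def swapGate (b b' : ι) : Matrix.unitaryGroup ι ℂ :=
  permPhase (Equiv.swap b b') (fun _ => 1) (fun _ => by simp)

lemma swapGate_mulVec (b b' : ι) :
    (swapGate b b' : Matrix ι ι ℂ).mulVec (Pi.single b 1) = Pi.single b' 1 := by
  ext c
  simp only [swapGate, permPhase_mulVec, one_mul, Pi.single_apply]
  by_cases h : c = b'
  · subst h; simp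
  · rw [if_neg h, if_neg]
    intro hc
    rw [Equiv.swap_apply_eq_iff] at hc
    simp at hc; exact h hc

/-- The reflection `ψ ↦ 2 ⟨u, ψ⟩ u - ψ` at a unit vector `u`. -/
def reflGate (u : ι → ℂ) (hu : dotProduct (star u) u = 1) : Matrix.unitaryGroup ι ℂ :=
  ⟨(2 : ℂ) • Matrix.vecMulVec u (star u) - 1, by
    rw [Matrix.mem_unitaryGroup_iff, Matrix.star_eq_conjTranspose]
    have h1 : (Matrix.vecMulVec u (star u)).conjTranspose = Matrix.vecMulVec u (star u) := by
      ext i j; simp [Matrix.vecMulVec_apply, mul_comm]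
    have h2 : Matrix.vecMulVec u (star u) * Matrix.vecMulVec u (star u) =
        Matrix.vecMulVec u (star u) := by
      rw [Matrix.vecMulVec_mul_vecMulVec, hu]; simp
    have h3 : ((2 : ℂ) • Matrix.vecMulVec u (star u)).conjTranspose =
        (2 : ℂ) • Matrix.vecMulVec u (star u) := by
      rw [Matrix.conjTranspose_smul, h1]; simp
    rw [Matrix.conjTranspose_sub, Matrix.conjTranspose_one, h3]
    rw [sub_mul, mul_sub, mul_sub, Matrix.smul_mul, Matrix.mul_smul, h2]
    simp only [mul_one, one_mul, smul_smul]
    module⟩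

lemma reflGate_mulVec (u : ι → ℂ) (hu : dotProduct (star u) u = 1) (ψ : ι → ℂ) (b : ι) :
    (reflGate u hu : Matrix ι ι ℂ).mulVec ψ b = 2 * dotProduct (star u) ψ * u b - ψ b := by
  simp only [reflGate, Matrix.sub_mulVec, Matrix.smul_mulVec, Matrix.one_mulVec, Pi.sub_apply,
    Pi.smul_apply, smul_eq_mul, Matrix.vecMulVec_mulVec]
  simp; ring

lemma exists_unitary_mulVec_single (b : ι) (u : ι → ℂ) (hu : dotProduct (star u) u = 1) :
    ∃ U : Matrix.unitaryGroup ι ℂ, (U : Matrix ι ι ℂ).mulVec (Pi.single b 1) = u := by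
  have hv : Orthonormal ℂ (({b} : Set ι).domRestrict
      (fun _ : ι => (WithLp.toLp 2 u : EuclideanSpace ℂ ι))) := by
    rw [orthonormal_iff_ite]
    rintro ⟨i, hi⟩ ⟨j, hj⟩
    have : i = j := by simp at hi hj; rw [hi, hj]
    subst this
    rw [if_pos rfl]
    change inner ℂ (WithLp.toLp 2 u : EuclideanSpace ℂ ι) (WithLp.toLp 2 u) = 1
    rw [EuclideanSpace.inner_toLp_toLp, dotProduct_comm]; exact hu
  obtain ⟨ob, hob⟩ := hv.exists_orthonormalBasis_extension_of_card_eq (by simp)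
  refine ⟨⟨(EuclideanSpace.basisFun ι ℂ).toBasis.toMatrix ob,
    (EuclideanSpace.basisFun ι ℂ).toMatrix_orthonormalBasis_mem_unitary ob⟩, ?_⟩
  ext c
  have := hob b rfl
  simp [Module.Basis.toMatrix_apply, this]

end Unitaries

/-! ### A machine that lists marked indices -/

/-- The control states of a machine that runs a sequence of *searches*. The search is governed by
a state `s : S`; `l` counts the draws of the search, `c` the indices found so far, `j` the Grover
iterations left, `e` the found indices that were read back, and `b` is the basis state in which
the work space is known to be. -/
inductive Ctl (S B : Type) (L C I : ℕ) : Type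
  | prep (s : S) (b : B)
  | gate (s : S) (l : Fin L) (c : Fin (C + 1)) (b : B)
  | iter (s : S) (l : Fin L) (c : Fin (C + 1)) (j : Fin (I + 1))
  | phase (s : S) (l : Fin L) (c : Fin (C + 1)) (j : Fin (I + 1))
  | unquery (s : S) (l : Fin L) (c : Fin (C + 1)) (j : Fin (I + 1))
  | diffuse (s : S) (l : Fin L) (c : Fin (C + 1)) (j : Fin (I + 1))
  | look (s : S) (l : Fin L) (c : Fin (C + 1))
  | addr (s : S) (l : Fin L) (c : Fin (C + 1)) (b : B)
  | stamp (s : S) (l : Fin L) (c : Fin (C + 1)) (b : B)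
  | check (s : S) (l : Fin L) (c : Fin (C + 1)) (b : B)
  | putStamp (s : S) (l : Fin L) (c : Fin (C + 1)) (b b' : B)
  | putLog (s : S) (l : Fin L) (c : Fin (C + 1)) (b b' : B)
  | backAddr (s : S) (c : Fin (C + 1)) (e : Fin C) (b : B)
  | backRead (s : S) (c : Fin (C + 1)) (e : Fin C)
  | backLook (s : S) (c : Fin (C + 1)) (e : Fin C)
  | backEmit (s : S) (c : Fin (C + 1)) (e : Fin C) (b : B)
  | halt

namespace Ctl

variable {S B : Type} {L C I : ℕ}

/-- The fields of a control state, as a tuple. -/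
def fields : Ctl S B L C I → Fin 17 × Option S × Option (Fin L) × Option (Fin (C + 1)) ×
    Option (Fin (I + 1)) × Option (Fin C) × Option B × Option B
  | prep s b => (0, some s, none, none, none, none, some b, none)
  | gate s l c b => (1, some s, some l, some c, none, none, some b, none)
  | iter s l c j => (2, some s, some l, some c, some j, none, none, none)
  | phase s l c j => (3, some s, some l, some c, some j, none, none, none)
  | unquery s l c j => (4, some s, some l, some c, some j, none, none, none)
  | diffuse s l c j => (5, some s, some l, some c, some j, none, none, none)
  | look s l c => (6, some s, some l, some c, none, none, none, none)
  | addr s l c b => (7, some s, some l, some c, none, none, some b, none)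
  | stamp s l c b => (8, some s, some l, some c, none, none, some b, none)
  | check s l c b => (9, some s, some l, some c, none, none, some b, none)
  | putStamp s l c b b' => (10, some s, some l, some c, none, none, some b, some b')
  | putLog s l c b b' => (11, some s, some l, some c, none, none, some b, some b')
  | backAddr s c e b => (12, some s, none, some c, none, some e, some b, none)
  | backRead s c e => (13, some s, none, some c, none, some e, none, none)
  | backLook s c e => (14, some s, none, some c, none, some e, none, none)
  | backEmit s c e b => (15, some s, none, some c, none, some e, some b, none)
  | halt => (16, none, none, none, none, none, none, none)

lemma fields_injective : Function.Injective (fields : Ctl S B L C I → _) := by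
  intro a b h
  cases a <;> cases b <;> simp_all [fields]

instance [Fintype S] [Fintype B] : Fintype (Ctl S B L C I) :=
  Fintype.ofInjective _ fields_injective

lemma card_le [Fintype S] [Fintype B] : Fintype.card (Ctl S B L C I) ≤
    17 * ((Fintype.card S + 1) * ((L + 1) * ((C + 2) * ((I + 2) * ((C + 1) *
      ((Fintype.card B + 1) * (Fintype.card B + 1))))))) := by
  have := Fintype.card_le_of_injective _ (fields_injective (S := S) (B := B) (L := L) (C := C)
    (I := I))
  simpa [Fintype.card_prod, Fintype.card_option] using this

end Ctl

/-- A sequence of searches for marked indices. In the state `s`, the index `i`, for which the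
weight oracle (queried with the flag `flag s i`) returns the word `z`, is marked if
`pick s i z = some v`; then `v` is a code for the pair `item v` of an index and a weight. If at
most `cap s` indices are marked, the search is accepted: their list of weights is handed to the
oracle, and the search `onAcc s` follows. Otherwise it is rejected, and `onRej s` follows. The
entry `sched[l]` is the number of Grover iterations in the `l`-th draw of a search. -/
structure Search (n : ℕ) where
  State : Type
  [fintypeState : Fintype State]
  maxWord : ℕ
  unit : ℝ
  unit_pos : 0 < unit
  sched : List ℕ
  iterMax : ℕ
  sched_le : ∀ J ∈ sched, J ≤ iterMax
  capMax : ℕ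
  idx : Fin n
  first : State
  depth : State → ℕ
  depth_lt : ∀ s, depth s < maxWord
  flag : State → Fin n → Bool
  pick : State → Fin n → Fin (maxWord + 1) → Option (Fin (maxWord + 1))
  item : Fin (maxWord + 1) → Fin n × Fin (maxWord + 1)
  cap : State → ℕ
  cap_le : ∀ s, cap s ≤ capMax
  onAcc : State → Option State
  onRej : State → Option State
  acc_lt : ∀ {s s'}, onAcc s = some s' → depth s' < depth s
  rej_lt : ∀ {s s'}, onRej s = some s' → depth s' < depth s

namespace Search

attribute [instance] Search.fintypeState

variable {n : ℕ} (A : Search n)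

/-- Basis states of the work space. -/
abbrev Bas : Type := Fin n × Bool × Fin (n + A.capMax) × Fin (A.maxWord + 1) × Fin 1

/-- Control states. -/
abbrev Q : Type := Ctl A.State A.Bas A.sched.length A.capMax A.iterMax

/-- Control states are numbered. -/
def num : A.Q ≃ Fin (Fintype.card A.Q) := Fintype.equivFin A.Q

/-- The sizes of the machine. -/
abbrev shape : Shape := ⟨Fintype.card A.Q, n + A.capMax, A.maxWord, 1⟩

/-- The address of the stamp of an index. -/
def stampAddr (i : Fin n) : Fin (n + A.capMax) := Fin.castAdd _ i

/-- The address of an entry of the log. -/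
def logAddr (e : Fin A.capMax) : Fin (n + A.capMax) := Fin.natAdd _ e

/-- The stamp of the indices that were found in the state `s`. It depends on `s`, so that stamps
need not be erased. -/
def stampWord (s : A.State) : Fin (A.maxWord + 1) :=
  ⟨A.depth s + 1, Nat.succ_lt_succ (A.depth_lt s)⟩

/-- The vector with amplitude `φ i` at the basis state with index `i`, its flag, and the word
`z i`. -/
def spread (s : A.State) (φ : Fin n → ℂ) (z : Fin n → Fin (A.maxWord + 1)) : A.Bas → ℂ :=
  fun b => if b.2.1 = A.flag s b.1 ∧ b.2.2.1 = A.stampAddr A.idx ∧ b.2.2.2.1 = z b.1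
    then φ b.1 else 0

lemma sum_spread {R : Type*} [AddCommMonoid R] (s : A.State) (z : Fin n → Fin (A.maxWord + 1))
    (G : A.Bas → R) :
    (∑ b : A.Bas, if b.2.1 = A.flag s b.1 ∧ b.2.2.1 = A.stampAddr A.idx ∧ b.2.2.2.1 = z b.1
      then G b else 0) = ∑ i, G (i, A.flag s i, A.stampAddr A.idx, z i, 0) := by
  rw [← Finset.sum_filter]
  symm
  refine Finset.sum_bij (fun i _ => (i, A.flag s i, A.stampAddr A.idx, z i, 0)) ?_ ?_ ?_ ?_
  · simp
  · intro i _ j _ h; exact (Prod.ext_iff.mp h).1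
  · rintro ⟨i, f, r, w, x⟩ h
    simp only [Finset.mem_filter, Finset.mem_univ, true_and] at h
    obtain ⟨rfl, rfl, rfl⟩ := h
    exact ⟨i, Finset.mem_univ _, by rw [Subsingleton.elim x 0]⟩
  · simp

/-- The uniform superposition of the indices. -/
def uniform (s : A.State) : A.Bas → ℂ := A.spread s (fun _ => ((√(n : ℝ))⁻¹ : ℝ)) 0

lemma star_uniform (s : A.State) : star (A.uniform s) = A.uniform s := by
  ext b; simp only [uniform, spread, Pi.star_apply]
  split_ifs <;> simp

lemma dotProduct_uniform (s : A.State) (φ : Fin n → ℂ) :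
    dotProduct (star (A.uniform s)) (A.spread s φ 0) = ((√(n : ℝ))⁻¹ : ℝ) * ∑ i, φ i := by
  rw [star_uniform, dotProduct]
  have : ∀ b : A.Bas, A.uniform s b * A.spread s φ 0 b =
      if b.2.1 = A.flag s b.1 ∧ b.2.2.1 = A.stampAddr A.idx ∧
        b.2.2.2.1 = (0 : Fin n → Fin (A.maxWord + 1)) b.1
      then ((√(n : ℝ))⁻¹ : ℝ) * φ b.1 else 0 := by
    intro b; simp only [uniform, spread]; split_ifs <;> simp
  rw [Finset.sum_congr rfl fun b _ => this b, A.sum_spread s 0, Finset.mul_sum]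

lemma uniform_unit (s : A.State) : dotProduct (star (A.uniform s)) (A.uniform s) = 1 := by
  have hn : (0 : ℝ) < n := by exact_mod_cast A.idx.pos
  refine (A.dotProduct_uniform s _).trans ?_
  rw [Finset.sum_const, Finset.card_univ, Fintype.card_fin, nsmul_eq_mul]
  have h : √(n : ℝ) * √n = n := Real.mul_self_sqrt hn.le
  have h0 : √(n : ℝ) ≠ 0 := (Real.sqrt_pos.mpr hn).ne'
  rw [← Complex.ofReal_natCast, ← Complex.ofReal_mul, ← Complex.ofReal_mul, ← Complex.ofReal_one]
  congr 1
  field_simp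
  rw [sq, h]

/-- A unitary that maps a basis state to the uniform superposition. -/
def prepGate (s : A.State) (b : A.Bas) : Matrix.unitaryGroup A.Bas ℂ :=
  (exists_unitary_mulVec_single b (A.uniform s) (A.uniform_unit s)).choose

lemma prepGate_mulVec (s : A.State) (b : A.Bas) :
    (A.prepGate s b : Matrix A.Bas A.Bas ℂ).mulVec (Pi.single b 1) = A.uniform s :=
  (exists_unitary_mulVec_single b (A.uniform s) (A.uniform_unit s)).choose_spec

/-- The sign of an index with a given word: `-1` if it is marked. -/
def sgn (s : A.State) (i : Fin n) (z : Fin (A.maxWord + 1)) : ℂ :=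
  if (A.pick s i z).isSome then -1 else 1

/-- The gate that negates the word (so that another query uncomputes it) and marks by a sign. -/
def phaseGate (s : A.State) : Matrix.unitaryGroup A.Bas ℂ :=
  permPhase ⟨fun b => (b.1, b.2.1, b.2.2.1, -b.2.2.2.1, b.2.2.2.2),
      fun b => (b.1, b.2.1, b.2.2.1, -b.2.2.2.1, b.2.2.2.2),
      fun b => by simp, fun b => by simp⟩
    (fun b => A.sgn s b.1 (-b.2.2.2.1)) (fun b => by unfold sgn; split_ifs <;> simp)

/-- The basis state that addresses the stamp of the index of `b`. -/
def atStamp (b : A.Bas) : A.Bas := (b.1, b.2.1, A.stampAddr b.1, 0, 0)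

/-- The basis state that addresses an entry of the log. -/
def atLog (e : Fin A.capMax) : A.Bas := (A.idx, false, A.logAddr e, 0, 0)

/-- The control state after acceptance. -/
def acc (s : A.State) (b : A.Bas) : A.Q :=
  match A.onAcc s with
  | some s' => .prep s' b
  | none => .halt

/-- The control state before the `e`-th entry of a log with `c` entries is read back. -/
def back (s : A.State) (c : Fin (A.capMax + 1)) (e : ℕ) (b : A.Bas) : A.Q :=
  if h : e < c then .backAddr s c ⟨e, h.trans_le (Nat.le_of_lt_succ c.2)⟩ b else A.acc s b

/-- The control state before the `l`-th draw. -/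
def draw (s : A.State) (l : ℕ) (c : Fin (A.capMax + 1)) (b : A.Bas) : A.Q :=
  if h : l < A.sched.length then .gate s ⟨l, h⟩ c b else A.back s c 0 b

/-- The control state after rejection. -/
def rej (s : A.State) (b : A.Bas) : A.Q :=
  match A.onRej s with
  | some s' => A.draw s' 0 0 b
  | none => .halt

/-- The number of iterations in the `l`-th draw. -/
def reps (l : Fin A.sched.length) : Fin (A.iterMax + 1) :=
  ⟨A.sched[l], Nat.lt_succ_of_le (A.sched_le _ (List.getElem_mem _))⟩

/-- The program. -/
def program : A.Q → Instr n A.shape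
  | .prep s b => .prep (A.num (A.draw s 0 0 b))
  | .gate s l c b => .gate (A.prepGate s b) (A.num (.iter s l c (A.reps l)))
  | .iter s l c j => .query (A.num (if (j : ℕ) = 0 then .look s l c
      else .phase s l c ⟨j - 1, (Nat.sub_le _ _).trans_lt j.2⟩))
  | .phase s l c j => .gate (A.phaseGate s) (A.num (.unquery s l c j))
  | .unquery s l c j => .query (A.num (.diffuse s l c j))
  | .diffuse s l c j => .gate (reflGate (A.uniform s) (A.uniform_unit s))
      (A.num (.iter s l c j))
  | .look s l c => .measure fun b => A.num <|
      if (A.pick s b.1 b.2.2.2.1).isSome then .addr s l c b else A.draw s (l + 1) c b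
  | .addr s l c b => .gate (swapGate b (A.atStamp b)) (A.num (.stamp s l c b))
  | .stamp s l c b => .read (A.num (.check s l c b))
  | .check s l c b => .measure fun b' => A.num <|
      if b'.2.2.2.1 = A.stampWord s then A.draw s (l + 1) c b'
      else if (c : ℕ) < A.cap s then .putStamp s l c b b' else A.rej s b'
  | .putStamp s l c b b' =>
      .write (A.stampAddr b.1) (A.stampWord s) (A.num (.putLog s l c b b'))
  | .putLog s l c b b' =>
      if h : (c : ℕ) < A.capMax then
        .write (A.logAddr ⟨c, h⟩) ((A.pick s b.1 b.2.2.2.1).getD 0)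
          (A.num (A.draw s (l + 1) ⟨c + 1, Nat.succ_lt_succ h⟩ b'))
      else .halt
  | .backAddr s c e b => .gate (swapGate b (A.atLog e)) (A.num (.backRead s c e))
  | .backRead s c e => .read (A.num (.backLook s c e))
  | .backLook s c e => .measure fun b => A.num (.backEmit s c e b)
  | .backEmit s c e b => .emit (A.item b.2.2.2.1).1 (A.item b.2.2.2.1).2
      (A.num (A.back s c (e + 1) b))
  | .halt => .halt

/-- The machine of a sequence of searches. -/
abbrev machine : QMachine n where
  shape := A.shape
  scale := 1
  scale_pos := one_pos
  unit := A.unit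
  unit_pos := A.unit_pos
  start := A.num (.prep A.first (A.atStamp (A.idx, false, A.stampAddr A.idx, 0, 0)))
  initBasis := A.atStamp (A.idx, false, A.stampAddr A.idx, 0, 0)
  code p := A.program (A.num.symm p)

/-! ### The running time of a search -/

/-- The number of steps that the draws `l, l + 1, …` of a search take. -/
def drawSteps (l : ℕ) : ℕ := ((A.sched.drop l).map fun J => 4 * J + 8).sum

lemma drawSteps_of_lt (l : Fin A.sched.length) :
    A.drawSteps l = 4 * A.reps l + 8 + A.drawSteps (l + 1) := by
  rw [drawSteps, List.drop_eq_getElem_cons l.2, List.map_cons, List.sum_cons]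
  rfl

/-- The number of steps that a search takes. -/
def trySteps : ℕ := A.drawSteps 0 + 4 * A.capMax + 1

/-- The number of steps until the halt. -/
def rank : A.Q → ℕ
  | .prep s _ => A.depth s * A.trySteps + A.trySteps
  | .gate s l _ _ => A.depth s * A.trySteps + 4 * A.capMax + A.drawSteps l
  | .iter s l _ j => A.depth s * A.trySteps + 4 * A.capMax + A.drawSteps (l + 1) + 4 * j + 7
  | .phase s l _ j => A.depth s * A.trySteps + 4 * A.capMax + A.drawSteps (l + 1) + 4 * j + 10
  | .unquery s l _ j => A.depth s * A.trySteps + 4 * A.capMax + A.drawSteps (l + 1) + 4 * j + 9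
  | .diffuse s l _ j => A.depth s * A.trySteps + 4 * A.capMax + A.drawSteps (l + 1) + 4 * j + 8
  | .look s l _ => A.depth s * A.trySteps + 4 * A.capMax + A.drawSteps (l + 1) + 6
  | .addr s l _ _ => A.depth s * A.trySteps + 4 * A.capMax + A.drawSteps (l + 1) + 5
  | .stamp s l _ _ => A.depth s * A.trySteps + 4 * A.capMax + A.drawSteps (l + 1) + 4
  | .check s l _ _ => A.depth s * A.trySteps + 4 * A.capMax + A.drawSteps (l + 1) + 3
  | .putStamp s l _ _ _ => A.depth s * A.trySteps + 4 * A.capMax + A.drawSteps (l + 1) + 2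
  | .putLog s l _ _ _ => A.depth s * A.trySteps + 4 * A.capMax + A.drawSteps (l + 1) + 1
  | .backAddr s c e _ => A.depth s * A.trySteps + 4 * (c - e - 1) + 4
  | .backRead s c e => A.depth s * A.trySteps + 4 * (c - e - 1) + 3
  | .backLook s c e => A.depth s * A.trySteps + 4 * (c - e - 1) + 2
  | .backEmit s c e _ => A.depth s * A.trySteps + 4 * (c - e - 1) + 1
  | .halt => 0

lemma rank_acc_le (s : A.State) (b : A.Bas) : A.rank (A.acc s b) ≤ A.depth s * A.trySteps := by
  unfold acc
  split
  · rename_i s' h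
    calc A.depth s' * A.trySteps + A.trySteps = (A.depth s' + 1) * A.trySteps := by ring
      _ ≤ _ := Nat.mul_le_mul_right _ (A.acc_lt h)
  · exact Nat.zero_le _

lemma rank_back_le (s : A.State) (c : Fin (A.capMax + 1)) (e : ℕ) (b : A.Bas) :
    A.rank (A.back s c e b) ≤ A.depth s * A.trySteps + 4 * (c - e) := by
  unfold back
  split
  · simp only [rank]; omega
  · exact (A.rank_acc_le s b).trans (Nat.le_add_right _ _)

lemma rank_draw_le (s : A.State) (l : ℕ) (c : Fin (A.capMax + 1)) (b : A.Bas) :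
    A.rank (A.draw s l c b) ≤ A.depth s * A.trySteps + 4 * A.capMax + A.drawSteps l := by
  unfold draw
  split
  · exact le_rfl
  · have := A.rank_back_le s c 0 b
    have := c.2
    omega

lemma rank_rej_le (s : A.State) (b : A.Bas) : A.rank (A.rej s b) ≤ A.depth s * A.trySteps := by
  unfold rej
  split
  · rename_i s' h
    have h1 := A.rank_draw_le s' 0 0 b
    calc _ ≤ (A.depth s' + 1) * A.trySteps := by
          rw [add_mul, one_mul]; rw [trySteps] at h1 ⊢; omega
      _ ≤ _ := Nat.mul_le_mul_right _ (A.rej_lt h)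
  · exact Nat.zero_le _

/-- The rank as a function on numbered control states. -/
def rk (p : Fin A.machine.shape.states) : ℕ := A.rank (A.num.symm p)

@[simp] lemma rk_num (q : A.Q) : A.rk (A.num q) = A.rank q := by
  exact congrArg A.rank (A.num.symm_apply_apply q)

@[simp] lemma code_num (q : A.Q) : A.machine.code (A.num q) = A.program q :=
  congrArg A.program (A.num.symm_apply_apply q)

lemma ranked : A.machine.Ranked A.rk := by
  intro p
  obtain ⟨q, rfl⟩ := A.num.surjective p
  rw [code_num]
  cases q <;> simp only [program, rk_num]
  case prep s b =>
    refine (A.rank_draw_le s 0 0 b).trans_lt ?_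
    simp only [rank]; rw [trySteps]; omega
  case gate s l c b => simp only [rank]; rw [drawSteps_of_lt]; omega
  case iter s l c j => split <;> simp only [rank] <;> omega
  case look s l c =>
    intro b
    split
    · simp only [rank]; omega
    · refine (A.rank_draw_le s (l + 1) c b).trans_lt ?_
      simp only [rank]; omega
  case check s l c b =>
    intro b'
    split
    · refine (A.rank_draw_le s (l + 1) c b').trans_lt ?_
      simp only [rank]; omega
    · split
      · simp only [rank]; omega
      · refine (A.rank_rej_le s b').trans_lt ?_
        simp only [rank]; omega
  case putLog s l c b b' =>
    by_cases h : (c : ℕ) < A.capMax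
    · rw [dif_pos h]
      simp only [rk_num]
      refine (A.rank_draw_le s (l + 1) ⟨c + 1, Nat.succ_lt_succ h⟩ b').trans_lt ?_
      simp only [rank]; omega
    · rw [dif_neg h]; trivial
  case backEmit s c e b =>
    refine (A.rank_back_le s c (e + 1) b).trans_lt ?_
    simp only [rank]; omega
  all_goals (simp only [rank]; omega)

/-! ### Bounds that hold in every branch -/

section Sure

variable (P₁ P₂ T₁ T₂ T : ℕ)

/-- The number of preprocessing steps that can still follow. -/
def prepsLeft : A.Q → ℕ
  | .prep s _ => A.depth s + 1
  | .gate s _ _ _ | .iter s _ _ _ | .phase s _ _ _ | .unquery s _ _ _ | .diffuse s _ _ _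
  | .look s _ _ | .addr s _ _ _ | .stamp s _ _ _ | .check s _ _ _ | .putStamp s _ _ _ _
  | .putLog s _ _ _ _ | .backAddr s _ _ _ | .backRead s _ _ | .backLook s _ _
  | .backEmit s _ _ _ => A.depth s
  | .halt => 0

/-- The size of the current list is bounded in terms of the control state. -/
def ListBound : A.Q → ℕ → Prop
  | .prep _ _, k => k ≤ P₁
  | .gate s _ c _, k | .iter s _ c _, k | .phase s _ c _, k | .unquery s _ c _, k
  | .diffuse s _ c _, k | .look s _ c, k | .addr s _ c _, k | .stamp s _ c _, k
  | .check s _ c _, k => k = 0 ∧ c ≤ A.cap s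
  | .putStamp s _ c _ _, k | .putLog s _ c _ _, k => k = 0 ∧ c < A.cap s
  | .backAddr s c e _, k | .backRead s c e, k | .backLook s c e, k | .backEmit s c e _, k =>
      k ≤ e ∧ (e : ℕ) < c ∧ c ≤ A.cap s
  | .halt, k => k ≤ P₂

/-- What holds in every configuration of a run: bounds on the lists, and on the time. -/
def Inv (c : Config n A.shape) : Prop :=
  A.ListBound P₁ P₂ (A.num.symm c.pc) (listSize c.list) ∧
    (∀ Y, c.loaded = some Y → listSize Y ≤ P₁) ∧
    c.time + T₁ * A.prepsLeft (A.num.symm c.pc) + T₂ * A.rank (A.num.symm c.pc) ≤ T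

end Sure

end Search

namespace Search
variable {n : ℕ} (A : Search n)

section Sure

variable {P₁ P₂ T₁ T₂ T : ℕ} {A}

lemma listSize_zero {σ : Shape} : listSize (fun _ : Fin n => (0 : σ.Word)) = 0 := by
  simp [listSize]

lemma listSize_update_le {σ : Shape} (v : Fin n → σ.Word) (i : Fin n) (x : σ.Word) :
    listSize (Function.update v i x) ≤ listSize v + 1 := by
  unfold listSize
  refine (Finset.card_le_card (t := insert i (Finset.univ.filter fun i => v i ≠ 0)) ?_).trans
    (Finset.card_insert_le _ _)
  intro k hk
  by_cases h : k = i <;> simp_all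

lemma listBound_acc (h₁ : ∀ s s', A.onAcc s = some s' → A.cap s ≤ P₁)
    (h₂ : ∀ s, A.onAcc s = none → A.cap s ≤ P₂) {s : A.State} {b : A.Bas} {k : ℕ}
    (hk : k ≤ A.cap s) : A.ListBound P₁ P₂ (A.acc s b) k := by
  unfold acc
  split
  · rename_i s' h; exact hk.trans (h₁ s s' h)
  · rename_i h; exact hk.trans (h₂ s h)

lemma listBound_back (h₁ : ∀ s s', A.onAcc s = some s' → A.cap s ≤ P₁)
    (h₂ : ∀ s, A.onAcc s = none → A.cap s ≤ P₂) {s : A.State} {c : Fin (A.capMax + 1)} {e : ℕ}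
    {b : A.Bas} {k : ℕ} (hk : k ≤ e) (he : e ≤ c) (hc : c ≤ A.cap s) :
    A.ListBound P₁ P₂ (A.back s c e b) k := by
  unfold back
  split
  · rename_i h; exact ⟨hk, h, hc⟩
  · exact listBound_acc h₁ h₂ (hk.trans (he.trans hc))

lemma listBound_draw (h₁ : ∀ s s', A.onAcc s = some s' → A.cap s ≤ P₁)
    (h₂ : ∀ s, A.onAcc s = none → A.cap s ≤ P₂) {s : A.State} {l : ℕ}
    {c : Fin (A.capMax + 1)} {b : A.Bas} {k : ℕ} (hk : k = 0) (hc : c ≤ A.cap s) :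
    A.ListBound P₁ P₂ (A.draw s l c b) k := by
  unfold draw
  split
  · exact ⟨hk, hc⟩
  · exact listBound_back h₁ h₂ hk.le (Nat.zero_le _) hc

lemma listBound_rej (h₁ : ∀ s s', A.onAcc s = some s' → A.cap s ≤ P₁)
    (h₂ : ∀ s, A.onAcc s = none → A.cap s ≤ P₂) {s : A.State} {b : A.Bas} {k : ℕ}
    (hk : k = 0) : A.ListBound P₁ P₂ (A.rej s b) k := by
  unfold rej
  split
  · exact listBound_draw h₁ h₂ hk (Nat.zero_le _)
  · exact hk.le.trans (Nat.zero_le _)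

lemma prepsLeft_acc_le (s : A.State) (b : A.Bas) : A.prepsLeft (A.acc s b) ≤ A.depth s := by
  unfold acc
  split
  · rename_i s' h; exact A.acc_lt h
  · exact Nat.zero_le _

lemma prepsLeft_draw_le (s : A.State) (l : ℕ) (c : Fin (A.capMax + 1)) (b : A.Bas) :
    A.prepsLeft (A.draw s l c b) ≤ A.depth s := by
  unfold draw back
  split
  · exact le_rfl
  · split
    · exact le_rfl
    · exact prepsLeft_acc_le s b

lemma prepsLeft_rej_le (s : A.State) (b : A.Bas) : A.prepsLeft (A.rej s b) ≤ A.depth s := by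
  unfold rej
  split
  · rename_i s' h; exact (prepsLeft_draw_le s' 0 0 b).trans (A.rej_lt h).le
  · exact Nat.zero_le _

lemma Inv.of_step {c c' : Config n A.shape} {q q' : A.Q}
    (h : A.Inv P₁ P₂ T₁ T₂ T c) (hq : c.pc = A.num q) (hq' : c'.pc = A.num q')
    (hlist : A.ListBound P₁ P₂ q (listSize c.list) → A.ListBound P₁ P₂ q' (listSize c'.list))
    (hload : c'.loaded = c.loaded) (hrk : A.rank q' < A.rank q)
    (hpr : A.prepsLeft q' ≤ A.prepsLeft q) (ht : c'.time ≤ c.time + T₂) :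
    A.Inv P₁ P₂ T₁ T₂ T c' := by
  obtain ⟨h1, h2, h3⟩ := h
  rw [hq, A.num.symm_apply_apply] at h1 h3
  refine ⟨?_, by rwa [hload], ?_⟩
  · rw [hq', A.num.symm_apply_apply]; exact hlist h1
  · rw [hq', A.num.symm_apply_apply]
    have a1 : T₂ * (A.rank q' + 1) ≤ T₂ * A.rank q := Nat.mul_le_mul_left _ hrk
    have a2 := Nat.mul_le_mul_left T₁ hpr
    rw [mul_add, mul_one] at a1
    omega

lemma inv_succ {O : WeightOracle n} (h₁ : ∀ s s', A.onAcc s = some s' → A.cap s ≤ P₁)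
    (h₂ : ∀ s, A.onAcc s = none → A.cap s ≤ P₂) (hT₁ : ∀ k ≤ P₁, O.prepTime k ≤ T₁)
    (hT₂ : ∀ k ≤ P₁, O.queryTime k ≤ T₂) (hT : 1 ≤ T₂) (c : Config n A.shape)
    (h : A.Inv P₁ P₂ T₁ T₂ T c) : ∀ c' ∈ A.machine.succs O c, A.Inv P₁ P₂ T₁ T₂ T c' := by
  have hqc : A.machine.queryCost O c.loaded ≤ T₂ := by
    unfold QMachine.queryCost
    split
    · exact hT
    · rename_i Y hY; exact hT₂ _ (h.2.1 _ hY)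
  obtain ⟨q, hq⟩ := A.num.surjective c.pc
  have hrk := A.ranked c.pc
  intro c' hc'
  unfold QMachine.succs at hc'
  rw [← hq, code_num] at hrk hc'
  replace hq := hq.symm
  cases q <;> simp only [program, Set.mem_singleton_iff, Set.mem_range, rk_num] at hc' hrk
  case prep s b =>
    subst hc'
    obtain ⟨a1, a2, a3⟩ := h
    rw [hq, A.num.symm_apply_apply] at a1 a3
    refine ⟨?_, ?_, ?_⟩
    · simp only [A.num.symm_apply_apply]
      exact listBound_draw h₁ h₂ listSize_zero (Nat.zero_le _)
    · intro Y hY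
      obtain rfl := Option.some.inj hY
      exact a1
    · simp only [A.num.symm_apply_apply]
      have b1 : T₂ * (A.rank (A.draw s 0 0 b) + 1) ≤ T₂ * A.rank (Ctl.prep s b : A.Q) :=
        Nat.mul_le_mul_left _ hrk
      have b2 : T₁ * A.prepsLeft (A.draw s 0 0 b) ≤ T₁ * A.depth s :=
        Nat.mul_le_mul_left T₁ (prepsLeft_draw_le s 0 0 b)
      have b3 : T₁ * A.prepsLeft (Ctl.prep s b : A.Q) = T₁ * A.depth s + T₁ := by
        simp only [prepsLeft]; ring
      rw [mul_add, mul_one] at b1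
      refine (Nat.add_le_add_right (Nat.add_le_add (Nat.add_le_add_left (hT₁ _ a1) _) b2)
        _).trans ?_
      omega
  case gate s l cc b =>
    subst hc'
    exact h.of_step hq rfl id rfl hrk le_rfl (Nat.add_le_add_left hT _)
  case iter s l cc j =>
    subst hc'
    refine h.of_step hq rfl ?_ rfl hrk ?_ (Nat.add_le_add_left hqc _)
    · split <;> exact id
    · split <;> exact le_rfl
  case phase s l cc j =>
    subst hc'
    exact h.of_step hq rfl id rfl hrk le_rfl (Nat.add_le_add_left hT _)
  case unquery s l cc j =>
    subst hc'
    exact h.of_step hq rfl id rfl hrk le_rfl (Nat.add_le_add_left hqc _)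
  case diffuse s l cc j =>
    subst hc'
    exact h.of_step hq rfl id rfl hrk le_rfl (Nat.add_le_add_left hT _)
  case look s l cc =>
    obtain ⟨b, rfl⟩ := hc'
    refine h.of_step hq rfl ?_ rfl (hrk b) ?_ (Nat.add_le_add_left hT _)
    · split
      · exact id
      · exact fun hl => listBound_draw h₁ h₂ hl.1 hl.2
    · split
      · exact le_rfl
      · exact prepsLeft_draw_le _ _ _ _
  case addr s l cc b =>
    subst hc'
    exact h.of_step hq rfl id rfl hrk le_rfl (Nat.add_le_add_left hT _)
  case stamp s l cc b =>
    subst hc'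
    exact h.of_step hq rfl id rfl hrk le_rfl (Nat.add_le_add_left hT _)
  case check s l cc b =>
    obtain ⟨b', rfl⟩ := hc'
    refine h.of_step hq rfl ?_ rfl (hrk b') ?_ (Nat.add_le_add_left hT _)
    · intro hl
      split
      · exact listBound_draw h₁ h₂ hl.1 hl.2
      · split
        · rename_i hc; exact ⟨hl.1, hc⟩
        · exact listBound_rej h₁ h₂ hl.1
    · split
      · exact prepsLeft_draw_le _ _ _ _
      · split
        · exact le_rfl
        · exact prepsLeft_rej_le _ _
  case putStamp s l cc b b' =>
    subst hc'
    exact h.of_step hq rfl id rfl hrk le_rfl (Nat.add_le_add_left hT _)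
  case putLog s l cc b b' =>
    have hl := h.1
    rw [hq, A.num.symm_apply_apply] at hl
    have hcc : (cc : ℕ) < A.capMax := hl.2.trans_le (A.cap_le s)
    rw [dif_pos hcc] at hc' hrk
    simp only [Set.mem_singleton_iff, rk_num] at hc' hrk
    subst hc'
    exact h.of_step hq rfl (fun _ => listBound_draw h₁ h₂ hl.1 hl.2) rfl hrk
      (prepsLeft_draw_le _ _ _ _) (Nat.add_le_add_left hT _)
  case backAddr s cc e b =>
    subst hc'
    exact h.of_step hq rfl id rfl hrk le_rfl (Nat.add_le_add_left hT _)
  case backRead s cc e =>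
    subst hc'
    exact h.of_step hq rfl id rfl hrk le_rfl (Nat.add_le_add_left hT _)
  case backLook s cc e =>
    obtain ⟨b, rfl⟩ := hc'
    exact h.of_step hq rfl id rfl (hrk b) le_rfl (Nat.add_le_add_left hT _)
  case backEmit s cc e b =>
    subst hc'
    refine h.of_step hq rfl ?_ rfl hrk ?_ (Nat.add_le_add_left hT _)
    · intro hl
      exact listBound_back h₁ h₂ ((listSize_update_le _ _ _).trans (Nat.succ_le_succ hl.1))
        hl.2.1 hl.2.2
    · unfold back
      split
      · exact le_rfl
      · exact prepsLeft_acc_le s b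
  case halt => exact absurd hc' (Set.notMem_empty _)

end Sure

end Search

/-! ### Amplitudes of the Grover iteration -/

section Grover

variable {n : ℕ} (M : Finset (Fin n))

/-- Amplitudes after `j` Grover iterations that start in the uniform superposition and mark the
set `M`. -/
def groverAmp : ℕ → Fin n → ℝ
  | 0, _ => (√(n : ℝ))⁻¹
  | j + 1, i => 2 * ((n : ℝ)⁻¹ * ∑ k, (if k ∈ M then -1 else 1) * groverAmp j k) -
      (if i ∈ M then -1 else 1) * groverAmp j i

/-- The probability that a measurement after `J` Grover iterations gives a fixed one of `m` marked
indices among `n`. -/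
def hitProb (n m J : ℕ) : ℝ := Real.sin ((2 * J + 1) * Real.arcsin √(m / n)) ^ 2 / m

lemma sum_groverAmp_sq (hn : 0 < n) (j : ℕ) : ∑ i, groverAmp M j i ^ 2 = 1 := by
  have hn' : (0 : ℝ) < n := by exact_mod_cast hn
  induction j with
  | zero =>
    simp only [groverAmp, Finset.sum_const, Finset.card_univ, Fintype.card_fin, nsmul_eq_mul]
    rw [inv_pow, Real.sq_sqrt hn'.le, mul_inv_cancel₀ hn'.ne']
  | succ j ih =>
    simp only [groverAmp]
    generalize hS : ∑ k, (if k ∈ M then (-1 : ℝ) else 1) * groverAmp M j k = S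
    have h1 : ∀ i, (2 * ((n : ℝ)⁻¹ * S) - (if i ∈ M then -1 else 1) * groverAmp M j i) ^ 2 =
        4 * ((n : ℝ)⁻¹ * S) ^ 2 - 4 * ((n : ℝ)⁻¹ * S) *
          ((if i ∈ M then -1 else 1) * groverAmp M j i) + groverAmp M j i ^ 2 := by
      intro i; split_ifs <;> ring
    have h2 : ∑ k, 4 * ((n : ℝ)⁻¹ * S) * ((if k ∈ M then -1 else 1) * groverAmp M j k) =
        4 * ((n : ℝ)⁻¹ * S) * S := by rw [← Finset.mul_sum, hS]
    rw [Finset.sum_congr rfl fun i _ => h1 i, Finset.sum_add_distrib, Finset.sum_sub_distrib, ih,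
      h2, Finset.sum_const, Finset.card_univ, Fintype.card_fin, nsmul_eq_mul]
    field_simp
    ring

lemma groverAmp_eq (hn : 0 < n) (j : ℕ) (i : Fin n) :
    groverAmp M j i = if i ∈ M
      then Real.sin ((2 * j + 1) * Real.arcsin √(M.card / n)) /
        (√n * Real.sin (Real.arcsin √(M.card / n)))
      else Real.cos ((2 * j + 1) * Real.arcsin √(M.card / n)) /
        (√n * Real.cos (Real.arcsin √(M.card / n))) := by
  have hn' : (0 : ℝ) < n := by exact_mod_cast hn
  have hsq : √(n : ℝ) * √n = n := Real.mul_self_sqrt hn'.le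
  have hs0 : √(n : ℝ) ≠ 0 := (Real.sqrt_pos.mpr hn').ne'
  have hm : (M.card : ℝ) ≤ n := by
    have := M.card_le_univ; rw [Fintype.card_fin] at this; exact_mod_cast this
  have hmn : (M.card : ℝ) / n ≤ 1 := (div_le_one hn').mpr hm
  set θ := Real.arcsin √(M.card / n) with hθ
  have hsin : Real.sin θ = √(M.card / n) :=
    Real.sin_arcsin (by linarith [Real.sqrt_nonneg ((M.card : ℝ) / n)])
      (Real.sqrt_le_one.mpr hmn)
  have hsin2 : Real.sin θ ^ 2 = M.card / n := by
    rw [hsin, Real.sq_sqrt (by positivity)]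
  have hcos2 : Real.cos θ ^ 2 = 1 - M.card / n := by rw [Real.cos_sq', hsin2]
  have e1 : (M.card : ℝ) = n * Real.sin θ ^ 2 := by rw [hsin2]; field_simp
  have e2 : (n : ℝ) - M.card = n * Real.cos θ ^ 2 := by rw [hcos2]; field_simp
  -- on each of the two sets the formula is used only where its denominator does not vanish
  have hM : ∀ i ∈ M, Real.sin θ ≠ 0 := by
    intro i hi h0
    have : (0 : ℝ) < M.card := by exact_mod_cast Finset.card_pos.mpr ⟨i, hi⟩
    rw [h0] at e1; norm_num at e1; exact (Finset.card_pos.mpr ⟨i, hi⟩).ne' (by simp [e1])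
  have hMc : ∀ i ∉ M, Real.cos θ ≠ 0 := by
    intro i hi h0
    have h3 : M.card < n := by
      have := Finset.card_lt_univ_of_notMem hi
      rwa [Fintype.card_fin] at this
    have : (M.card : ℝ) < n := by exact_mod_cast h3
    rw [h0] at e2; norm_num at e2; linarith
  induction j generalizing i with
  | zero =>
    simp only [groverAmp, Nat.cast_zero, mul_zero, zero_add, one_mul]
    split_ifs with h
    · have := hM i h; field_simp
    · have := hMc i h; field_simp
  | succ j ih =>
    have hsum : ∑ k, (if k ∈ M then (-1 : ℝ) else 1) * groverAmp M j k =
        √n * Real.cos ((2 * j + 1) * θ + θ) := by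
      have : ∀ k, (if k ∈ M then (-1 : ℝ) else 1) * groverAmp M j k =
          if k ∈ M then -(Real.sin ((2 * j + 1) * θ) / (√n * Real.sin θ))
          else Real.cos ((2 * j + 1) * θ) / (√n * Real.cos θ) := by
        intro k; rw [ih k]; split_ifs <;> ring
      rw [Finset.sum_congr rfl fun k _ => this k, Finset.sum_ite, Finset.sum_const,
        Finset.sum_const, nsmul_eq_mul, nsmul_eq_mul]
      have c1 : (Finset.univ.filter fun k => k ∈ M) = M := by ext; simp
      have c2 : ((Finset.univ.filter fun k => k ∉ M).card : ℝ) = n - M.card := by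
        have : (Finset.univ.filter fun k => k ∉ M) = Mᶜ := by ext; simp
        rw [this, Finset.card_compl, Fintype.card_fin, Nat.cast_sub]
        exact_mod_cast hm
      rw [c1, c2, e2, e1, Real.cos_add]
      generalize Real.sin ((2 * j + 1) * θ) = a
      generalize Real.cos ((2 * j + 1) * θ) = b
      have f1 : n * Real.sin θ ^ 2 * -(a / (√n * Real.sin θ)) = -(√n * a * Real.sin θ) := by
        by_cases h : Real.sin θ = 0
        · simp [h]
        · nth_rw 1 [← hsq]; field_simp
      have f2 : n * Real.cos θ ^ 2 * (b / (√n * Real.cos θ)) = √n * b * Real.cos θ := by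
        by_cases h : Real.cos θ = 0
        · simp [h]
        · nth_rw 1 [← hsq]; field_simp
      rw [f1, f2]; ring
    have hinv : (n : ℝ)⁻¹ * √n = (√n)⁻¹ := by
      nth_rw 1 [← hsq]; field_simp
    rw [groverAmp, hsum, ih i, ← mul_assoc (n : ℝ)⁻¹, hinv]
    obtain ⟨y, hy⟩ : ∃ y, (2 * (j : ℝ) + 1) * θ = y - θ := ⟨(2 * j + 1) * θ + θ, by ring⟩
    have a1 : (2 * ((j + 1 : ℕ) : ℝ) + 1) * θ = y + θ := by push_cast; linarith
    rw [a1, hy, sub_add_cancel, Real.sin_add, Real.cos_add, Real.sin_sub, Real.cos_sub]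
    generalize Real.sin y = a
    generalize Real.cos y = b
    split_ifs with h
    · have := hM i h; field_simp; ring
    · have := hMc i h
      field_simp; ring

lemma groverAmp_sq_of_mem (hn : 0 < n) (j : ℕ) {i : Fin n} (hi : i ∈ M) :
    groverAmp M j i ^ 2 = hitProb n M.card j := by
  have hn' : (0 : ℝ) < n := by exact_mod_cast hn
  have hm : (M.card : ℝ) ≤ n := by
    have := M.card_le_univ; rw [Fintype.card_fin] at this; exact_mod_cast this
  rw [groverAmp_eq M hn, if_pos hi, hitProb, div_pow, mul_pow, Real.sq_sqrt hn'.le,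
    Real.sin_arcsin (by linarith [Real.sqrt_nonneg ((M.card : ℝ) / n)])
      (Real.sqrt_le_one.mpr ((div_le_one hn').mpr hm)), Real.sq_sqrt (by positivity)]
  congr 1
  field_simp

end Grover

/-! ### One search -/

namespace Search
variable {n : ℕ} (A : Search n)

/-- The word that the oracle returns for an index in the state `s`, if the list `Y` is loaded. -/
def word (O : WeightOracle n) (s : A.State) (Y : Fin n → Fin (A.maxWord + 1)) (i : Fin n) :
    Fin (A.maxWord + 1) :=
  A.machine.queryWord O (some Y) i (A.flag s i)

/-- The marked indices. -/
def marked (O : WeightOracle n) (s : A.State) (Y : Fin n → Fin (A.maxWord + 1)) :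
    Finset (Fin n) :=
  Finset.univ.filter fun i => (A.pick s i (A.word O s Y i)).isSome

/-- The list of the weights of the marked indices. -/
def result (O : WeightOracle n) (s : A.State) (Y : Fin n → Fin (A.maxWord + 1)) (i : Fin n) :
    Fin (A.maxWord + 1) :=
  if i ∈ A.marked O s Y then (A.item ((A.pick s i (A.word O s Y i)).getD 0)).2 else 0

/-- Value of the machine at a configuration that is given by its parts. -/
def valAt (O : WeightOracle n) (F : Config n A.shape → ℝ) (q : A.Q)
    (mem : Fin (n + A.capMax) → Fin (A.maxWord + 1)) (list : Fin n → Fin (A.maxWord + 1))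
    (loaded : Option (Fin n → Fin (A.maxWord + 1))) (psi : A.Bas → ℂ) (t : ℕ) : ℝ :=
  A.machine.val A.rk O F ⟨A.num q, mem, list, loaded, psi, t⟩

variable {A} {O : WeightOracle n} {F : Config n A.shape → ℝ} {s : A.State}
  {mem : Fin (n + A.capMax) → Fin (A.maxWord + 1)} {list Y : Fin n → Fin (A.maxWord + 1)}
  {loaded : Option (Fin n → Fin (A.maxWord + 1))}

lemma valAt_nonneg (hF : ∀ c, 0 ≤ F c) (q : A.Q) (psi : A.Bas → ℂ) (t : ℕ) :
    0 ≤ A.valAt O F q mem list loaded psi t :=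
  QMachine.val_nonneg hF _

lemma valAt_eq_of_gate {q q' : A.Q} {U : Matrix.unitaryGroup A.Bas ℂ} {psi : A.Bas → ℂ} {t : ℕ}
    (h : A.program q = .gate U (A.num q')) :
    A.valAt O F q mem list loaded psi t =
      A.valAt O F q' mem list loaded ((U : Matrix A.Bas A.Bas ℂ).mulVec psi) (t + 1) := by
  rw [valAt, A.ranked.val_eq]
  simp only [Equiv.symm_apply_apply, h]; rfl

lemma valAt_eq_of_query {q q' : A.Q} {psi : A.Bas → ℂ} {t : ℕ}
    (h : A.program q = .query (A.num q')) :
    ∃ t', A.valAt O F q mem list loaded psi t = A.valAt O F q' mem list loaded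
      (fun b => psi (b.1, b.2.1, b.2.2.1,
        b.2.2.2.1 - A.machine.queryWord O loaded b.1 b.2.1, b.2.2.2.2)) t' := by
  refine ⟨t + A.machine.queryCost O loaded, ?_⟩
  rw [valAt, A.ranked.val_eq]
  simp only [Equiv.symm_apply_apply, h]; rfl

lemma valAt_eq_of_measure {q : A.Q} {q' : A.Bas → A.Q} {psi : A.Bas → ℂ} {t : ℕ}
    (h : A.program q = .measure fun b => A.num (q' b)) :
    A.valAt O F q mem list loaded psi t = ∑ b, ‖psi b‖ ^ 2 *
      A.valAt O F (q' b) mem list loaded (Pi.single b 1) (t + 1) := by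
  rw [valAt, A.ranked.val_eq]
  simp only [Equiv.symm_apply_apply, h]; rfl

/-- A measurement of a basis state does not change it. -/
lemma valAt_eq_of_measure_single {q : A.Q} {q' : A.Bas → A.Q} {b : A.Bas} {t : ℕ}
    (h : A.program q = .measure fun b => A.num (q' b)) :
    A.valAt O F q mem list loaded (Pi.single b 1) t =
      A.valAt O F (q' b) mem list loaded (Pi.single b 1) (t + 1) := by
  rw [valAt_eq_of_measure h, Finset.sum_eq_single b] <;> simp +contextual

lemma valAt_eq_of_read_single {q q' : A.Q} {b : A.Bas} {t : ℕ}
    (h : A.program q = .read (A.num q')) :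
    A.valAt O F q mem list loaded (Pi.single b 1) t =
      A.valAt O F q' mem list loaded
        (Pi.single (b.1, b.2.1, b.2.2.1, b.2.2.2.1 + mem b.2.2.1, b.2.2.2.2) 1) (t + 1) := by
  rw [valAt, A.ranked.val_eq]
  simp only [Equiv.symm_apply_apply, h]
  have : (fun x : A.Bas => (Pi.single b 1 : A.Bas → ℂ)
      (x.1, x.2.1, x.2.2.1, x.2.2.2.1 - mem x.2.2.1, x.2.2.2.2)) =
      Pi.single (b.1, b.2.1, b.2.2.1, b.2.2.2.1 + mem b.2.2.1, b.2.2.2.2) 1 := by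
    ext ⟨i, f, r, z, x⟩
    obtain ⟨i', f', r', z', x'⟩ := b
    simp only [Pi.single_apply, Prod.mk.injEq]
    congr 1
    apply propext
    constructor
    · rintro ⟨rfl, rfl, rfl, h, rfl⟩; simp [← h]
    · rintro ⟨rfl, rfl, rfl, rfl, rfl⟩; simp
  rw [valAt, ← this]

lemma valAt_eq_of_write {q q' : A.Q} {r : Fin (n + A.capMax)} {v : Fin (A.maxWord + 1)}
    {psi : A.Bas → ℂ} {t : ℕ} (h : A.program q = .write r v (A.num q')) :
    A.valAt O F q mem list loaded psi t =
      A.valAt O F q' (Function.update mem r v) list loaded psi (t + 1) := by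
  rw [valAt, A.ranked.val_eq]
  simp only [Equiv.symm_apply_apply, h]; rfl

lemma valAt_eq_of_emit {q q' : A.Q} {i : Fin n} {v : Fin (A.maxWord + 1)}
    {psi : A.Bas → ℂ} {t : ℕ} (h : A.program q = .emit i v (A.num q')) :
    A.valAt O F q mem list loaded psi t =
      A.valAt O F q' mem (Function.update list i v) loaded psi (t + 1) := by
  rw [valAt, A.ranked.val_eq]
  simp only [Equiv.symm_apply_apply, h]; rfl

lemma valAt_eq_of_prep {q q' : A.Q} {psi : A.Bas → ℂ} {t : ℕ}
    (h : A.program q = .prep (A.num q')) :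
    ∃ t', A.valAt O F q mem list loaded psi t =
      A.valAt O F q' mem (fun _ => 0) (some list) psi t' := by
  refine ⟨t + O.prepTime (listSize (σ := A.shape) list), ?_⟩
  rw [valAt, A.ranked.val_eq]
  simp only [Equiv.symm_apply_apply, h]; rfl

lemma valAt_halt {psi : A.Bas → ℂ} {t : ℕ} :
    A.valAt O F .halt mem list loaded psi t = F ⟨A.num .halt, mem, list, loaded, psi, t⟩ := by
  rw [valAt, A.ranked.val_eq]
  simp only [Equiv.symm_apply_apply, program]

/-! ### One draw -/

lemma spread_query (φ : Fin n → ℂ) (z : Fin n → Fin (A.maxWord + 1)) :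
    (fun b : A.Bas => A.spread s φ z (b.1, b.2.1, b.2.2.1,
      b.2.2.2.1 - A.machine.queryWord O (some Y) b.1 b.2.1, b.2.2.2.2)) =
    A.spread s φ (z + A.word O s Y) := by
  ext ⟨i, f, r, w, x⟩
  simp only [spread]
  congr 1
  apply propext
  refine and_congr_right fun hf => and_congr_right fun _ => ?_
  subst hf
  rw [Pi.add_apply]
  exact sub_eq_iff_eq_add

lemma phaseGate_spread (φ : Fin n → ℂ) (z : Fin n → Fin (A.maxWord + 1)) :
    (A.phaseGate s : Matrix A.Bas A.Bas ℂ).mulVec (A.spread s φ z) =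
      A.spread s (fun i => A.sgn s i (z i) * φ i) (-z) := by
  ext ⟨i, f, r, w, x⟩
  rw [phaseGate, permPhase_mulVec]
  simp only [spread, Equiv.coe_fn_mk, Pi.neg_apply]
  by_cases h : -w = z i
  · rw [if_congr (and_congr_right fun _ => and_congr_right fun _ =>
      (show (-w = z i) ↔ (w = -z i) from neg_eq_iff_eq_neg)) rfl rfl, h]
    split_ifs <;> simp
  · have h' : ¬ w = -z i := fun hw => h (by rw [hw, neg_neg])
    rw [if_neg (by tauto), if_neg (by tauto), mul_zero]

lemma diffuse_spread (φ : Fin n → ℂ) :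
    (reflGate (A.uniform s) (A.uniform_unit s) : Matrix A.Bas A.Bas ℂ).mulVec
      (A.spread s φ 0) =
      A.spread s (fun i => 2 * ((n : ℂ)⁻¹ * ∑ k, φ k) - φ i) 0 := by
  ext b
  rw [reflGate_mulVec, dotProduct_uniform]
  simp only [uniform, spread]
  split_ifs
  · have h : ((√(n : ℝ))⁻¹ : ℝ) * ((√(n : ℝ))⁻¹ : ℝ) = (n : ℝ)⁻¹ := by
      rw [← mul_inv, Real.mul_self_sqrt (Nat.cast_nonneg n)]
    have h' : (((√(n : ℝ))⁻¹ : ℝ) : ℂ) * (((√(n : ℝ))⁻¹ : ℝ) : ℂ) = (n : ℂ)⁻¹ := by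
      rw [← Complex.ofReal_mul, h]; simp
    linear_combination 2 * (∑ k, φ k) * h'
  · simp

/-- The state after `k` iterations. -/
def groverState (O : WeightOracle n) (s : A.State) (Y : Fin n → Fin (A.maxWord + 1)) (k : ℕ)
    (z : Fin n → Fin (A.maxWord + 1)) : A.Bas → ℂ :=
  A.spread s (fun i => (groverAmp (A.marked O s Y) k i : ℂ)) z

lemma valAt_iter (l : Fin A.sched.length) (c : Fin (A.capMax + 1)) (j : Fin (A.iterMax + 1))
    (k : ℕ) (t : ℕ) :
    ∃ t', A.valAt O F (.iter s l c j) mem list (some Y) (groverState O s Y k 0) t =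
      A.valAt O F (.look s l c) mem list (some Y) (groverState O s Y (k + j) (A.word O s Y))
        t' := by
  obtain ⟨j, hj⟩ := j
  induction j generalizing k t with
  | zero =>
    obtain ⟨t', ht⟩ := valAt_eq_of_query (O := O) (F := F) (mem := mem) (list := list)
      (loaded := some Y) (psi := groverState O s Y k 0) (t := t)
      (q := .iter s l c ⟨0, hj⟩) (q' := .look s l c) (by simp [program])
    refine ⟨t', ht.trans ?_⟩
    rw [groverState, spread_query, zero_add]; rfl
  | succ j ih =>
    have hj' : j < A.iterMax + 1 := by omega
    obtain ⟨t₁, h₁⟩ := valAt_eq_of_query (O := O) (F := F) (mem := mem) (list := list)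
      (loaded := some Y) (psi := groverState O s Y k 0) (t := t)
      (q := .iter s l c ⟨j + 1, hj⟩) (q' := .phase s l c ⟨j, hj'⟩) (by simp [program])
    have h₂ := valAt_eq_of_gate (O := O) (F := F) (mem := mem) (list := list)
      (loaded := some Y) (psi := groverState O s Y k (A.word O s Y)) (t := t₁)
      (q := .phase s l c ⟨j, hj'⟩) rfl
    rw [groverState, phaseGate_spread] at h₂
    obtain ⟨t₂, h₃⟩ := valAt_eq_of_query (O := O) (F := F) (mem := mem) (list := list)
      (loaded := some Y) (psi := A.spread s (fun i => A.sgn s i (A.word O s Y i) *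
        (groverAmp (A.marked O s Y) k i : ℂ)) (-A.word O s Y)) (t := t₁ + 1)
      (q := .unquery s l c ⟨j, hj'⟩) (q' := .diffuse s l c ⟨j, hj'⟩) rfl
    rw [spread_query, neg_add_cancel] at h₃
    have h₄ := valAt_eq_of_gate (O := O) (F := F) (mem := mem) (list := list)
      (loaded := some Y) (psi := A.spread s (fun i => A.sgn s i (A.word O s Y i) *
        (groverAmp (A.marked O s Y) k i : ℂ)) 0) (t := t₂)
      (q := .diffuse s l c ⟨j, hj'⟩) rfl
    rw [diffuse_spread] at h₄
    obtain ⟨t₃, h₅⟩ := ih (k + 1) (t₂ + 1) hj'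
    refine ⟨t₃, ?_⟩
    rw [h₁, groverState, spread_query, zero_add, h₂, h₃, h₄]
    have h₆ : (fun i => 2 * ((n : ℂ)⁻¹ * ∑ k', A.sgn s k' (A.word O s Y k') *
        (groverAmp (A.marked O s Y) k k' : ℂ)) - A.sgn s i (A.word O s Y i) *
        (groverAmp (A.marked O s Y) k i : ℂ)) =
        fun i => (groverAmp (A.marked O s Y) (k + 1) i : ℂ) := by
      have hs : ∀ i, A.sgn s i (A.word O s Y i) =
          (((if i ∈ A.marked O s Y then -1 else 1 : ℝ)) : ℂ) := by
        intro i; simp only [sgn, marked, Finset.mem_filter, Finset.mem_univ, true_and]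
        split_ifs <;> simp
      ext i
      simp only [groverAmp, hs]
      push_cast
      rfl
    rw [h₆]
    have h₇ : k + (j + 1) = k + 1 + j := by ring
    rw [h₇]
    exact h₅

/-- A draw gives the index `i` with the probability `groverAmp ^ 2`. -/
lemma valAt_gate (l : Fin A.sched.length) (c : Fin (A.capMax + 1)) (b : A.Bas) (t : ℕ) :
    ∃ t', A.valAt O F (.gate s l c b) mem list (some Y) (Pi.single b 1) t =
      ∑ i, groverAmp (A.marked O s Y) (A.reps l) i ^ 2 *
        A.valAt O F (if i ∈ A.marked O s Y
            then .addr s l c (i, A.flag s i, A.stampAddr A.idx, A.word O s Y i, 0)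
            else A.draw s (l + 1) c (i, A.flag s i, A.stampAddr A.idx, A.word O s Y i, 0))
          mem list (some Y)
          (Pi.single (i, A.flag s i, A.stampAddr A.idx, A.word O s Y i, 0) 1) t' := by
  have h₁ := valAt_eq_of_gate (O := O) (F := F) (mem := mem) (list := list) (loaded := some Y)
    (psi := Pi.single b 1) (t := t) (q := .gate s l c b) rfl
  have h₂ : A.uniform s = groverState O s Y 0 0 := by
    simp only [uniform, groverState, groverAmp]
  rw [prepGate_mulVec, h₂] at h₁
  obtain ⟨t', h₃⟩ := valAt_iter (A := A) (O := O) (F := F) (mem := mem) (list := list) (s := s)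
    (Y := Y) l c (A.reps l) 0 (t + 1)
  refine ⟨t' + 1, ?_⟩
  rw [h₁, h₃, valAt_eq_of_measure (q' := fun b => if (A.pick s b.1 b.2.2.2.1).isSome
    then .addr s l c b else A.draw s (l + 1) c b) rfl]
  have h₄ := A.sum_spread s (A.word O s Y) (fun b => groverAmp (A.marked O s Y) (A.reps l) b.1 ^ 2 *
    A.valAt O F (if (A.pick s b.1 b.2.2.2.1).isSome
      then .addr s l c b else A.draw s (l + 1) c b) mem list (some Y) (Pi.single b 1) (t' + 1))
  refine Eq.trans (Finset.sum_congr rfl fun b _ => ?_) (h₄.trans ?_)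
  · simp only [groverState, spread, zero_add]
    split_ifs <;> simp
  · simp [marked]

end Search

/-- The probability that a search with the draws `sched` succeeds, if there are `m` marked indices,
`x` of which were found: it has to find all of them, or more than `cap`. A draw with `J` iterations
gives each marked index with probability `p J`. -/
def findProb (cap m : ℕ) (p : ℕ → ℝ) : List ℕ → ℕ → ℝ
  | [], x => if x = m ∨ cap < x then 1 else 0
  | J :: l, x => if cap < x then 1 else
      (m - x) * p J * findProb cap m p l (x + 1) + (1 - (m - x) * p J) * findProb cap m p l x

lemma findProb_of_lt {cap m x : ℕ} (h : cap < x) (p : ℕ → ℝ) (l : List ℕ) :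
    findProb cap m p l x = 1 := by
  cases l <;> simp [findProb, h]

namespace Search
variable {n : ℕ} {A : Search n} {O : WeightOracle n} {F : Config n A.shape → ℝ} {s : A.State}
  {mem : Fin (n + A.capMax) → Fin (A.maxWord + 1)} {list Y : Fin n → Fin (A.maxWord + 1)}
  {loaded : Option (Fin n → Fin (A.maxWord + 1))}

/-- The stamp of `i`, if it has one, was written before the state `s`. -/
def Old (s : A.State) (mem : Fin (n + A.capMax) → Fin (A.maxWord + 1)) (i : Fin n) : Prop :=
  (mem (A.stampAddr i) : ℕ) = 0 ∨ A.depth s + 1 < mem (A.stampAddr i)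

/-- The stamps that are in the memory after the state `s`. -/
def Stamped (s : A.State) (mem : Fin (n + A.capMax) → Fin (A.maxWord + 1)) : Prop :=
  ∀ i, (mem (A.stampAddr i) : ℕ) = 0 ∨ A.depth s + 1 ≤ mem (A.stampAddr i)

lemma Stamped.old {s' : A.State} (h : Stamped s mem) (hs : A.depth s' < A.depth s) (i : Fin n) :
    Old s' mem i :=
  (h i).imp_right fun h => by omega

/-- The memory describes the list `g` of found indices. -/
structure MemInv (O : WeightOracle n) (s : A.State) (Y : Fin n → Fin (A.maxWord + 1))
    (mem : Fin (n + A.capMax) → Fin (A.maxWord + 1)) (g : List (Fin n)) : Prop where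
  stamp : ∀ i ∈ g, mem (A.stampAddr i) = A.stampWord s
  old : ∀ i ∉ g, Old s mem i
  log : ∀ (e : Fin A.capMax) (h : (e : ℕ) < g.length),
    mem (A.logAddr e) = (A.pick s g[(e : ℕ)] (A.word O s Y g[(e : ℕ)])).getD 0

lemma MemInv.stamped {g : List (Fin n)} (h : MemInv O s Y mem g) : Stamped s mem := by
  intro i
  by_cases hi : i ∈ g
  · rw [h.stamp i hi]; exact Or.inr le_rfl
  · exact (h.old i hi).imp_right le_of_lt

lemma MemInv.stamp_eq_iff {g : List (Fin n)} (h : MemInv O s Y mem g) (i : Fin n) :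
    mem (A.stampAddr i) = A.stampWord s ↔ i ∈ g := by
  refine ⟨fun hs => ?_, h.stamp i⟩
  by_contra hi
  have := h.old i hi
  rw [Old, hs, stampWord] at this
  simp at this

lemma MemInv.append {g : List (Fin n)} (h : MemInv O s Y mem g) (i : Fin n)
    (hg : g.length < A.capMax) :
    MemInv O s Y (Function.update (Function.update mem (A.stampAddr i) (A.stampWord s))
      (A.logAddr ⟨g.length, hg⟩) ((A.pick s i (A.word O s Y i)).getD 0)) (g ++ [i]) := by
  have hne : ∀ k e, A.stampAddr k ≠ A.logAddr e := by
    intro k e hk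
    have h1 := congrArg Fin.val hk
    simp only [stampAddr, logAddr, Fin.val_castAdd, Fin.val_natAdd] at h1
    have h2 := k.2
    omega
  have hinj : ∀ k k', A.stampAddr k = A.stampAddr k' → k = k' :=
    fun k k' hk => Fin.castAdd_injective _ _ hk
  constructor
  · intro k hk
    rw [Function.update_of_ne (hne _ _)]
    by_cases hki : k = i
    · rw [hki, Function.update_self]
    · rw [Function.update_of_ne (fun h => hki (hinj _ _ h))]
      exact h.stamp k (by simpa [hki] using hk)
  · intro k hk
    simp only [List.mem_append, List.mem_singleton, not_or] at hk
    rw [Old, Function.update_of_ne (hne _ _), Function.update_of_ne (fun h => hk.2 (hinj _ _ h))]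
    exact h.old k hk.1
  · intro e he
    by_cases hee : (e : ℕ) = g.length
    · have : e = ⟨g.length, hg⟩ := Fin.ext hee
      subst this
      simp
    · have he' : (e : ℕ) < g.length := by simp at he; omega
      have h1 : A.logAddr e ≠ A.logAddr ⟨g.length, hg⟩ := by
        intro hl
        exact hee (congrArg Fin.val (Fin.natAdd_injective _ _ hl))
      rw [Function.update_of_ne h1, Function.update_of_ne (hne _ _).symm, h.log e he']
      simp [List.getElem_append_left he']

/-- A marked index that was drawn is looked up in the memory. -/
lemma valAt_addr (l : Fin A.sched.length) (c : Fin (A.capMax + 1)) (b : A.Bas) (t : ℕ) :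
    ∃ b' t', A.valAt O F (.addr s l c b) mem list loaded (Pi.single b 1) t =
      A.valAt O F (if mem (A.stampAddr b.1) = A.stampWord s then A.draw s (l + 1) c b'
        else if (c : ℕ) < A.cap s then .putStamp s l c b b' else A.rej s b')
        mem list loaded (Pi.single b' 1) t' := by
  refine ⟨(b.1, b.2.1, A.stampAddr b.1, 0 + mem (A.stampAddr b.1), 0), t + 1 + 1 + 1, ?_⟩
  rw [valAt_eq_of_gate (q' := .stamp s l c b) rfl, swapGate_mulVec,
    valAt_eq_of_read_single (q' := .check s l c b) rfl]
  have := valAt_eq_of_measure_single (A := A) (O := O) (F := F) (mem := mem) (list := list)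
    (loaded := loaded) (q := .check s l c b) (q' := fun b' =>
      if b'.2.2.2.1 = A.stampWord s then A.draw s (l + 1) c b'
      else if (c : ℕ) < A.cap s then .putStamp s l c b b' else A.rej s b')
    (b := (b.1, b.2.1, A.stampAddr b.1, 0 + mem (A.stampAddr b.1), 0)) (t := t + 1 + 1) rfl
  simp only [zero_add] at this ⊢
  simp only [atStamp, zero_add]
  exact this

lemma valAt_putStamp (l : Fin A.sched.length) (c : Fin (A.capMax + 1)) (b b' : A.Bas) (t : ℕ)
    (hc : (c : ℕ) < A.capMax) :
    A.valAt O F (.putStamp s l c b b') mem list loaded (Pi.single b' 1) t =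
      A.valAt O F (A.draw s (l + 1) ⟨c + 1, Nat.succ_lt_succ hc⟩ b')
        (Function.update (Function.update mem (A.stampAddr b.1) (A.stampWord s))
          (A.logAddr ⟨c, hc⟩) ((A.pick s b.1 b.2.2.2.1).getD 0)) list loaded
        (Pi.single b' 1) (t + 1 + 1) := by
  rw [valAt_eq_of_write (q' := .putLog s l c b b') rfl,
    valAt_eq_of_write (q' := A.draw s (l + 1) ⟨c + 1, Nat.succ_lt_succ hc⟩ b')
      (by simp only [program]; rw [dif_pos hc])]

/-- Reading back the log emits the weights of all marked indices. -/
lemma valAt_back (hitem : ∀ i z v, A.pick s i z = some v → (A.item v).1 = i)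
    {g : List (Fin n)} (hgM : ∀ i, i ∈ g ↔ i ∈ A.marked O s Y)
    (hmem : MemInv O s Y mem g) (c : Fin (A.capMax + 1)) (hc : (c : ℕ) = g.length) (k : ℕ) :
    ∀ (e : ℕ), e + k = g.length → ∀ (b : A.Bas) (t : ℕ) (list : Fin n → Fin (A.maxWord + 1)),
    (∀ i, list i = if i ∈ g.take e then A.result O s Y i else 0) →
    ∃ b' t', A.valAt O F (A.back s c e b) mem list loaded (Pi.single b 1) t =
      A.valAt O F (A.acc s b') mem (A.result O s Y) loaded (Pi.single b' 1) t' := by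
  induction k with
  | zero =>
    intro e he b t list hlist
    refine ⟨b, t, ?_⟩
    have h1 : list = A.result O s Y := by
      ext1 i
      rw [hlist i, List.take_of_length_le (by omega)]
      split_ifs with h
      · rfl
      · rw [result, if_neg (fun h' => h ((hgM i).mpr h'))]
    rw [h1, back, dif_neg (by omega)]
  | succ k ih =>
    intro e he b t list hlist
    have hec : e < c := by omega
    have hcm : e < A.capMax := by have := c.2; omega
    have heg : e < g.length := by omega
    rw [back, dif_pos hec]
    rw [valAt_eq_of_gate (q' := .backRead s c ⟨e, hcm⟩) rfl, swapGate_mulVec,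
      valAt_eq_of_read_single (q' := .backLook s c ⟨e, hcm⟩) rfl,
      valAt_eq_of_measure_single (q' := fun b => .backEmit s c ⟨e, hcm⟩ b) rfl,
      valAt_eq_of_emit (q' := A.back s c (e + 1) _) rfl]
    refine ih (e + 1) (by omega) _ _ _ ?_
    have hm : g[e] ∈ A.marked O s Y := (hgM _).mp (List.getElem_mem heg)
    have hlog : mem (A.logAddr ⟨e, hcm⟩) = (A.pick s g[e] (A.word O s Y g[e])).getD 0 :=
      hmem.log ⟨e, hcm⟩ heg
    simp only [atLog, hlog, zero_add]
    obtain ⟨v, hv⟩ : ∃ v, A.pick s g[e] (A.word O s Y g[e]) = some v := by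
      simpa [marked, Option.isSome_iff_exists] using hm
    have hv1 : (A.item ((A.pick s g[e] (A.word O s Y g[e])).getD 0)).1 = g[e] := by
      rw [hv]; exact hitem _ _ _ hv
    intro i
    rw [hv1]
    have htake : i ∈ g.take (e + 1) ↔ i ∈ g.take e ∨ i = g[e] := by
      rw [List.take_add_one, List.getElem?_eq_getElem heg, Option.toList_some, List.mem_append,
        List.mem_singleton]
    by_cases hi : i = g[e]
    · rw [if_pos (htake.mpr (Or.inr hi))]
      subst hi
      rw [Function.update_self, result, if_pos hm]
    · rw [Function.update_of_ne hi, hlist i]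
      simp only [htake, hi, or_false]

/-- A search succeeds with the probability `findProb`: what can be guaranteed after the correct
outcome (acceptance with the list of all marked indices if there are at most `cap s`, rejection
otherwise) is guaranteed, up to this factor, before. -/
theorem le_valAt_draw (hF : ∀ c, 0 ≤ F c)
    (hitem : ∀ i z v, A.pick s i z = some v → (A.item v).1 = i) {v : ℝ}
    (hacc : (A.marked O s Y).card ≤ A.cap s → ∀ b mem t, Stamped s mem →
      v ≤ A.valAt O F (A.acc s b) mem (A.result O s Y) (some Y) (Pi.single b 1) t)
    (hrej : A.cap s < (A.marked O s Y).card → ∀ b mem t, Stamped s mem →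
      v ≤ A.valAt O F (A.rej s b) mem (fun _ => 0) (some Y) (Pi.single b 1) t)
    (rest : List ℕ) : ∀ (l : ℕ), A.sched.drop l = rest → l ≤ A.sched.length →
      ∀ (g : List (Fin n)) (mem : Fin (n + A.capMax) → Fin (A.maxWord + 1))
        (c : Fin (A.capMax + 1)) (b : A.Bas) (t : ℕ), g.Nodup → (∀ i ∈ g, i ∈ A.marked O s Y) →
      (c : ℕ) = g.length → g.length ≤ A.cap s → MemInv O s Y mem g →
      findProb (A.cap s) (A.marked O s Y).card (hitProb n (A.marked O s Y).card) rest g.length * v ≤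
        A.valAt O F (A.draw s l c b) mem (fun _ => 0) (some Y) (Pi.single b 1) t := by
  set M := A.marked O s Y with hM
  have hn : 0 < n := A.idx.pos
  induction rest with
  | nil =>
    intro l hl hlen g mem c b t hg hgM hc hgc hmem
    have hL : ¬ l < A.sched.length := by
      have := List.drop_eq_nil_iff.mp hl; omega
    have hsub : g.toFinset ⊆ M := fun i hi => hgM i (List.mem_toFinset.mp hi)
    rw [findProb, draw, dif_neg hL]
    by_cases hm : g.length = M.card
    · rw [if_pos (Or.inl hm), one_mul]
      have heq : g.toFinset = M := Finset.eq_of_subset_of_card_le hsub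
        (by rw [List.toFinset_card_of_nodup hg, hm])
      obtain ⟨b', t', h⟩ := valAt_back (F := F) (loaded := some Y) hitem
        (fun i => by rw [← hM, ← heq, List.mem_toFinset]) hmem c hc g.length 0 (zero_add _)
        b t (fun _ => 0) (by simp)
      rw [h]
      exact hacc (by rw [← hm]; exact hgc) b' mem t' hmem.stamped
    · rw [if_neg (by omega), zero_mul]
      exact valAt_nonneg hF _ _ _
  | cons J rest ih =>
    intro l hl hlen g mem c b t hg hgM hc hgc hmem
    have hL : l < A.sched.length := by
      by_contra h
      rw [List.drop_eq_nil_of_le (by omega)] at hl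
      cases hl
    have hdrop := List.drop_eq_getElem_cons hL
    rw [hl] at hdrop
    obtain ⟨hJ, hrest⟩ := List.cons.inj hdrop
    have hJ' : ((A.reps ⟨l, hL⟩ : Fin (A.iterMax + 1)) : ℕ) = J := hJ.symm
    rw [findProb, if_neg (by omega), draw, dif_pos hL]
    obtain ⟨t', ht⟩ := valAt_gate (A := A) (O := O) (F := F) (mem := mem)
      (list := fun _ => 0) (s := s) (Y := Y) ⟨l, hL⟩ c b t
    rw [ht, hJ', ← hM]
    set p := hitProb n M.card with hp
    set f₀ := findProb (A.cap s) M.card p rest g.length with hf₀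
    set f₁ := findProb (A.cap s) M.card p rest (g.length + 1) with hf₁
    have hterm : ∀ i, groverAmp M J i ^ 2 * (if i ∈ M \ g.toFinset then f₁ * v else f₀ * v) ≤
        groverAmp M J i ^ 2 * A.valAt O F (if i ∈ M
            then .addr s ⟨l, hL⟩ c (i, A.flag s i, A.stampAddr A.idx, A.word O s Y i, 0)
            else A.draw s (l + 1) c (i, A.flag s i, A.stampAddr A.idx, A.word O s Y i, 0))
          mem (fun _ => 0) (some Y)
          (Pi.single (i, A.flag s i, A.stampAddr A.idx, A.word O s Y i, 0) 1) t' := by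
      intro i
      refine mul_le_mul_of_nonneg_left ?_ (sq_nonneg _)
      by_cases hi : i ∈ M
      · rw [if_pos hi]
        obtain ⟨b', t₁, h₁⟩ := valAt_addr (A := A) (O := O) (F := F) (mem := mem)
          (list := fun _ => 0) (loaded := some Y) (s := s) ⟨l, hL⟩ c
          (i, A.flag s i, A.stampAddr A.idx, A.word O s Y i, 0) t'
        rw [h₁]
        simp only [hmem.stamp_eq_iff i]
        by_cases hig : i ∈ g
        · -- found before
          rw [if_pos hig, if_neg (by simp [hig])]
          exact ih (l + 1) hrest.symm hL g mem c b' t₁ hg hgM hc hgc hmem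
        · -- a new index; if the log is full, the search is rejected
          rw [if_neg hig, if_pos (by simp [hig, hi])]
          have hnd : (g ++ [i]).Nodup := by
            rw [List.nodup_append]; simp [hg]; intro a ha h; exact hig (h ▸ ha)
          have hsub : ∀ k ∈ g ++ [i], k ∈ M := by
            intro k hk
            rcases List.mem_append.mp hk with h | h
            · exact hgM k h
            · rw [List.mem_singleton.mp h]; exact hi
          have hcard : g.length + 1 ≤ M.card := by
            have h1 : (g ++ [i]).toFinset ⊆ M := fun k hk => hsub k (List.mem_toFinset.mp hk)
            have h2 := Finset.card_le_card h1
            rw [List.toFinset_card_of_nodup hnd] at h2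
            simpa using h2
          by_cases hcc : (c : ℕ) < A.cap s
          · have hcm : (c : ℕ) < A.capMax := hcc.trans_le (A.cap_le s)
            rw [if_pos hcc, valAt_putStamp _ _ _ _ _ hcm]
            have hmem' := hmem.append i (by omega : g.length < A.capMax)
            have := ih (l + 1) hrest.symm hL (g ++ [i]) _ ⟨c + 1, Nat.succ_lt_succ hcm⟩ b'
              (t₁ + 1 + 1) hnd hsub (by simp [hc]) (by simp; omega) hmem'
            simpa [hc, hf₁] using this
          · have hlt : A.cap s < g.length + 1 := by omega
            rw [if_neg hcc, hf₁, findProb_of_lt hlt, one_mul]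
            exact hrej (by omega) b' mem t₁ hmem.stamped
      · -- not marked
        rw [if_neg hi, if_neg (by simp [hi])]
        exact ih (l + 1) hrest.symm hL g mem c _ t' hg hgM hc hgc hmem
    refine le_trans (le_of_eq ?_) (Finset.sum_le_sum fun i _ => hterm i)
    have hsub : g.toFinset ⊆ M := fun i hi => hgM i (List.mem_toFinset.mp hi)
    have hcard : ((M \ g.toFinset).card : ℝ) = M.card - g.length := by
      rw [Finset.card_sdiff_of_subset hsub, List.toFinset_card_of_nodup hg, Nat.cast_sub]
      rw [← List.toFinset_card_of_nodup hg]
      exact Finset.card_le_card hsub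
    have hsplit : ∀ i, groverAmp M J i ^ 2 * (if i ∈ M \ g.toFinset then f₁ * v else f₀ * v) =
        (if i ∈ M \ g.toFinset then p J * (f₁ * v - f₀ * v) else 0) +
          groverAmp M J i ^ 2 * (f₀ * v) := by
      intro i
      split_ifs with h
      · rw [groverAmp_sq_of_mem M hn J (Finset.mem_sdiff.mp h).1]; ring
      · ring
    rw [Finset.sum_congr rfl fun i _ => hsplit i, Finset.sum_add_distrib, ← Finset.sum_mul,
      sum_groverAmp_sq M hn, Finset.sum_ite_mem, Finset.univ_inter, Finset.sum_const, nsmul_eq_mul,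
      hcard]
    ring

end Search

/-! ### The schedule of the draws -/

/-- Union bound: each index that is not yet found is missed by all draws with the probability
`∏ (1 - p)`. -/
lemma one_sub_findProb_le_sub_mul {cap m : ℕ} {p : ℕ → ℝ} (h0 : ∀ J, 0 ≤ p J)
    (h1 : ∀ J, m * p J ≤ 1) (l : List ℕ) {x : ℕ} (hx : x ≤ m) :
    1 - findProb cap m p l x ≤ (m - x) * (l.map fun J => 1 - p J).prod := by
  have hp1 : ∀ J, 0 < m → p J ≤ 1 := by
    intro J hm
    have : (1 : ℝ) ≤ m := by exact_mod_cast hm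
    nlinarith [h0 J, h1 J]
  have hxm : ∀ {x : ℕ}, x ≤ m → (0 : ℝ) ≤ m - x := fun h => by
    rw [sub_nonneg]; exact_mod_cast h
  have hprod : ∀ (l : List ℕ) (x : ℕ), x ≤ m → 0 ≤ (m - x : ℝ) * (l.map fun J => 1 - p J).prod := by
    intro l x hx
    rcases Nat.eq_zero_or_pos m with hm | hm
    · have : x = m := by omega
      simp [this]
    · refine mul_nonneg (hxm hx) (List.prod_nonneg ?_)
      intro a ha
      obtain ⟨J, -, rfl⟩ := List.mem_map.mp ha
      linarith [hp1 J hm]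
  induction l generalizing x with
  | nil =>
    rw [findProb]
    split_ifs with h
    · simpa using hxm hx
    · have : x + 1 ≤ m := by omega
      have : (x : ℝ) + 1 ≤ m := by exact_mod_cast this
      simp; linarith
  | cons J l ih =>
    rw [findProb]
    split_ifs with h
    · rw [sub_self]; exact hprod _ x hx
    · rw [List.map_cons, List.prod_cons]
      have e0 := ih hx
      rcases hx.eq_or_lt with rfl | hlt
      · rw [sub_self] at e0 ⊢; linarith
      · have e1 := ih (x := x + 1) hlt
        push_cast at e1
        have hc0 : 0 ≤ (m - x : ℝ) * p J := mul_nonneg (hxm hx) (h0 J)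
        have hc1 : (m - x : ℝ) * p J ≤ 1 := by
          have : (0 : ℝ) ≤ x * p J := mul_nonneg (Nat.cast_nonneg _) (h0 J)
          linarith [h1 J]
        have e2 := mul_le_mul_of_nonneg_left e1 hc0
        have e3 := mul_le_mul_of_nonneg_left e0 (sub_nonneg.mpr hc1)
        generalize (l.map fun J => 1 - p J).prod = P at *
        nlinarith

/-- If there are many more marked indices than `cap`, every draw finds a new one with probability at
least `m * p / 2`. Hence the expectation of `2 ^ -x`, where `x` is the number of found indices,
decreases by the factor `1 - m * p / 4` in every draw. -/
lemma one_sub_findProb_le_two_pow_mul {cap m : ℕ} {p : ℕ → ℝ} (h0 : ∀ J, 0 ≤ p J)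
    (h1 : ∀ J, m * p J ≤ 1) (hm : 2 * cap ≤ m) (l : List ℕ) {x : ℕ} (hx : x ≤ cap) :
    1 - findProb cap m p l x ≤ 2 ^ cap / 2 ^ x * (l.map fun J => 1 - m * p J / 4).prod := by
  have hprod : ∀ (l : List ℕ), 0 ≤ (l.map fun J => 1 - m * p J / 4).prod := by
    intro l
    refine List.prod_nonneg ?_
    intro a ha
    obtain ⟨J, -, rfl⟩ := List.mem_map.mp ha
    linarith [h1 J]
  have hmc : (2 : ℝ) * cap ≤ m := by exact_mod_cast hm
  induction l generalizing x with
  | nil =>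
    have h2 : (1 : ℝ) ≤ 2 ^ cap / 2 ^ x := by
      rw [one_le_div (by positivity)]
      exact pow_le_pow_right₀ (by norm_num) hx
    rw [findProb]
    split_ifs with h
    · simp; positivity
    · simpa using h2
  | cons J l ih =>
    rw [findProb, if_neg (by omega), List.map_cons, List.prod_cons]
    have hxr : (x : ℝ) ≤ cap := by exact_mod_cast hx
    have e0 := ih hx
    have e1 : 1 - findProb cap m p l (x + 1) ≤
        2 ^ cap / 2 ^ x / 2 * (l.map fun J => 1 - m * p J / 4).prod := by
      rcases hx.eq_or_lt with rfl | hlt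
      · rw [findProb_of_lt (Nat.lt_succ_self _), sub_self]
        exact mul_nonneg (by positivity) (hprod l)
      · refine (ih (x := x + 1) hlt).trans (le_of_eq ?_)
        rw [pow_succ]; field_simp
    have hA : (0 : ℝ) ≤ 2 ^ cap / 2 ^ x := by positivity
    generalize (2 : ℝ) ^ cap / 2 ^ x = B at *
    have hP := hprod l
    generalize (l.map fun J => 1 - m * p J / 4).prod = P at *
    have hpJ := h0 J
    have hpm := h1 J
    have hxp : (0 : ℝ) ≤ x * p J := mul_nonneg (Nat.cast_nonneg _) hpJ
    have hxp2 : (x : ℝ) * p J ≤ m * p J / 2 := by nlinarith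
    have e2 := mul_le_mul_of_nonneg_left e1 (show 0 ≤ (m - x : ℝ) * p J by nlinarith)
    have e3 := mul_le_mul_of_nonneg_left e0 (show 0 ≤ 1 - (m - x : ℝ) * p J by nlinarith)
    have hBP : 0 ≤ B * P := mul_nonneg hA hP
    nlinarith

lemma _root_.List.Sublist.prod_map_le {l₁ l₂ : List ℕ} (h : l₁.Sublist l₂) {f : ℕ → ℝ}
    (h0 : ∀ J, 0 ≤ f J) (h1 : ∀ J, f J ≤ 1) : (l₂.map f).prod ≤ (l₁.map f).prod := by
  have hp : ∀ l : List ℕ, 0 ≤ (l.map f).prod := fun l => List.prod_nonneg (by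
    intro a ha; obtain ⟨J, -, rfl⟩ := List.mem_map.mp ha; exact h0 J)
  induction h with
  | slnil => exact le_rfl
  | cons a _ ih =>
    rw [List.map_cons, List.prod_cons]
    exact (mul_le_of_le_one_left (hp _) (h1 a)).trans ih
  | cons_cons a _ ih =>
    rw [List.map_cons, List.prod_cons, List.map_cons, List.prod_cons]
    exact mul_le_mul_of_nonneg_left ih (h0 a)

/-- The number of Grover iterations if there are about `2 ^ a` marked indices. -/
def groverIters (n a : ℕ) : ℕ := ⌊(√((n : ℝ) / 2 ^ a) - 1) / 2⌋₊

/-- The schedule of a search that is to find up to `C` indices: for each order of magnitude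
`2 ^ a` of the number of marked indices, about `min (2 ^ a) C` draws. -/
def schedule (n C R : ℕ) : List ℕ :=
  (List.range (Nat.clog 2 n + 1)).flatMap fun a =>
    List.replicate (min (2 ^ a) C * R) (groverIters n a)

lemma hitProb_nonneg (n m J : ℕ) : 0 ≤ hitProb n m J :=
  div_nonneg (sq_nonneg _) (Nat.cast_nonneg _)

lemma mul_hitProb_le_one (n m J : ℕ) : m * hitProb n m J ≤ 1 := by
  rcases Nat.eq_zero_or_pos m with rfl | hm
  · simp
  · have : (0 : ℝ) < m := by exact_mod_cast hm
    rw [hitProb, mul_div_cancel₀ _ this.ne']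
    exact Real.sin_sq_le_one _

/-- With the right number of iterations, a draw gives a marked index with constant probability:
the angle `(2 J + 1) θ` lies between a constant and `π / 2`. -/
lemma one_div_le_mul_hitProb {n m : ℕ} (hm : 0 < m) (hmn : m ≤ n) :
    1 / 50 ≤ m * hitProb n m (groverIters n (Nat.clog 2 m)) := by
  have hm' : (0 : ℝ) < m := by exact_mod_cast hm
  have hmn' : (m : ℝ) ≤ n := by exact_mod_cast hmn
  have hn' : (0 : ℝ) < n := hm'.trans_le hmn'
  rw [hitProb, mul_div_cancel₀ _ hm'.ne']
  set a := Nat.clog 2 m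
  have ha1 : (m : ℝ) ≤ 2 ^ a := by exact_mod_cast Nat.le_pow_clog (by norm_num) m
  have ha2 : (2 : ℝ) ^ a ≤ 2 * m := by
    rcases Nat.lt_or_ge 1 m with h | h
    · have h1 := Nat.pow_pred_clog_lt_self (b := 2) (by norm_num) h
      have h2 : 0 < a := Nat.clog_pos (by norm_num) h
      have h3 : 2 ^ a = 2 * 2 ^ (a - 1) := by rw [← pow_succ']; congr 1; omega
      have : 2 ^ a ≤ 2 * m := by rw [h3]; exact Nat.mul_le_mul_left 2 h1.le
      exact_mod_cast this
    · have : m = 1 := by omega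
      simp [a, this]
  set r := √((n : ℝ) / 2 ^ a) with hr
  set J := groverIters n a with hJ
  have hr0 : 0 ≤ r := Real.sqrt_nonneg _
  set q := √((m : ℝ) / n) with hq
  have hq0 : 0 ≤ q := Real.sqrt_nonneg _
  have hq1 : q ≤ 1 := Real.sqrt_le_one.mpr ((div_le_one hn').mpr hmn')
  have hr2 : r ^ 2 = n / 2 ^ a := Real.sq_sqrt (by positivity)
  have hq2 : q ^ 2 = m / n := Real.sq_sqrt (by positivity)
  have hrq1 : r * q ≤ 1 := by
    have : (r * q) ^ 2 ≤ 1 := by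
      rw [mul_pow, hr2, hq2, div_mul_div_comm, div_le_one (by positivity)]
      nlinarith
    nlinarith [mul_nonneg hr0 hq0]
  have hrq2 : 7 / 10 ≤ r * q := by
    have : 1 / 2 ≤ (r * q) ^ 2 := by
      rw [mul_pow, hr2, hq2, div_mul_div_comm, div_le_div_iff₀ (by norm_num) (by positivity)]
      nlinarith
    nlinarith [mul_nonneg hr0 hq0]
  -- `2 J + 1` is comparable to `r`
  have hJ1 : (2 * J + 1 : ℝ) * q ≤ 1 := by
    rcases le_or_gt 1 r with h | h
    · have : (J : ℝ) ≤ (r - 1) / 2 := Nat.floor_le (by linarith)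
      nlinarith
    · have : J = 0 := Nat.floor_eq_zero.mpr (by rw [← hr]; linarith)
      rw [this]; simpa using hq1
  have hJ2 : r / 3 ≤ 2 * J + 1 := by
    have h1 : (r - 1) / 2 < J + 1 := Nat.lt_floor_add_one _
    have h2 : (0 : ℝ) ≤ J := Nat.cast_nonneg _
    rcases le_or_gt r 3 with h | h <;> linarith
  set θ := Real.arcsin q with hθ
  have hsin : Real.sin θ = q := Real.sin_arcsin (by linarith) hq1
  have hθ0 : 0 ≤ θ := Real.arcsin_nonneg.mpr hq0
  have hθ1 : q ≤ θ := by rw [← hsin]; exact Real.sin_le hθ0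
  have hθ2 : 2 / Real.pi * θ ≤ q := by
    rw [← hsin]; exact Real.mul_le_sin hθ0 (Real.arcsin_le_pi_div_two _)
  have hpi := Real.pi_pos
  have hθ3 : θ ≤ Real.pi / 2 * q := by
    rw [div_mul_eq_mul_div, div_le_iff₀ hpi] at hθ2
    linarith
  have hJp : (0 : ℝ) ≤ 2 * J + 1 := by positivity
  have hx0 : 7 / 30 ≤ (2 * J + 1) * θ := by
    calc (7 / 30 : ℝ) ≤ (r / 3) * q := by linarith
      _ ≤ (2 * J + 1) * θ := mul_le_mul hJ2 hθ1 hq0 hJp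
  have hx1 : (2 * J + 1) * θ ≤ Real.pi / 2 := by
    calc (2 * J + 1) * θ ≤ (2 * J + 1) * (Real.pi / 2 * q) := mul_le_mul_of_nonneg_left hθ3 hJp
      _ = Real.pi / 2 * ((2 * J + 1) * q) := by ring
      _ ≤ Real.pi / 2 * 1 := mul_le_mul_of_nonneg_left hJ1 (by positivity)
      _ = _ := mul_one _
  have hs := Real.mul_le_sin (by linarith) hx1
  have hpi4 : Real.pi < 3.15 := Real.pi_lt_d2
  have hs2 : 1 / 7 ≤ Real.sin ((2 * J + 1) * θ) := by
    refine le_trans ?_ hs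
    rw [div_mul_eq_mul_div, le_div_iff₀ hpi]
    linarith
  nlinarith

lemma exp_neg_natCast_le (k : ℕ) : Real.exp (-(k : ℝ)) ≤ 1 / 2 ^ k := by
  rw [Real.exp_neg, ← one_div]
  refine one_div_le_one_div_of_le (by positivity) ?_
  have h : (2 : ℝ) ≤ Real.exp 1 := by linarith [Real.add_one_le_exp (1 : ℝ)]
  calc (2 : ℝ) ^ k ≤ Real.exp 1 ^ k := pow_le_pow_left₀ (by norm_num) h k
    _ = Real.exp k := by rw [← Real.exp_nat_mul, mul_one]

lemma one_sub_pow_le_exp {x : ℝ} (hx : x ≤ 1) (k : ℕ) : (1 - x) ^ k ≤ Real.exp (-(k * x)) := by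
  calc (1 - x) ^ k ≤ Real.exp (-x) ^ k :=
        pow_le_pow_left₀ (by linarith) (by linarith [Real.add_one_le_exp (-x)]) k
    _ = Real.exp (-(k * x)) := by rw [← Real.exp_nat_mul]; congr 1; ring

/-- The schedule makes a search succeed with high probability. Only the draws that are made for the
correct order of magnitude of `m` are used. -/
theorem le_findProb_schedule {n C cap m k : ℕ} {δ : ℝ} (hC : 0 < C) (hcap : cap ≤ C)
    (hm : m ≤ n) (hδ : δ < 1) (hk : 2 * n ≤ 2 ^ k * δ) (hn : 0 < n) :
    1 - δ ≤ findProb cap m (hitProb n m) (schedule n C (200 * k)) 0 := by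
  have hn' : (1 : ℝ) ≤ n := by exact_mod_cast hn
  have h2k : (0 : ℝ) < 2 ^ k := by positivity
  have hδ0 : 0 < δ := by
    by_contra h
    nlinarith
  have hp0 := hitProb_nonneg n m
  have hp1 := mul_hitProb_le_one n m
  rcases Nat.eq_zero_or_pos m with rfl | hm0
  · have := one_sub_findProb_le_sub_mul (cap := cap) hp0 hp1 (schedule n C (200 * k)) le_rfl
    simp only [Nat.cast_zero, sub_self, zero_mul] at this
    linarith
  have hm0' : (1 : ℝ) ≤ m := by exact_mod_cast hm0
  have hmn' : (m : ℝ) ≤ n := by exact_mod_cast hm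
  set a := Nat.clog 2 m with ha
  have hma : m ≤ 2 ^ a := Nat.le_pow_clog (by norm_num) m
  have hsub : (List.replicate (min (2 ^ a) C * (200 * k)) (groverIters n a)).Sublist
      (schedule n C (200 * k)) := by
    refine List.sublist_flatten_of_mem ?_
    refine List.mem_map.mpr ⟨a, ?_, rfl⟩
    rw [List.mem_range, Nat.lt_succ_iff]
    exact Nat.clog_mono_right 2 hm
  have hhit := one_div_le_mul_hitProb hm0 hm
  rw [← ha] at hhit
  set p := hitProb n m (groverIters n a) with hp
  have hple : ∀ J, hitProb n m J ≤ 1 := fun J => by nlinarith [hp0 J, hp1 J]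
  rcases le_or_gt m (2 * C) with hmC | hmC
  · -- few marked indices: all of them are found
    have h1 := one_sub_findProb_le_sub_mul (cap := cap) hp0 hp1 (schedule n C (200 * k))
      (Nat.zero_le m)
    have h2 := hsub.prod_map_le (f := fun J => 1 - hitProb n m J)
      (fun J => by linarith [hple J]) (fun J => by linarith [hp0 J])
    rw [List.map_replicate, List.prod_replicate] at h2
    have h3 := one_sub_pow_le_exp (hple (groverIters n a)) (min (2 ^ a) C * (200 * k))
    have hL : 2 * (k : ℝ) ≤ (min (2 ^ a) C * (200 * k) : ℕ) * p := by
      have h4 : (m : ℝ) ≤ 2 * (min (2 ^ a) C : ℕ) := by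
        have : m ≤ 2 * min (2 ^ a) C := by omega
        exact_mod_cast this
      have h5 : 1 / 100 ≤ ((min (2 ^ a) C : ℕ) : ℝ) * p := by nlinarith [hp0 (groverIters n a)]
      rw [Nat.cast_mul, Nat.cast_mul]
      have : (0 : ℝ) ≤ k := Nat.cast_nonneg k
      push_cast at h5 ⊢
      nlinarith
    have h6 : Real.exp (-((min (2 ^ a) C * (200 * k) : ℕ) * p)) ≤ 1 / 2 ^ k := by
      refine le_trans (Real.exp_le_exp.mpr ?_) (exp_neg_natCast_le k)
      have : (0 : ℝ) ≤ k := Nat.cast_nonneg k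
      linarith
    have h7 : (m : ℝ) * (1 / 2 ^ k) ≤ δ := by
      rw [mul_one_div, div_le_iff₀ h2k]; nlinarith
    have h8 : (m : ℝ) * (List.map (fun J => 1 - hitProb n m J) (schedule n C (200 * k))).prod
        ≤ m * (1 / 2 ^ k) :=
      mul_le_mul_of_nonneg_left (h2.trans (h3.trans h6)) (by linarith)
    simp only [Nat.cast_zero, sub_zero] at h1
    linarith
  · -- many marked indices: more than `cap` of them are found
    have h1 := one_sub_findProb_le_two_pow_mul hp0 hp1 (by omega : 2 * cap ≤ m)
      (schedule n C (200 * k)) (Nat.zero_le cap)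
    have h2 := hsub.prod_map_le (f := fun J => 1 - m * hitProb n m J / 4)
      (fun J => by linarith [hp1 J])
      (fun J => by have := mul_nonneg (Nat.cast_nonneg m) (hp0 J); linarith)
    rw [List.map_replicate, List.prod_replicate] at h2
    have h3 := one_sub_pow_le_exp (x := m * p / 4) (by linarith [hp1 (groverIters n a)])
      (min (2 ^ a) C * (200 * k))
    have hmin : min (2 ^ a) C = C := by omega
    rw [hmin] at h2 h3
    have h4 : Real.exp (-((C * (200 * k) : ℕ) * (m * p / 4))) ≤ (1 / 2 ^ k) ^ C := by
      calc _ ≤ Real.exp (-(k : ℝ)) ^ C := by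
            rw [← Real.exp_nat_mul, Real.exp_le_exp]
            push_cast
            have : (0 : ℝ) ≤ C * k := by positivity
            nlinarith
        _ ≤ _ := pow_le_pow_left₀ (Real.exp_pos _).le (exp_neg_natCast_le k) C
    have h5 : 2 * (1 / 2 ^ k : ℝ) ≤ δ := by
      rw [mul_one_div, div_le_iff₀ h2k]; nlinarith
    have h6 : (2 : ℝ) ^ cap * (1 / 2 ^ k) ^ C ≤ δ := by
      calc (2 : ℝ) ^ cap * (1 / 2 ^ k) ^ C ≤ 2 ^ C * (1 / 2 ^ k) ^ C :=
            mul_le_mul_of_nonneg_right (pow_le_pow_right₀ (by norm_num) hcap) (by positivity)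
        _ = (2 * (1 / 2 ^ k)) ^ C := (mul_pow _ _ _).symm
        _ ≤ δ ^ C := pow_le_pow_left₀ (by positivity) h5 C
        _ ≤ δ := pow_le_of_le_one hδ0.le hδ.le hC.ne'
    have h8 : (2 : ℝ) ^ cap * (List.map (fun J => 1 - m * hitProb n m J / 4)
        (schedule n C (200 * k))).prod ≤ 2 ^ cap * (1 / 2 ^ k) ^ C :=
      mul_le_mul_of_nonneg_left (h2.trans (h3.trans h4)) (by positivity)
    rw [pow_zero, div_one] at h1
    linarith

lemma groverIters_le (n a : ℕ) : (groverIters n a : ℝ) ≤ √((n : ℝ) / 2 ^ a) / 2 := by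
  rcases le_or_gt 1 (√((n : ℝ) / 2 ^ a)) with h | h
  · exact (Nat.floor_le (by linarith)).trans (by linarith)
  · rw [groverIters, Nat.floor_eq_zero.mpr (by linarith)]
    rw [Nat.cast_zero]
    exact div_nonneg (Real.sqrt_nonneg _) (by norm_num)

lemma groverIters_le_self (n a : ℕ) : groverIters n a ≤ n := by
  rcases Nat.eq_zero_or_pos n with rfl | hn
  · rw [groverIters, Nat.floor_eq_zero.mpr (by norm_num)]
  have hn' : (1 : ℝ) ≤ n := by exact_mod_cast hn
  have h1 : √((n : ℝ) / 2 ^ a) ≤ n := by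
    rw [Real.sqrt_le_left (by linarith)]
    calc (n : ℝ) / 2 ^ a ≤ n := div_le_self (by linarith) (one_le_pow₀ (by norm_num))
      _ ≤ n ^ 2 := by nlinarith
  have h2 := groverIters_le n a
  have : (groverIters n a : ℝ) ≤ n := by linarith
  exact_mod_cast this

lemma length_schedule_le (n C R : ℕ) :
    (schedule n C R).length ≤ (Nat.clog 2 n + 1) * (C * R) := by
  rw [schedule, List.length_flatMap]
  refine (List.sum_le_card_nsmul _ (C * R) ?_).trans (by simp)
  intro x hx
  obtain ⟨a, -, rfl⟩ := List.mem_map.mp hx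
  rw [List.length_replicate]
  exact Nat.mul_le_mul_right _ (min_le_right _ _)

lemma two_pow_clog_le {n : ℕ} (hn : 0 < n) : 2 ^ Nat.clog 2 n ≤ 2 * n := by
  rcases Nat.lt_or_ge 1 n with h | h
  · have h1 := Nat.pow_pred_clog_lt_self (b := 2) (by norm_num) h
    have h2 : 0 < Nat.clog 2 n := Nat.clog_pos (by norm_num) h
    have h3 : 2 ^ Nat.clog 2 n = 2 * 2 ^ (Nat.clog 2 n - 1) := by
      rw [← pow_succ']; congr 1; omega
    rw [Nat.pred_eq_sub_one] at h1
    omega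
  · have : n = 1 := by omega
    subst this; norm_num

/-- The time of a search, up to a logarithmic factor, is the square root of `n` times the size of
the sample. -/
lemma sum_schedule_le {n C : ℕ} (R : ℕ) (hn : 0 < n) :
    ((((schedule n C R).map fun J => 4 * J + 8).sum : ℕ) : ℝ) ≤
      (Nat.clog 2 n + 1) * (18 * R * √(n * C)) := by
  have hn' : (0 : ℝ) < n := by exact_mod_cast hn
  have hpow : ∀ a ≤ Nat.clog 2 n, (2 : ℝ) ^ a ≤ 2 * n := by
    intro a ha
    exact_mod_cast (Nat.pow_le_pow_right (by norm_num) ha).trans (two_pow_clog_le hn)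
  -- each order of magnitude contributes at most `18 R √(n C)`
  have hterm : ∀ a ≤ Nat.clog 2 n,
      ((min (2 ^ a) C * R * (4 * groverIters n a + 8) : ℕ) : ℝ) ≤ 18 * R * √(n * C) := by
    intro a ha
    set μ : ℝ := ((min (2 ^ a) C : ℕ) : ℝ) with hμ
    have hμ0 : 0 ≤ μ := Nat.cast_nonneg _
    have hμ1 : μ ≤ 2 ^ a := by rw [hμ]; exact_mod_cast min_le_left _ _
    have hμ2 : μ ≤ C := by rw [hμ]; exact_mod_cast min_le_right _ _
    have hμ3 : μ ^ 2 ≤ 2 ^ a * C := by rw [sq]; exact mul_le_mul hμ1 hμ2 hμ0 (by positivity)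
    have hsq : √((n : ℝ) * C) ^ 2 = n * C := Real.sq_sqrt (by positivity)
    have h1 : μ * √((n : ℝ) / 2 ^ a) ≤ √(n * C) := by
      refine Real.le_sqrt_of_sq_le ?_
      rw [mul_pow, Real.sq_sqrt (by positivity), ← mul_div_assoc, div_le_iff₀ (by positivity)]
      nlinarith
    have h2 : μ ≤ 2 * √(n * C) := by
      have h3 : μ ^ 2 ≤ (2 * √(n * C)) ^ 2 := by
        rw [mul_pow, hsq]
        have := mul_le_mul_of_nonneg_right (hpow a ha) (Nat.cast_nonneg (α := ℝ) C)
        nlinarith [Nat.cast_nonneg (α := ℝ) C]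
      exact le_of_sq_le_sq h3 (by positivity)
    have h3 := mul_le_mul_of_nonneg_left (groverIters_le n a) hμ0
    have hR : (0 : ℝ) ≤ R := Nat.cast_nonneg _
    have h4 : μ * (4 * groverIters n a + 8) ≤ 18 * √(n * C) := by nlinarith
    have := mul_le_mul_of_nonneg_left h4 hR
    push_cast [← hμ] at this ⊢
    linarith
  have hlist : ∀ L : List ℕ, (∀ a ∈ L, a ≤ Nat.clog 2 n) →
      ((((L.flatMap fun a => List.replicate (min (2 ^ a) C * R) (groverIters n a)).map
        fun J => 4 * J + 8).sum : ℕ) : ℝ) ≤ L.length * (18 * R * √(n * C)) := by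
    intro L hL
    induction L with
    | nil => simp
    | cons a L ih =>
      rw [List.flatMap_cons, List.map_append, List.sum_append, List.map_replicate,
        List.sum_replicate, List.length_cons, smul_eq_mul]
      have h1 := hterm a (hL a (by simp))
      have h2 := ih fun b hb => hL b (by simp [hb])
      push_cast at h1 h2 ⊢
      linarith
  have := hlist (List.range (Nat.clog 2 n + 1)) (fun a ha => by
    rw [List.mem_range] at ha; omega)
  rw [List.length_range] at this
  exact_mod_cast this

/-! ### Independent sampling by thresholds -/

section Thresholds

variable {n N : ℕ}

/-- The indices of `S` whose uniformly random number `b i < N` is below the threshold `t i`: a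
random subset of `S`, in which `i` is kept independently with probability `t i / N`. -/
def below (b : Fin n → Fin N) (t : Fin n → ℕ) (S : Finset (Fin n)) : Finset (Fin n) :=
  S.filter fun i => (b i : ℕ) < t i

lemma card_fin_lt {t : ℕ} (ht : t ≤ N) :
    (Finset.univ.filter fun x : Fin N => (x : ℕ) < t).card = t := by
  rw [Fin.card_filter_val_lt, min_eq_right ht]

lemma expect_ite_lt {t : ℕ} (ht : t ≤ N) (c : ℝ) :
    𝔼 x : Fin N, (if (x : ℕ) < t then c else 0) = t / N * c := by
  rw [Fintype.expect_eq_sum_div_card, ← Finset.sum_filter, Finset.sum_const, card_fin_lt ht,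
    Fintype.card_fin, nsmul_eq_mul]
  ring

/-- Resampling one coordinate does not change the distribution. -/
lemma expect_update [NeZero N] (i : Fin n) (G : (Fin n → Fin N) → ℝ) :
    𝔼 b, G b = 𝔼 b, 𝔼 x, G (Function.update b i x) := by
  let e : (Fin n → Fin N) × Fin N ≃ (Fin n → Fin N) × Fin N :=
    ⟨fun y => (Function.update y.1 i y.2, y.1 i), fun y => (Function.update y.1 i y.2, y.1 i),
      fun y => by simp, fun y => by simp⟩
  have h1 : 𝔼 y : (Fin n → Fin N) × Fin N, G (Function.update y.1 i y.2) =
      𝔼 y : (Fin n → Fin N) × Fin N, G y.1 :=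
    Fintype.expect_equiv e _ _ fun y => rfl
  have h2 := Finset.expect_product' (Finset.univ : Finset (Fin n → Fin N))
    (Finset.univ : Finset (Fin N)) (fun b x => G (Function.update b i x))
  have h3 := Finset.expect_product' (Finset.univ : Finset (Fin n → Fin N))
    (Finset.univ : Finset (Fin N)) (fun b _ => G b)
  rw [Finset.univ_product_univ] at h2 h3
  rw [← h2, h1, h3]
  exact Finset.expect_congr rfl fun b _ => (Fintype.expect_const _).symm

lemma expect_ite_lt_mul [NeZero N] (i : Fin n) {t : ℕ} (ht : t ≤ N) (h : (Fin n → Fin N) → ℝ)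
    (hh : ∀ b x, h (Function.update b i x) = h b) :
    𝔼 b, (if (b i : ℕ) < t then h b else 0) = t / N * 𝔼 b, h b := by
  rw [expect_update i, Finset.mul_expect]
  refine Finset.expect_congr rfl fun b _ => ?_
  simp only [Function.update_self, hh]
  exact expect_ite_lt ht _

lemma expect_card_below [NeZero N] {t : Fin n → ℕ} (ht : ∀ i, t i ≤ N) (S : Finset (Fin n)) :
    𝔼 b : Fin n → Fin N, ((below b t S).card : ℝ) = ∑ i ∈ S, (t i : ℝ) / N := by
  have : ∀ b : Fin n → Fin N, ((below b t S).card : ℝ) =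
      ∑ i ∈ S, if (b i : ℕ) < t i then (1 : ℝ) else 0 := by
    intro b; simp [below]
  rw [Finset.expect_congr rfl fun b _ => this b, Finset.expect_sum_comm]
  refine Finset.sum_congr rfl fun i _ => ?_
  rw [expect_ite_lt_mul i (ht i) (fun _ => 1) (fun _ _ => rfl), Fintype.expect_const, mul_one]

/-- The distribution of a threshold sample. -/
lemma expect_below_eq [NeZero N] {t : Fin n → ℕ} (ht : ∀ i, t i ≤ N) {S R : Finset (Fin n)}
    (hR : R ⊆ S) :
    𝔼 b : Fin n → Fin N, (if below b t S = R then (1 : ℝ) else 0) =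
      sampleProb (fun i => (t i : ℝ) / N) S R := by
  have hN : (0 : ℝ) < N := by exact_mod_cast Nat.pos_of_neZero N
  set f : Fin n → Fin N → ℝ := fun i x =>
    if i ∈ R then (if (x : ℕ) < t i then 1 else 0)
    else if i ∈ S then (if (x : ℕ) < t i then 0 else 1) else 1 with hf
  have h1 : ∀ b : Fin n → Fin N, (if below b t S = R then (1 : ℝ) else 0) = ∏ i, f i (b i) := by
    intro b
    by_cases h : below b t S = R
    · rw [if_pos h]
      symm
      refine Finset.prod_eq_one fun i _ => ?_
      have hi : i ∈ R ↔ i ∈ S ∧ (b i : ℕ) < t i := by rw [← h, below, Finset.mem_filter]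
      simp only [hf]
      by_cases hiR : i ∈ R
      · rw [if_pos hiR, if_pos (hi.mp hiR).2]
      · rw [if_neg hiR]
        split_ifs with h1 h2
        · exact absurd (hi.mpr ⟨h1, h2⟩) hiR
        · rfl
        · rfl
    · rw [if_neg h]
      symm
      have : ∃ i, ¬ (i ∈ R ↔ i ∈ S ∧ (b i : ℕ) < t i) := by
        by_contra hc
        push Not at hc
        refine h (Finset.ext fun i => ?_)
        rw [below, Finset.mem_filter]
        exact (hc i).symm
      obtain ⟨i, hi⟩ := this
      refine Finset.prod_eq_zero (Finset.mem_univ i) ?_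
      simp only [hf]
      by_cases hiR : i ∈ R
      · rw [if_pos hiR, if_neg]
        exact fun hlt => hi ⟨fun _ => ⟨hR hiR, hlt⟩, fun _ => hiR⟩
      · rw [if_neg hiR]
        have : i ∈ S ∧ (b i : ℕ) < t i := by
          by_contra hc; exact hi ⟨fun h => absurd h hiR, fun h => absurd h hc⟩
        rw [if_pos this.1, if_pos this.2]
  have h2 : ∀ i, ∑ x, f i x = N * (if i ∈ R then (t i : ℝ) / N
      else if i ∈ S then 1 - (t i : ℝ) / N else 1) := by
    intro i
    have e1 : ∑ x : Fin N, (if (x : ℕ) < t i then (1 : ℝ) else 0) = t i := by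
      rw [Finset.sum_boole, card_fin_lt (ht i)]
    simp only [hf]
    split_ifs
    · rw [e1]; field_simp
    · have e2 : ∀ x : Fin N, (if (x : ℕ) < t i then (0 : ℝ) else 1) =
          1 - if (x : ℕ) < t i then (1 : ℝ) else 0 := fun x => by split_ifs <;> simp
      rw [Finset.sum_congr rfl fun x _ => e2 x, Finset.sum_sub_distrib, e1]
      simp; field_simp
    · simp
  rw [Finset.expect_congr rfl fun b _ => h1 b, Fintype.expect_eq_sum_div_card]
  have h3 := Finset.prod_univ_sum (fun _ : Fin n => (Finset.univ : Finset (Fin N))) f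
  rw [Fintype.piFinset_univ] at h3
  rw [← h3, Finset.prod_congr rfl fun i _ => h2 i, Finset.prod_mul_distrib, Finset.prod_const]
  simp only [Fintype.card_pi, Fintype.card_fin, Finset.prod_const, Finset.card_univ, Nat.cast_pow]
  rw [mul_div_cancel_left₀ _ (pow_ne_zero _ hN.ne'), sampleProb]
  rw [← Finset.prod_subset (Finset.subset_univ S) (fun i _ hi => by
      rw [if_neg (fun h => hi (hR h)), if_neg hi]),
    ← Finset.prod_sdiff hR, mul_comm]
  congr 1
  · exact Finset.prod_congr rfl fun i hi => if_pos hi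
  · refine Finset.prod_congr rfl fun i hi => ?_
    rw [Finset.mem_sdiff] at hi
    rw [if_neg hi.2, if_pos hi.1]

lemma expect_below_prop [NeZero N] {t : Fin n → ℕ} (ht : ∀ i, t i ≤ N) (S : Finset (Fin n))
    (P : Finset (Fin n) → Prop) [DecidablePred P] :
    𝔼 b : Fin n → Fin N, (if P (below b t S) then (1 : ℝ) else 0) =
      ∑ R ∈ S.powerset with P R, sampleProb (fun i => (t i : ℝ) / N) S R := by
  have h1 : ∀ b : Fin n → Fin N, (if P (below b t S) then (1 : ℝ) else 0) =
      ∑ R ∈ S.powerset with P R, if below b t S = R then (1 : ℝ) else 0 := by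
    intro b
    have hS : below b t S ∈ S.powerset := Finset.mem_powerset.mpr (Finset.filter_subset _ _)
    rw [Finset.sum_ite_eq]
    exact if_congr (by simp only [Finset.mem_filter, hS, true_and]) rfl rfl
  rw [Finset.expect_congr rfl fun b _ => h1 b, Finset.expect_sum_comm]
  refine Finset.sum_congr rfl fun R hR => ?_
  rw [Finset.mem_filter, Finset.mem_powerset] at hR
  exact expect_below_eq ht hR.1

/-- Adding a random set `D` to `T` reduces the weights of the other indices: their weights with
respect to `T ∪ D` are compared to those of the elements of `D`, because for every `i` the event
`i ∈ D` is independent of `D \ {i}`. -/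
lemma mul_expect_sum_compl_le [NeZero N] {t : ℕ} (ht : t ≤ N) (T : Finset (Fin n))
    {W : Finset (Fin n) → Fin n → ℝ} (hW : ∀ U i, 0 ≤ W U i) {B : ℝ}
    (hB : ∀ U, ∑ i ∈ U, W U i ≤ B) :
    (t : ℝ) / N * 𝔼 a : Fin n → Fin N,
      ∑ i ∈ (T ∪ below a (fun _ => t) Finset.univ)ᶜ,
        W (insert i (T ∪ below a (fun _ => t) Finset.univ)) i ≤ B := by
  set D : (Fin n → Fin N) → Finset (Fin n) := fun a => below a (fun _ => t) Finset.univ with hD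
  have hmem : ∀ a i, i ∈ D a ↔ (a i : ℕ) < t := fun a i => by simp [hD, below]
  have hnn : (0 : ℝ) ≤ t / N := by positivity
  have h1 : 𝔼 a, ∑ i ∈ (T ∪ D a)ᶜ, W (insert i (T ∪ D a)) i ≤
      ∑ i ∈ Tᶜ, 𝔼 a, W (insert i (T ∪ D a)) i := by
    rw [← Finset.expect_sum_comm]
    refine Finset.expect_le_expect fun a _ => ?_
    refine Finset.sum_le_sum_of_subset_of_nonneg ?_ fun i _ _ => hW _ _
    exact Finset.compl_subset_compl.mpr Finset.subset_union_left
  have h2 : ∀ i, (t : ℝ) / N * 𝔼 a, W (insert i (T ∪ D a)) i =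
      𝔼 a, if (a i : ℕ) < t then W (T ∪ D a) i else 0 := by
    intro i
    rw [← expect_ite_lt_mul i ht]
    · refine Finset.expect_congr rfl fun a _ => ?_
      split_ifs with h
      · rw [Finset.insert_eq_self.mpr (Finset.mem_union_right _ ((hmem a i).mpr h))]
      · rfl
    · intro a x
      congr 1
      ext k
      by_cases hk : k = i
      · simp [hk]
      · simp [hmem, hk]
  calc (t : ℝ) / N * 𝔼 a, ∑ i ∈ (T ∪ D a)ᶜ, W (insert i (T ∪ D a)) i
      ≤ t / N * ∑ i ∈ Tᶜ, 𝔼 a, W (insert i (T ∪ D a)) i := mul_le_mul_of_nonneg_left h1 hnn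
    _ = 𝔼 a, ∑ i ∈ Tᶜ, if (a i : ℕ) < t then W (T ∪ D a) i else 0 := by
        rw [Finset.mul_sum, Finset.expect_sum_comm]
        exact Finset.sum_congr rfl fun i _ => h2 i
    _ ≤ 𝔼 _a : Fin n → Fin N, B := by
        refine Finset.expect_le_expect fun a _ => le_trans ?_ (hB (T ∪ D a))
        rw [← Finset.sum_filter]
        refine Finset.sum_le_sum_of_subset_of_nonneg ?_ fun i _ _ => hW _ _
        intro i hi
        exact Finset.mem_union_right _ ((hmem a i).mpr (Finset.mem_filter.mp hi).2)
    _ = B := Fintype.expect_const _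

end Thresholds

/-! ### Coresets and their weights -/

section Weights

variable {n d : ℕ} {X : Type*} {a : Fin n → Pt d} {cost : Pt d → X → ℝ≥0}
  {w : Pt d → WSet d → ℝ≥0} {g : ℝ → ℕ → ℕ → ℝ} {sumw δ : ℝ}

lemma totalCost_add (B C : WSet d) (x : X) :
    totalCost cost (B + C) x = totalCost cost B x + totalCost cost C x :=
  Finsupp.sum_add_index' (fun _ => by simp) fun _ _ _ => by push_cast; ring

lemma IsCoreset.add_single {ε : ℝ} (hε : 0 ≤ ε) {T : Finset (Fin n)} {B : WSet d}
    (h : IsCoreset cost a ε T B) {i : Fin n} (hi : i ∉ T) :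
    IsCoreset cost a ε (insert i T) (B + Finsupp.single (a i) 1) := by
  classical
  refine ⟨fun p hp => ?_, fun x => ?_⟩
  · have := Finsupp.support_add hp
    rw [Finset.mem_union] at this
    rw [Finset.coe_insert]
    rcases this with hp | hp
    · obtain ⟨k, hk, rfl⟩ := h.1 hp
      exact ⟨k, Or.inr hk, rfl⟩
    · have := Finsupp.support_single_subset hp
      rw [Finset.mem_singleton] at this
      exact ⟨i, Or.inl rfl, this.symm⟩
  · have h1 : unitSet a (insert i T) = unitSet a T + Finsupp.single (a i) 1 := by
      rw [unitSet, Finset.sum_insert hi, add_comm]; rfl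
    have h2 : 0 ≤ totalCost cost (Finsupp.single (a i) 1) x :=
      Finset.sum_nonneg fun p _ => by positivity
    rw [h1, totalCost_add, totalCost_add]
    obtain ⟨h3, h4⟩ := h.2 x
    constructor <;> nlinarith

/-- The weight of `a i` with respect to a subset. -/
def wt (a : Fin n → Pt d) (w : Pt d → WSet d → ℝ≥0) (S : Finset (Fin n)) (i : Fin n) : ℝ :=
  w (a i) (unitSet a S)

lemma wt_nonneg (S : Finset (Fin n)) (i : Fin n) : 0 ≤ wt a w S i := NNReal.coe_nonneg _

lemma WeightConditions.wt_le (hw : WeightConditions a cost w g sumw δ) {S : Finset (Fin n)}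
    {i : Fin n} (hi : i ∈ S) : wt a w S i ≤ sumw :=
  (Finset.single_le_sum (fun k _ => wt_nonneg S k) hi).trans (hw.consistent_total S)

lemma WeightConditions.wt_anti (hw : WeightConditions a cost w g sumw δ)
    {S' S : Finset (Fin n)} (h : S' ⊆ S) {i : Fin n} (hi : i ∈ S) :
    wt a w S i ≤ wt a w (insert i S') i := by
  have := hw.uniform_sampling S' S h i hi
  rw [wt, wt, NNReal.coe_le_coe]
  convert this

/-- The answer of the oracle for a coreset of `{a_i : i ∈ T}` is close to the weight with respect
to the set `{a_i : i ∈ T}` itself. -/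
lemma WeightConditions.answer_bounds (hw : WeightConditions a cost w g sumw δ)
    {T : Finset (Fin n)} {B : WSet d} (hB : IsCoreset cost a 0.01 T B) (i : Fin n) :
    0.99 * wt a w (insert i T) i ≤
        w (a i) (B + if i ∉ T then Finsupp.single (a i) 1 else 0) ∧
      0.99 * (w (a i) (B + if i ∉ T then Finsupp.single (a i) 1 else 0) : ℝ) ≤
        wt a w (insert i T) i := by
  have key : IsCoreset cost a 0.01 (insert i T)
      (B + if i ∉ T then Finsupp.single (a i) 1 else 0) := by
    by_cases hi : i ∈ T
    · rw [if_neg (not_not.mpr hi), add_zero, Finset.insert_eq_self.mpr hi]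
      exact hB
    · rw [if_pos hi]
      exact hB.add_single (by norm_num) hi
  have := hw.coreset_preserves 0.01 (by norm_num) (by norm_num) _ _ key (a i)
  norm_num at this ⊢
  exact this

/-- Importance sampling by thresholds with probabilities that are powers of two. -/
lemma WeightConditions.le_expect_isCoreset (hw : WeightConditions a cost w g sumw δ)
    {ε : ℝ} (hε : 0 < ε) (hε1 : ε < 1) (hg : 0 < g ε n d) (S : Finset (Fin n)) {A : ℕ}
    {κ : Fin n → ℕ} (hA : ∀ i, κ i ≤ A)
    (hκ : ∀ i ∈ S, κ i = 0 ∨ g ε n d * wt a w S i * 2 ^ κ i ≤ 1)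
    {P : Finset (Fin n) → Prop} [DecidablePred P]
    (hP : ∀ R, P R ↔ IsCoreset cost a ε S (reweighted a (fun i => (2 ^ κ i)⁻¹) R)) :
    1 - δ ≤ 𝔼 b : Fin n → Fin (2 ^ A),
      (if P (below b (fun i => 2 ^ (A - κ i)) S) then (1 : ℝ) else 0) := by
  classical
  rw [expect_below_prop (fun i => Nat.pow_le_pow_right (by norm_num) (Nat.sub_le _ _))]
  have hq : (fun i => ((2 ^ (A - κ i) : ℕ) : ℝ) / ((2 ^ A : ℕ) : ℝ)) =
      fun i => ((2 : ℝ) ^ κ i)⁻¹ := by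
    ext i
    rw [← Nat.sub_add_cancel (hA i)]
    push_cast
    rw [Nat.add_sub_cancel, pow_add]
    field_simp
  rw [hq]
  set u : Fin n → ℝ := fun i => if i ∈ S then max ((2 ^ κ i)⁻¹ / g ε n d) (wt a w S i)
    else (2 ^ κ i)⁻¹ / g ε n d with hu
  have hle : ∀ i, ((2 : ℝ) ^ κ i)⁻¹ ≤ 1 := fun i =>
    inv_le_one_of_one_le₀ (one_le_pow₀ (by norm_num))
  have h1 : (fun i => min 1 (g ε n d * u i)) = fun i => ((2 : ℝ) ^ κ i)⁻¹ := by
    ext i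
    have h2 : g ε n d * ((2 ^ κ i)⁻¹ / g ε n d) = ((2 : ℝ) ^ κ i)⁻¹ := by
      field_simp
    simp only [hu]
    split_ifs with hi
    · rw [mul_max_of_nonneg _ _ hg.le, h2]
      rcases hκ i hi with h0 | h0
      · rw [h0, pow_zero, inv_one]
        exact min_eq_left (le_max_left _ _)
      · rw [max_eq_left, min_eq_right (hle i)]
        rw [← one_div, le_div_iff₀ (by positivity)]
        exact h0
    · rw [h2, min_eq_right (hle i)]
  have h3 := hw.importance_sampling ε hε hε1 S u fun i hi => by
    simp only [hu]
    rw [if_pos hi]; exact le_max_right _ _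
  rw [h1] at h3
  refine h3.trans (le_of_eq (Finset.sum_congr ?_ fun _ _ => rfl))
  ext R
  simp only [Finset.mem_filter, hP]

end Weights

/-! ### Rounded sampling probabilities -/

/-- The exponent `κ` of the sampling probability `2 ^ -κ` of a point, given its weight `z`, an
integer multiple of `2 ^ -u` times the total weight, and the intended sample size `σ`. -/
def expo (u : ℕ) (σ : ℝ) (z : ℕ) : ℕ := Nat.log 2 ⌊2 ^ u / (2 * σ * max (z : ℝ) 1)⌋₊

section Expo

variable {u : ℕ} {σ : ℝ} (z : ℕ)

lemma expo_le (hσ : 1 ≤ σ) : expo u σ z ≤ u := by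
  have h1 : (1 : ℝ) ≤ 2 * σ * max (z : ℝ) 1 := by
    have : (1 : ℝ) ≤ max (z : ℝ) 1 := le_max_right _ _
    nlinarith
  have h2 : (2 : ℝ) ^ u / (2 * σ * max (z : ℝ) 1) ≤ (2 ^ u : ℕ) := by
    push_cast
    exact div_le_self (by positivity) h1
  exact (Nat.log_mono_right (Nat.floor_le_of_le h2)).trans (Nat.log_pow (by norm_num) u).le

lemma expo_eq_zero_or (hσ : 1 ≤ σ) : expo u σ z = 0 ∨ 2 * σ * z * 2 ^ expo u σ z ≤ 2 ^ u := by
  have h1 : (0 : ℝ) < 2 * σ * max (z : ℝ) 1 := by positivity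
  by_cases h : ⌊(2 : ℝ) ^ u / (2 * σ * max (z : ℝ) 1)⌋₊ = 0
  · left; rw [expo, h, Nat.log_zero_right]
  · right
    have h2 : ((2 ^ expo u σ z : ℕ) : ℝ) ≤ 2 ^ u / (2 * σ * max (z : ℝ) 1) :=
      (Nat.cast_le.mpr (Nat.pow_log_le_self 2 h)).trans (Nat.floor_le (by positivity))
    push_cast at h2
    rw [le_div_iff₀ h1] at h2
    refine le_trans ?_ h2
    have h3 : (z : ℝ) ≤ max (z : ℝ) 1 := le_max_left _ _
    rw [mul_comm]
    gcongr

lemma le_expo (hσ : 1 ≤ σ) : (2 : ℝ) ^ u ≤ 4 * σ * (z + 1) * 2 ^ expo u σ z := by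
  have h1 : (0 : ℝ) < 2 * σ * max (z : ℝ) 1 := by positivity
  have h2 : (2 : ℝ) ^ u / (2 * σ * max (z : ℝ) 1) < 2 * 2 ^ expo u σ z := by
    set r := (2 : ℝ) ^ u / (2 * σ * max (z : ℝ) 1) with hr
    have h5 := Nat.lt_floor_add_one r
    have h6 : (⌊r⌋₊ : ℝ) + 1 ≤ ((2 ^ (expo u σ z + 1) : ℕ) : ℝ) := by
      rw [expo, ← hr]
      exact_mod_cast Nat.succ_le_of_lt (Nat.lt_pow_succ_log_self (b := 2) (by norm_num) ⌊r⌋₊)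
    push_cast [pow_succ] at h6
    linarith
  rw [div_lt_iff₀ h1] at h2
  have h3 : max (z : ℝ) 1 ≤ z + 1 := max_le (by linarith) (by linarith [Nat.cast_nonneg (α := ℝ) z])
  have h4 : (0 : ℝ) < 2 ^ expo u σ z := by positivity
  calc (2 : ℝ) ^ u ≤ 2 * 2 ^ expo u σ z * (2 * σ * max (z : ℝ) 1) := h2.le
    _ = 4 * σ * max (z : ℝ) 1 * 2 ^ expo u σ z := by ring
    _ ≤ _ := by gcongr

end Expo

/-! ### The sequence of tries -/

/-- The numerical parameters of the algorithm. Random seeds are pairs of sequences of `n` numbers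
of `bits` bits. Weights are multiples of `unit`, up to a total of about `2 ^ prec`; `coarse` and
`fine` are the intended sample sizes for a `1 / 100`-coreset and for the output. -/
structure Scheme (n : ℕ) where
  bits : ℕ
  prec : ℕ
  maxWord : ℕ
  unit : ℝ
  coarse : ℝ
  fine : ℝ
  prec_le : prec ≤ bits
  unit_pos : 0 < unit
  one_le_coarse : 1 ≤ coarse
  one_le_fine : 1 ≤ fine

namespace Scheme

variable {n : ℕ} (𝒮 : Scheme n)

/-- The first component selects the points that are added to the current set, the second one
samples from the resulting set. -/
abbrev Seed : Type := (Fin n → Fin (2 ^ 𝒮.bits)) × (Fin n → Fin (2 ^ 𝒮.bits))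

abbrev Word : Type := Fin (𝒮.maxWord + 1)

end Scheme

/-- A set `T` of indices, for which a coreset is known, and, unless `T` is everything and only the
output is left to be sampled, a number `j`: points will be added to `T` with probability
`2 ^ -j`. -/
abbrev Phase (n : ℕ) : Type := Finset (Fin n) × Option ℕ

namespace Scheme

variable {n : ℕ} (𝒮 : Scheme n) (st : Phase n) (ρ : 𝒮.Seed) (z : Fin n → 𝒮.Word)

/-- The intended sample size. -/
def size : ℝ := if st.2 = none then 𝒮.fine else 𝒮.coarse

/-- The set of which the next sample is taken. -/
def target : Finset (Fin n) :=
  match st.2 with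
  | none => st.1
  | some j => st.1 ∪ below ρ.1 (fun _ => 2 ^ (𝒮.bits - j)) Finset.univ

/-- The exponents of the sampling probabilities, if the oracle answers `z`. -/
def exponent (i : Fin n) : ℕ := expo 𝒮.prec (𝒮.size st) (z i)

/-- The sample. -/
def kept : Finset (Fin n) :=
  below ρ.2 (fun i => 2 ^ (𝒮.bits - 𝒮.exponent st z i)) (𝒮.target st ρ)

/-- The weights of the sample: the inverse sampling probabilities. -/
def output (i : Fin n) : 𝒮.Word :=
  if i ∈ 𝒮.kept st ρ z then Fin.ofNat _ (2 ^ 𝒮.exponent st z i) else 0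

/-- Larger samples are rejected. -/
def cap : ℕ := min n ⌊1000 * 𝒮.size st⌋₊

/-- What follows a sample that is accepted; `none` if it is the output. -/
def onAccept : Option (Phase n) :=
  match st.2 with
  | none => none
  | some 0 => some (Finset.univ, none)
  | some (j + 1) => some (𝒮.target st ρ, some j)

/-- What follows a sample that is rejected. -/
def onReject : Phase n := (st.1, st.2.map (· + 1))

/-- What follows a try. -/
def next : Option (Phase n) :=
  if (𝒮.kept st ρ z).card ≤ 𝒮.cap st then 𝒮.onAccept st ρ else some (onReject st)

end Scheme

/-- The weighted set that a list of words stands for. -/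
def listed {n d W : ℕ} (a : Fin n → Pt d) (Y : Fin n → Fin (W + 1)) : WSet d :=
  weightedSet a fun i => ((Y i : ℕ) : ℝ≥0)

lemma listed_zero {n d W : ℕ} (a : Fin n → Pt d) :
    listed a (fun _ => (0 : Fin (W + 1))) = 0 := by
  simp [listed, weightedSet]

/-- The words that the oracle returns for the loaded list `Y`, if the flag is set outside `T`. -/
def answers {n d : ℕ} (𝒮 : Scheme n) (a : Fin n → Pt d) (w : Pt d → WSet d → ℝ≥0)
    (T : Finset (Fin n)) (Y : Fin n → 𝒮.Word) (i : Fin n) : 𝒮.Word :=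
  ⟨min ⌈(w (a i) (listed a Y + if i ∉ T then Finsupp.single (a i) 1 else 0) : ℝ) / 𝒮.unit⌉₊
    𝒮.maxWord, Nat.lt_succ_of_le (min_le_right _ _)⟩

/-- The parameters of the algorithm are adapted to the weights. -/
structure Scheme.Fits {n d : ℕ} {X : Type*} (𝒮 : Scheme n) (a : Fin n → Pt d)
    (cost : Pt d → X → ℝ≥0) (w : Pt d → WSet d → ℝ≥0) (g : ℝ → ℕ → ℕ → ℝ) (sumw δ ε : ℝ) :
    Prop where
  conditions : WeightConditions a cost w g sumw δ
  eps_pos : 0 < ε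
  eps_lt : ε < 1
  coarse_eq : 𝒮.coarse = g 0.01 n d * sumw
  fine_eq : 𝒮.fine = g ε n d * sumw
  sumw_eq : sumw = 𝒮.unit * 2 ^ 𝒮.prec
  le_two_pow : n ≤ 2 ^ 𝒮.prec
  two_pow_le : 2 ^ (𝒮.prec + 1) ≤ 𝒮.maxWord

/-- The loaded list is a coreset of the current set. -/
structure Ready {n d W : ℕ} {X : Type*} (a : Fin n → Pt d) (cost : Pt d → X → ℝ≥0)
    (st : Phase n) (Y : Fin n → Fin (W + 1)) : Prop where
  coreset : IsCoreset cost a 0.01 st.1 (listed a Y)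
  eq_univ : st.2 = none → st.1 = Finset.univ

namespace Scheme.Fits

variable {n d : ℕ} {X : Type*} {𝒮 : Scheme n} {a : Fin n → Pt d} {cost : Pt d → X → ℝ≥0}
  {w : Pt d → WSet d → ℝ≥0} {g : ℝ → ℕ → ℕ → ℝ} {sumw δ ε : ℝ}
  {st : Phase n} {Y : Fin n → 𝒮.Word}

lemma _root_.Scheme.one_le_size (st : Phase n) : 1 ≤ 𝒮.size st := by
  unfold size; split_ifs
  exacts [𝒮.one_le_fine, 𝒮.one_le_coarse]

lemma sumw_pos (h : 𝒮.Fits a cost w g sumw δ ε) : 0 < sumw := by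
  rw [h.sumw_eq]; have := 𝒮.unit_pos; positivity

lemma _root_.Scheme.exponent_le (st : Phase n) (z : Fin n → 𝒮.Word) (i : Fin n) :
    𝒮.exponent st z i ≤ 𝒮.prec := expo_le _ (one_le_size st)

/-- The approximation parameter of the next sample. -/
def _root_.Scheme.precision (ε : ℝ) (st : Phase n) : ℝ := if st.2 = none then ε else 0.01

lemma precision_pos (h : 𝒮.Fits a cost w g sumw δ ε) : 0 < precision ε st := by
  unfold precision; split_ifs; exacts [h.eps_pos, by norm_num]

lemma precision_lt (h : 𝒮.Fits a cost w g sumw δ ε) : precision ε st < 1 := by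
  unfold precision; split_ifs; exacts [h.eps_lt, by norm_num]

lemma size_eq (h : 𝒮.Fits a cost w g sumw δ ε) : 𝒮.size st = g (precision ε st) n d * sumw := by
  unfold size precision; split_ifs; exacts [h.fine_eq, h.coarse_eq]

lemma g_pos (h : 𝒮.Fits a cost w g sumw δ ε) : 0 < g (precision ε st) n d := by
  have h1 := one_le_size (𝒮 := 𝒮) st
  rw [h.size_eq] at h1
  exact pos_of_mul_pos_left (lt_of_lt_of_le one_pos h1) h.sumw_pos.le

/-- The words determine the weights up to a constant factor and one unit; in particular, nothing
is cut off. -/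
lemma answers_bounds (h : 𝒮.Fits a cost w g sumw δ ε) (hY : Ready a cost st Y) (i : Fin n) :
    0.99 * wt a w (insert i st.1) i ≤ (answers 𝒮 a w st.1 Y i : ℕ) * 𝒮.unit ∧
      0.99 * ((answers 𝒮 a w st.1 Y i : ℕ) * 𝒮.unit) ≤
        wt a w (insert i st.1) i + 𝒮.unit := by
  obtain ⟨h1, h2⟩ := h.conditions.answer_bounds hY.coreset i
  have h3 := h.conditions.wt_le (Finset.mem_insert_self i st.1)
  have hu := 𝒮.unit_pos
  set y : ℝ := (w (a i) (listed a Y + if i ∉ st.1 then Finsupp.single (a i) 1 else 0) : ℝ)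
    with hy
  have hy0 : 0 ≤ y := NNReal.coe_nonneg _
  have h4 : ⌈y / 𝒮.unit⌉₊ ≤ 𝒮.maxWord := by
    refine le_trans (Nat.ceil_le.mpr ?_) h.two_pow_le
    rw [div_le_iff₀ hu]
    rw [h.sumw_eq] at h3
    push_cast [pow_succ]
    nlinarith
  have h5 : ((answers 𝒮 a w st.1 Y i : ℕ) : ℝ) = ⌈y / 𝒮.unit⌉₊ := by
    simp only [answers, ← hy]
    rw [min_eq_left h4]
  rw [h5]
  have h6 := Nat.le_ceil (y / 𝒮.unit)
  have h7 := (Nat.ceil_lt_add_one (div_nonneg hy0 hu.le)).le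
  rw [div_le_iff₀ hu] at h6
  have h8 : y / 𝒮.unit * 𝒮.unit = y := div_mul_cancel₀ y hu.ne'
  refine ⟨h1.trans h6, ?_⟩
  nlinarith

lemma exponent_eq_zero_or (h : 𝒮.Fits a cost w g sumw δ ε) (hY : Ready a cost st Y)
    {S : Finset (Fin n)} (hS : st.1 ⊆ S) {i : Fin n} (hi : i ∈ S) :
    𝒮.exponent st (answers 𝒮 a w st.1 Y) i = 0 ∨
      g (precision ε st) n d * wt a w S i * 2 ^ 𝒮.exponent st (answers 𝒮 a w st.1 Y) i ≤ 1 := by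
  refine (expo_eq_zero_or _ (one_le_size st)).imp_right fun h1 => ?_
  rw [h.size_eq, h.sumw_eq] at h1
  have hg := h.g_pos (st := st)
  have h2 := (h.answers_bounds hY i).1
  have h3 := h.conditions.wt_anti hS hi
  set z : ℝ := ((answers 𝒮 a w st.1 Y i : ℕ) : ℝ)
  have h4 : wt a w S i ≤ 2 * (z * 𝒮.unit) := by
    have := wt_nonneg (a := a) (w := w) (insert i st.1) i
    linarith
  have h5 : (0 : ℝ) < 2 ^ 𝒮.prec := by positivity
  refine le_of_mul_le_mul_right ?_ h5
  rw [one_mul]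
  refine le_trans ?_ h1
  rw [exponent, h.size_eq, h.sumw_eq]
  calc _ ≤ g (precision ε st) n d * (2 * (z * 𝒮.unit)) * 2 ^ expo 𝒮.prec
        (g (precision ε st) n d * (𝒮.unit * 2 ^ 𝒮.prec)) (answers 𝒮 a w st.1 Y i) *
        2 ^ 𝒮.prec := by gcongr
    _ = _ := by ring

lemma inv_two_pow_exponent_le (h : 𝒮.Fits a cost w g sumw δ ε) (hY : Ready a cost st Y)
    (i : Fin n) :
    ((2 : ℝ) ^ 𝒮.exponent st (answers 𝒮 a w st.1 Y) i)⁻¹ ≤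
      5 * g (precision ε st) n d * wt a w (insert i st.1) i + 9 * (𝒮.size st / n) := by
  have hn : (0 : ℝ) < n := by exact_mod_cast i.pos
  have h1 := le_expo (u := 𝒮.prec) (answers 𝒮 a w st.1 Y i : ℕ) (one_le_size (𝒮 := 𝒮) st)
  have hg := h.g_pos (st := st)
  have hu := 𝒮.unit_pos
  have h2 := (h.answers_bounds hY i).2
  have h3 := wt_nonneg (a := a) (w := w) (insert i st.1) i
  change _ ≤ _ * (2 : ℝ) ^ 𝒮.exponent st (answers 𝒮 a w st.1 Y) i at h1
  set z : ℝ := ((answers 𝒮 a w st.1 Y i : ℕ) : ℝ)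
  set κ := 𝒮.exponent st (answers 𝒮 a w st.1 Y) i
  have h5 : (0 : ℝ) < 2 ^ 𝒮.prec := by positivity
  have h6 : (n : ℝ) ≤ 2 ^ 𝒮.prec := by exact_mod_cast h.le_two_pow
  have h7 : ((2 : ℝ) ^ κ)⁻¹ ≤ 4 * 𝒮.size st * (z + 1) / 2 ^ 𝒮.prec := by
    rw [le_div_iff₀ h5, inv_mul_le_iff₀ (by positivity)]
    linarith
  refine h7.trans ?_
  have h8 : 4 * 𝒮.size st * (z + 1) / 2 ^ 𝒮.prec =
      4 * g (precision ε st) n d * (z * 𝒮.unit) + 4 * (𝒮.size st / 2 ^ 𝒮.prec) := by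
    rw [h.size_eq, h.sumw_eq]
    field_simp
  have h9 : z * 𝒮.unit ≤ 1.02 * (wt a w (insert i st.1) i + 𝒮.unit) := by linarith
  have h10 : g (precision ε st) n d * 𝒮.unit = 𝒮.size st / 2 ^ 𝒮.prec := by
    rw [h.size_eq, h.sumw_eq]
    field_simp
  have h11 : 𝒮.size st / 2 ^ 𝒮.prec ≤ 𝒮.size st / n := by
    have := one_le_size (𝒮 := 𝒮) st
    gcongr
  rw [h8]
  have h12 : g (precision ε st) n d * (z * 𝒮.unit) ≤
      g (precision ε st) n d * (1.02 * (wt a w (insert i st.1) i + 𝒮.unit)) := by gcongr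
  have h13 : 0 ≤ g (precision ε st) n d * wt a w (insert i st.1) i := by positivity
  nlinarith

lemma _root_.Scheme.subset_target (st : Phase n) (ρ : 𝒮.Seed) : st.1 ⊆ 𝒮.target st ρ := by
  unfold target
  split
  exacts [subset_rfl, Finset.subset_union_left]

lemma listed_output (h : 𝒮.Fits a cost w g sumw δ ε) (ρ : 𝒮.Seed) (z : Fin n → 𝒮.Word) :
    listed a (𝒮.output st ρ z) =
      reweighted a (fun i => (2 ^ 𝒮.exponent st z i)⁻¹) (𝒮.kept st ρ z) := by
  rw [listed, weightedSet, reweighted, ← Finset.sum_subset (Finset.subset_univ (𝒮.kept st ρ z))]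
  · refine Finset.sum_congr rfl fun i hi => ?_
    congr 1
    rw [output, if_pos hi, Fin.val_ofNat, Nat.mod_eq_of_lt]
    · rw [one_div, inv_inv]
      ext
      rw [Real.coe_toNNReal _ (by positivity)]
      push_cast; rfl
    · refine Nat.lt_succ_of_le (le_trans ?_ h.two_pow_le)
      exact Nat.pow_le_pow_right (by norm_num) ((exponent_le st z i).trans (Nat.le_succ _))
  · intro i _ hi
    rw [output, if_neg hi]
    simp

open Classical in
/-- A sample is a coreset with probability at least `1 - δ`. -/
lemma le_expect_isCoreset (h : 𝒮.Fits a cost w g sumw δ ε) (hY : Ready a cost st Y)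
    (ρ₁ : Fin n → Fin (2 ^ 𝒮.bits)) :
    1 - δ ≤ 𝔼 ρ₂, (if IsCoreset cost a (precision ε st) (𝒮.target st (ρ₁, ρ₂))
      (listed a (𝒮.output st (ρ₁, ρ₂) (answers 𝒮 a w st.1 Y))) then (1 : ℝ) else 0) := by
  have := h.conditions.le_expect_isCoreset h.precision_pos h.precision_lt h.g_pos
    (𝒮.target st (ρ₁, ρ₁)) (A := 𝒮.bits) (κ := 𝒮.exponent st (answers 𝒮 a w st.1 Y))
    (fun i => (exponent_le _ _ i).trans 𝒮.prec_le)
    (fun i hi => h.exponent_eq_zero_or hY (subset_target st _) hi)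
    (P := fun R => IsCoreset cost a (precision ε st) (𝒮.target st (ρ₁, ρ₁))
      (reweighted a (fun i => (2 ^ 𝒮.exponent st (answers 𝒮 a w st.1 Y) i)⁻¹) R))
    (fun _ => Iff.rfl)
  refine this.trans (le_of_eq (Finset.expect_congr rfl fun ρ₂ _ => ?_))
  have h1 : 𝒮.target st (ρ₁, ρ₂) = 𝒮.target st (ρ₁, ρ₁) := by unfold target; rfl
  rw [h.listed_output, kept, h1]

/-- The expected size of a sample. -/
lemma expect_card_kept_le (h : 𝒮.Fits a cost w g sumw δ ε) (hY : Ready a cost st Y)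
    (ρ₁ : Fin n → Fin (2 ^ 𝒮.bits)) :
    𝔼 ρ₂, ((𝒮.kept st (ρ₁, ρ₂) (answers 𝒮 a w st.1 Y)).card : ℝ) ≤
      5 * g (precision ε st) n d * (∑ i ∈ 𝒮.target st (ρ₁, ρ₁), wt a w (insert i st.1) i) +
        9 * 𝒮.size st := by
  have h1 : ∀ ρ₂, 𝒮.target st (ρ₁, ρ₂) = 𝒮.target st (ρ₁, ρ₁) := by intro; unfold target; rfl
  simp only [kept, h1]
  rw [expect_card_below (fun i => Nat.pow_le_pow_right (by norm_num) (Nat.sub_le _ _))]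
  have h2 : ∀ i ∈ 𝒮.target st (ρ₁, ρ₁),
      ((2 ^ (𝒮.bits - 𝒮.exponent st (answers 𝒮 a w st.1 Y) i) : ℕ) : ℝ) /
        ((2 ^ 𝒮.bits : ℕ) : ℝ) ≤
      5 * g (precision ε st) n d * wt a w (insert i st.1) i + 9 * (𝒮.size st / n) := by
    intro i _
    refine le_trans (le_of_eq ?_) (h.inv_two_pow_exponent_le hY i)
    have := (exponent_le st (answers 𝒮 a w st.1 Y) i).trans 𝒮.prec_le
    nth_rewrite 2 [← Nat.sub_add_cancel this]
    push_cast [pow_add]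
    field_simp
  refine (Finset.sum_le_sum h2).trans ?_
  rw [Finset.sum_add_distrib, ← Finset.mul_sum, Finset.sum_const, nsmul_eq_mul]
  refine add_le_add le_rfl ?_
  have h3 : ((𝒮.target st (ρ₁, ρ₁)).card : ℝ) ≤ n := by
    exact_mod_cast (Finset.card_le_univ _).trans (Fintype.card_fin n).le
  have h4 := one_le_size (𝒮 := 𝒮) st
  rcases Nat.eq_zero_or_pos n with h0 | h0
  · subst h0
    simp; linarith
  · have : (0 : ℝ) < n := by exact_mod_cast h0
    calc _ ≤ (n : ℝ) * (9 * (𝒮.size st / n)) := by gcongr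
      _ = _ := by field_simp

lemma _root_.Scheme.ite_card_kept_le (st : Phase n) (ρ : 𝒮.Seed) (z : Fin n → 𝒮.Word) :
    (if (𝒮.kept st ρ z).card ≤ 𝒮.cap st then (0 : ℝ) else 1) ≤
      (𝒮.kept st ρ z).card / (1000 * 𝒮.size st) := by
  have h1 := one_le_size (𝒮 := 𝒮) st
  split_ifs with h
  · positivity
  · rw [one_le_div (by positivity)]
    have h2 : (𝒮.kept st ρ z).card ≤ n := (Finset.card_le_univ _).trans (Fintype.card_fin n).le
    rw [cap] at h
    have h3 : ⌊1000 * 𝒮.size st⌋₊ < (𝒮.kept st ρ z).card := by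
      by_contra h4
      exact h (le_min h2 (not_lt.mp h4))
    exact (Nat.lt_of_floor_lt h3).le

end Scheme.Fits

/-! ### A potential that decreases in expectation -/

lemma expect_prod {α β : Type*} [Fintype α] [Fintype β] (f : α × β → ℝ) :
    𝔼 p, f p = 𝔼 x, 𝔼 y, f (x, y) := by
  have := Finset.expect_product' (Finset.univ : Finset α) (Finset.univ : Finset β)
    (fun x y => f (x, y))
  rwa [Finset.univ_product_univ] at this

/-- The sum of the weights of the points outside `T`, each with respect to `T` and the point. -/
def outerWeight {n d : ℕ} (a : Fin n → Pt d) (w : Pt d → WSet d → ℝ≥0) (T : Finset (Fin n)) : ℝ :=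
  ∑ i ∈ Tᶜ, wt a w (insert i T) i

/-- The potential of a phase. With a set `T` and the probability `2 ^ -j` for the points to be
added, it balances the number of phases to go, measured by `√2 ^ j`, and the risk of a sample that
is too large. -/
def potential {n d : ℕ} (a : Fin n → Pt d) (w : Pt d → WSet d → ℝ≥0) (sumw : ℝ)
    (st : Phase n) : ℝ :=
  match st.2 with
  | none => 1 / 2
  | some j => √2 ^ j + outerWeight a w st.1 / sumw / (10 * √2 ^ j)

namespace Scheme.Fits

variable {n d : ℕ} {X : Type*} {𝒮 : Scheme n} {a : Fin n → Pt d} {cost : Pt d → X → ℝ≥0}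
  {w : Pt d → WSet d → ℝ≥0} {g : ℝ → ℕ → ℕ → ℝ} {sumw δ ε : ℝ}
  {st : Phase n} {Y : Fin n → 𝒮.Word}

lemma _root_.outerWeight_nonneg (T : Finset (Fin n)) : 0 ≤ outerWeight a w T :=
  Finset.sum_nonneg fun _ _ => wt_nonneg _ _

lemma one_half_le_potential (h : 𝒮.Fits a cost w g sumw δ ε) (st : Phase n) :
    1 / 2 ≤ potential a w sumw st := by
  have hs := h.sumw_pos
  unfold potential
  split
  · exact le_rfl
  · rename_i j _
    have h1 : (1 : ℝ) ≤ √2 ^ j := one_le_pow₀ (Real.one_le_sqrt.mpr (by norm_num))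
    have h2 : 0 ≤ outerWeight a w st.1 / sumw / (10 * √2 ^ j) := by
      have := outerWeight_nonneg (a := a) (w := w) st.1
      positivity
    linarith

/-- The probability that a sample is rejected. -/
lemma expect_reject_le (h : 𝒮.Fits a cost w g sumw δ ε) (hY : Ready a cost st Y) {x : ℝ}
    (hx : 𝔼 ρ₁ : Fin n → Fin (2 ^ 𝒮.bits),
      ∑ i ∈ 𝒮.target st (ρ₁, ρ₁), wt a w (insert i st.1) i ≤ sumw * (1 + x)) :
    𝔼 ρ : 𝒮.Seed, (if (𝒮.kept st ρ (answers 𝒮 a w st.1 Y)).card ≤ 𝒮.cap st then (0 : ℝ) else 1) ≤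
      (14 + 5 * x) / 1000 := by
  have hs := one_le_size (𝒮 := 𝒮) st
  refine (Finset.expect_le_expect fun ρ _ => ite_card_kept_le st ρ _).trans ?_
  rw [← Finset.expect_div, expect_prod, div_le_div_iff₀ (by positivity) (by norm_num)]
  have h1 := Finset.expect_le_expect (s := Finset.univ) fun ρ₁ _ => h.expect_card_kept_le hY ρ₁
  rw [Finset.expect_add_distrib, ← Finset.mul_expect, Fintype.expect_const] at h1
  have h2 : g (precision ε st) n d * (𝔼 ρ₁ : Fin n → Fin (2 ^ 𝒮.bits),
      ∑ i ∈ 𝒮.target st (ρ₁, ρ₁), wt a w (insert i st.1) i) ≤ 𝒮.size st * (1 + x) := by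
    rw [h.size_eq, mul_assoc]
    exact mul_le_mul_of_nonneg_left hx h.g_pos.le
  nlinarith

lemma sum_wt_le (h : 𝒮.Fits a cost w g sumw δ ε) (T : Finset (Fin n)) :
    ∑ i ∈ T, wt a w (insert i T) i ≤ sumw := by
  refine le_trans (le_of_eq (Finset.sum_congr rfl fun i hi => ?_)) (h.conditions.consistent_total T)
  rw [Finset.insert_eq_self.mpr hi, wt]

lemma expect_sum_target_le (h : 𝒮.Fits a cost w g sumw δ ε) {j : ℕ} (hj : j ≤ 𝒮.bits)
    (T : Finset (Fin n)) :
    𝔼 ρ₁ : Fin n → Fin (2 ^ 𝒮.bits), ∑ i ∈ 𝒮.target (T, some j) (ρ₁, ρ₁), wt a w (insert i T) i ≤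
      sumw * (1 + outerWeight a w T / sumw / 2 ^ j) := by
  have h1 : ∀ ρ₁ : Fin n → Fin (2 ^ 𝒮.bits),
      ∑ i ∈ 𝒮.target (T, some j) (ρ₁, ρ₁), wt a w (insert i T) i ≤ sumw +
        ∑ i ∈ Tᶜ, if (ρ₁ i : ℕ) < 2 ^ (𝒮.bits - j) then wt a w (insert i T) i else 0 := by
    intro ρ₁
    have e1 : 𝒮.target (T, some j) (ρ₁, ρ₁) =
        T ∪ Tᶜ.filter fun i => (ρ₁ i : ℕ) < 2 ^ (𝒮.bits - j) := by
      ext i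
      simp only [target, below, Finset.mem_union, Finset.mem_filter, Finset.mem_univ, true_and,
        Finset.mem_compl]
      tauto
    rw [e1, Finset.sum_union, Finset.sum_filter]
    · exact add_le_add (h.sum_wt_le T) le_rfl
    · rw [Finset.disjoint_left]
      intro i hi hi'
      exact (Finset.mem_compl.mp (Finset.mem_filter.mp hi').1) hi
  refine (Finset.expect_le_expect fun ρ₁ _ => h1 ρ₁).trans ?_
  rw [Finset.expect_add_distrib, Fintype.expect_const, Finset.expect_sum_comm]
  have h2 : ∀ i, 𝔼 ρ₁ : Fin n → Fin (2 ^ 𝒮.bits), (if (ρ₁ i : ℕ) < 2 ^ (𝒮.bits - j)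
      then wt a w (insert i T) i else 0) = wt a w (insert i T) i / 2 ^ j := by
    intro i
    rw [expect_ite_lt_mul i (Nat.pow_le_pow_right (by norm_num) (Nat.sub_le _ _))
      (fun _ => wt a w (insert i T) i) (fun _ _ => rfl), Fintype.expect_const]
    nth_rewrite 2 [← Nat.sub_add_cancel hj]
    push_cast [pow_add]
    field_simp
  rw [Finset.sum_congr rfl fun i _ => h2 i, ← Finset.sum_div]
  have := h.sumw_pos
  rw [outerWeight]
  apply le_of_eq
  field_simp

lemma expect_outerWeight_target_le (h : 𝒮.Fits a cost w g sumw δ ε) {j : ℕ} (hj : j ≤ 𝒮.bits)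
    (T : Finset (Fin n)) :
    𝔼 ρ₁ : Fin n → Fin (2 ^ 𝒮.bits), outerWeight a w (𝒮.target (T, some j) (ρ₁, ρ₁)) ≤
      sumw * 2 ^ j := by
  have h1 := mul_expect_sum_compl_le (N := 2 ^ 𝒮.bits) (t := 2 ^ (𝒮.bits - j))
    (Nat.pow_le_pow_right (by norm_num) (Nat.sub_le _ _)) T (W := wt a w) wt_nonneg
    (B := sumw) h.conditions.consistent_total
  have h2 : ((2 ^ (𝒮.bits - j) : ℕ) : ℝ) / ((2 ^ 𝒮.bits : ℕ) : ℝ) = (2 ^ j)⁻¹ := by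
    nth_rewrite 2 [← Nat.sub_add_cancel hj]
    push_cast [pow_add]
    field_simp
  rw [h2, inv_mul_le_iff₀ (by positivity), mul_comm] at h1
  exact h1

/-- The numerical core of the decrease of the potential: `x` is the sum of the outer weights, in
units of the total weight, times the probability for the points to be added, and `P` is the
probability of rejection. -/
lemma _root_.potential_step_aux {x P : ℝ} (hx : 0 ≤ x) (hP : 0 ≤ P) (hP1 : P ≤ 1)
    (hPx : P ≤ (14 + 5 * x) / 1000) :
    0.6 * √2 + P * (√2 + √2 * x / 20) ≤ 0.9 * (1 + x / 10) := by
  have h1 : √2 ≤ 1.4143 := by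
    rw [Real.sqrt_le_left (by norm_num)]; norm_num
  have h0 : 0 ≤ √2 := Real.sqrt_nonneg 2
  have h2 : P * (√2 + √2 * x / 20) ≤ P * (1.4143 + 0.0708 * x) := by
    refine mul_le_mul_of_nonneg_left ?_ hP
    nlinarith
  rcases le_total x 180 with h3 | h3
  · have h4 : P * (1.4143 + 0.0708 * x) ≤ (14 + 5 * x) / 1000 * (1.4143 + 0.0708 * x) :=
      mul_le_mul_of_nonneg_right hPx (by positivity)
    nlinarith
  · have h4 : P * (1.4143 + 0.0708 * x) ≤ 1 * (1.4143 + 0.0708 * x) :=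
      mul_le_mul_of_nonneg_right hP1 (by positivity)
    nlinarith

/-- The potential decreases by a constant factor in expectation. -/
theorem expect_potential_le (h : 𝒮.Fits a cost w g sumw δ ε) (hY : Ready a cost st Y)
    (hst : ∀ j ∈ st.2, j ≤ 𝒮.bits) :
    𝔼 ρ : 𝒮.Seed, ((𝒮.next st ρ (answers 𝒮 a w st.1 Y)).elim 0 (potential a w sumw)) ≤
      0.9 * potential a w sumw st := by
  set z := answers 𝒮 a w st.1 Y with hz
  set rej : 𝒮.Seed → ℝ := fun ρ => if (𝒮.kept st ρ z).card ≤ 𝒮.cap st then 0 else 1 with hrej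
  have hs := h.sumw_pos
  have hpos : ∀ st', 0 ≤ potential a w sumw st' := fun st' =>
    (by norm_num : (0 : ℝ) ≤ 1 / 2).trans (h.one_half_le_potential st')
  have h0 : ∀ ρ, (𝒮.next st ρ z).elim 0 (potential a w sumw) ≤
      (𝒮.onAccept st ρ).elim 0 (potential a w sumw) +
        rej ρ * potential a w sumw (onReject st) := by
    intro ρ
    simp only [next, hrej]
    split_ifs
    · simp
    · have : 0 ≤ (𝒮.onAccept st ρ).elim 0 (potential a w sumw) := by
        cases 𝒮.onAccept st ρ
        exacts [le_rfl, hpos _]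
      simp only [Option.elim_some, one_mul]
      linarith
  refine (Finset.expect_le_expect fun ρ _ => h0 ρ).trans ?_
  rw [Finset.expect_add_distrib, ← Finset.expect_mul]
  have hP0 : 0 ≤ 𝔼 ρ, rej ρ := Finset.expect_nonneg fun ρ _ => by
    simp only [hrej]; split_ifs <;> norm_num
  have hP1 : 𝔼 ρ, rej ρ ≤ 1 := by
    refine (Finset.expect_le_expect (g := fun _ => 1) fun ρ _ => ?_).trans_eq
      (Fintype.expect_const _)
    simp only [hrej]; split_ifs <;> norm_num
  obtain ⟨T, m⟩ := st
  cases m with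
  | none =>
    have h1 : 𝔼 ρ, rej ρ ≤ (14 + 5 * 0) / 1000 := by
      refine h.expect_reject_le hY (x := 0) ?_
      refine (Finset.expect_le_expect (g := fun _ => sumw * (1 + 0)) fun ρ _ => ?_).trans_eq
        (Fintype.expect_const _)
      simpa [target] using h.sum_wt_le T
    simp only [onAccept, onReject, potential, Option.elim_none, Fintype.expect_const,
      Option.map_none] at h1 ⊢
    linarith
  | some j =>
    have hj : j ≤ 𝒮.bits := hst j rfl
    set Φ := outerWeight a w T / sumw with hΦ
    have hΦ0 : 0 ≤ Φ := div_nonneg (outerWeight_nonneg _) hs.le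
    have h2 : √2 * √2 = (2 : ℝ) := Real.mul_self_sqrt (by norm_num)
    have hc : 1.4 ≤ √2 := Real.le_sqrt_of_sq_le (by norm_num)
    set c := √2 with hcdef
    set r := c ^ j with hr
    have hr1 : 1 ≤ r := one_le_pow₀ (by linarith)
    have hrr : r * r = 2 ^ j := by rw [hr, ← mul_pow, h2]
    set x := Φ / 2 ^ j with hx
    have hx0 : 0 ≤ x := by positivity
    have hΦx : Φ = r * r * x := by rw [hx, hrr]; field_simp
    have h3 : 𝔼 ρ, rej ρ ≤ (14 + 5 * x) / 1000 :=
      h.expect_reject_le hY (h.expect_sum_target_le hj T)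
    -- After acceptance, the first term of the potential shrinks by the factor `√2`, and the second
    -- one is at most a tenth of `√2 ^ j * √2`, whatever it was before.
    have h4 : 𝔼 ρ : 𝒮.Seed, (𝒮.onAccept (T, some j) ρ).elim 0 (potential a w sumw) ≤
        0.6 * c * r := by
      cases j with
      | zero =>
        simp only [onAccept, potential, Option.elim_some, Fintype.expect_const]
        nlinarith
      | succ j =>
        have e1 : r = c ^ j * c := by rw [hr, pow_succ]
        have hc0 : 0 < c := by linarith
        have hcj : 0 < c ^ j := by positivity
        simp only [onAccept, potential, Option.elim_some]
        rw [Finset.expect_add_distrib, Fintype.expect_const, ← Finset.expect_div,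
          ← Finset.expect_div, expect_prod]
        have e2 := h.expect_outerWeight_target_le hj T
        have e3 : 𝔼 ρ₁ : Fin n → Fin (2 ^ 𝒮.bits), 𝔼 ρ₂ : Fin n → Fin (2 ^ 𝒮.bits),
            outerWeight a w (𝒮.target (T, some (j + 1)) (ρ₁, ρ₂)) =
            𝔼 ρ₁ : Fin n → Fin (2 ^ 𝒮.bits),
              outerWeight a w (𝒮.target (T, some (j + 1)) (ρ₁, ρ₁)) :=
          Finset.expect_congr rfl fun ρ₁ _ => by
            simp only [target]; exact Fintype.expect_const _
        rw [e3]
        have e4 : (𝔼 ρ₁ : Fin n → Fin (2 ^ 𝒮.bits),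
            outerWeight a w (𝒮.target (T, some (j + 1)) (ρ₁, ρ₁))) / sumw / (10 * c ^ j) ≤
            sumw * 2 ^ (j + 1) / sumw / (10 * c ^ j) := by gcongr
        have e5 : sumw * 2 ^ (j + 1) / sumw / (10 * c ^ j) = c ^ j * (c * c) / 10 := by
          rw [← hrr, e1]
          field_simp
        have e6 : c ^ j = c * r / 2 := by rw [e1]; linear_combination -(c ^ j) / 2 * h2
        rw [e5, h2] at e4
        linarith
    have h5 : potential a w sumw (onReject (T, some j)) = r * (c + c * x / 20) := by
      simp only [onReject, potential, Option.map_some]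
      rw [← hcdef, ← hΦ, pow_succ, ← hr, hΦx]
      have : c ≠ 0 := by linarith
      have : r ≠ 0 := by linarith
      field_simp
      linear_combination (-10 * x) * h2
    have h6 : potential a w sumw (T, some j) = r * (1 + x / 10) := by
      simp only [potential]
      rw [← hcdef, ← hΦ, ← hr, hΦx]
      have : r ≠ 0 := by linarith
      field_simp
    rw [h5, h6]
    have h7 := potential_step_aux hx0 hP0 hP1 h3
    rw [← hcdef] at h7
    nlinarith

end Scheme.Fits

/-! ### The probability of success -/

/-- A bound on the probability that `k` tries, from a potential `z`, do not suffice, if each of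
them may in addition fail with probability `2 * δ`. -/
def failBound (δ : ℝ) (k : ℕ) (z : ℝ) : ℝ :=
  2 * 0.9 ^ k * z + 2 * δ * ∑ t ∈ Finset.range k, min 1 (2 * 0.9 ^ t * z)

lemma failBound_nonneg {δ : ℝ} (hδ : 0 ≤ δ) (k : ℕ) {z : ℝ} (hz : 0 ≤ z) :
    0 ≤ failBound δ k z := by
  have : 0 ≤ ∑ t ∈ Finset.range k, min 1 (2 * 0.9 ^ t * z) :=
    Finset.sum_nonneg fun t _ => le_min zero_le_one (by positivity)
  unfold failBound
  positivity

lemma failBound_succ {δ : ℝ} (k : ℕ) {z : ℝ} (hz : 1 / 2 ≤ z) :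
    failBound δ (k + 1) z = failBound δ k (0.9 * z) + 2 * δ := by
  rw [failBound, failBound, Finset.sum_range_succ', pow_zero, min_eq_left (by linarith)]
  have : ∀ t, (2 : ℝ) * 0.9 ^ (t + 1) * z = 2 * 0.9 ^ t * (0.9 * z) := fun t => by
    rw [pow_succ]; ring
  simp only [this]
  ring

/-- The bound is concave and monotone in the potential. -/
lemma expect_failBound_le {δ : ℝ} (hδ : 0 ≤ δ) (k : ℕ) {α : Type*} [Fintype α] [Nonempty α]
    {f : α → ℝ} {z : ℝ} (hf : 𝔼 x, f x ≤ z) : 𝔼 x, failBound δ k (f x) ≤ failBound δ k z := by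
  simp only [failBound]
  rw [Finset.expect_add_distrib, ← Finset.mul_expect, ← Finset.mul_expect, Finset.expect_sum_comm]
  gcongr with t _
  refine le_min ?_ ?_
  · exact (Finset.expect_le_expect (g := fun _ => (1 : ℝ)) fun x _ => min_le_left _ _).trans_eq
      (Fintype.expect_const _)
  · refine (Finset.expect_le_expect fun x _ => min_le_right _ _).trans ?_
    rw [← Finset.mul_expect]
    gcongr

lemma expect_fin_succ {α : Type*} [Fintype α] {k : ℕ} (f : (Fin (k + 1) → α) → ℝ) :
    𝔼 ω, f ω = 𝔼 x, 𝔼 ω, f (Fin.cons x ω) := by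
  rw [← expect_prod (fun p : α × (Fin k → α) => f (Fin.cons p.1 p.2))]
  exact (Fintype.expect_equiv (Fin.consEquiv fun _ => α) _ _ fun _ => rfl).symm

open Classical in
/-- The probability that the algorithm ends with an `ε`-coreset if every search fails with
probability `δ` only; the try that follows a phase uses the first of the given seeds. -/
def ideal {n d : ℕ} {X : Type*} (𝒮 : Scheme n) (a : Fin n → Pt d) (cost : Pt d → X → ℝ≥0)
    (w : Pt d → WSet d → ℝ≥0) (δ ε : ℝ) : List 𝒮.Seed → Phase n → (Fin n → 𝒮.Word) → ℝ
  | [], _, _ => 0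
  | ρ :: L, st, Y =>
    (1 - δ) * if (𝒮.kept st ρ (answers 𝒮 a w st.1 Y)).card ≤ 𝒮.cap st then
        (𝒮.onAccept st ρ).elim
          (if IsCoreset cost a ε Finset.univ
            (listed a (𝒮.output st ρ (answers 𝒮 a w st.1 Y))) then 1 else 0)
          (fun st' => ideal 𝒮 a cost w δ ε L st' (𝒮.output st ρ (answers 𝒮 a w st.1 Y)))
      else ideal 𝒮 a cost w δ ε L (Scheme.onReject st) Y

namespace Scheme.Fits

variable {n d : ℕ} {X : Type*} {𝒮 : Scheme n} {a : Fin n → Pt d} {cost : Pt d → X → ℝ≥0}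
  {w : Pt d → WSet d → ℝ≥0} {g : ℝ → ℕ → ℕ → ℝ} {sumw δ ε : ℝ}
  {st : Phase n} {Y : Fin n → 𝒮.Word}

lemma _root_.ideal_nonneg (hδ1 : δ ≤ 1) (L : List 𝒮.Seed) (st : Phase n) (Y : Fin n → 𝒮.Word) :
    0 ≤ ideal 𝒮 a cost w δ ε L st Y := by
  induction L generalizing st Y with
  | nil => exact le_rfl
  | cons ρ L ih =>
    rw [ideal]
    refine mul_nonneg (by linarith) ?_
    split_ifs <;> cases 𝒮.onAccept st ρ <;> first | exact ih _ _ | simp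

/-- An accepted sample that is a coreset of the target is a coreset for the next phase. -/
lemma ready_of_onAccept {ρ : 𝒮.Seed} {st' : Phase n} {Y' : Fin n → 𝒮.Word}
    (h : IsCoreset cost a (precision ε st) (𝒮.target st ρ) (listed a Y'))
    (hst' : 𝒮.onAccept st ρ = some st') : Ready a cost st' Y' := by
  obtain ⟨T, m⟩ := st
  match m with
  | none => simp [onAccept] at hst'
  | some 0 =>
    simp only [onAccept, Option.some.injEq] at hst'
    subst hst'
    refine ⟨?_, fun _ => rfl⟩
    have h1 : 𝒮.target (T, some 0) ρ = Finset.univ := by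
      ext i
      simp [target, below]
    rw [h1] at h
    simpa [precision] using h
  | some (j + 1) =>
    simp only [onAccept, Option.some.injEq] at hst'
    subst hst'
    exact ⟨by simpa [precision] using h, fun h => by simp at h⟩

/-- Many tries suffice with a probability that is governed by the potential. -/
theorem le_expect_ideal (h : 𝒮.Fits a cost w g sumw δ ε) (hδ : 0 ≤ δ) (hδ1 : δ ≤ 1) (k : ℕ)
    (st : Phase n) (Y : Fin n → 𝒮.Word) (hY : Ready a cost st Y)
    (hst : ∀ j ∈ st.2, j + k ≤ 𝒮.bits) :
    1 - failBound δ k (potential a w sumw st) ≤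
      𝔼 ω : Fin k → 𝒮.Seed, ideal 𝒮 a cost w δ ε (List.ofFn ω) st Y := by
  classical
  induction k generalizing st Y with
  | zero =>
    have := h.one_half_le_potential st
    simp only [List.ofFn_zero, ideal, Finset.expect_const_zero, failBound, pow_zero,
      Finset.range_zero, Finset.sum_empty]
    linarith
  | succ k ih =>
    set z := answers 𝒮 a w st.1 Y with hz
    have hpos : ∀ o : Option (Phase n), 0 ≤ o.elim 0 (potential a w sumw) := by
      rintro (_ | st')
      · exact le_rfl
      · exact (by norm_num : (0 : ℝ) ≤ 1 / 2).trans (h.one_half_le_potential st')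
    set good : 𝒮.Seed → ℝ := fun ρ => if IsCoreset cost a (precision ε st) (𝒮.target st ρ)
      (listed a (𝒮.output st ρ z)) then (1 : ℝ) else 0 with hgood
    have hgood0 : ∀ ρ, 0 ≤ good ρ := fun ρ => by simp only [hgood]; split_ifs <;> norm_num
    have hgood1 : ∀ ρ, good ρ ≤ 1 := fun ρ => by simp only [hgood]; split_ifs <;> norm_num
    have hfail : ∀ o : Option (Phase n), 0 ≤ failBound δ k (o.elim 0 (potential a w sumw)) :=
      fun o => failBound_nonneg hδ k (hpos o)
    have key : ∀ ρ, good ρ - failBound δ k ((𝒮.next st ρ z).elim 0 (potential a w sumw)) - δ ≤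
        𝔼 ω : Fin k → 𝒮.Seed, ideal 𝒮 a cost w δ ε (ρ :: List.ofFn ω) st Y := by
      intro ρ
      simp only [ideal]
      rw [← Finset.mul_expect, ← hz]
      -- It suffices to compare without the factor `1 - δ`.
      suffices hs : good ρ - failBound δ k ((𝒮.next st ρ z).elim 0 (potential a w sumw)) ≤
          𝔼 ω : Fin k → 𝒮.Seed, (if (𝒮.kept st ρ z).card ≤ 𝒮.cap st then
            (𝒮.onAccept st ρ).elim (if IsCoreset cost a ε Finset.univ
              (listed a (𝒮.output st ρ z)) then 1 else 0)
              (fun st' => ideal 𝒮 a cost w δ ε (List.ofFn ω) st' (𝒮.output st ρ z))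
            else ideal 𝒮 a cost w δ ε (List.ofFn ω) (onReject st) Y) by
        have h1 := hfail (𝒮.next st ρ z)
        have h2 := hgood1 ρ
        refine le_trans ?_ (mul_le_mul_of_nonneg_left hs (by linarith))
        nlinarith
      unfold next
      by_cases hacc : (𝒮.kept st ρ z).card ≤ 𝒮.cap st
      · simp only [if_pos hacc]
        have h1 := hfail (𝒮.onAccept st ρ)
        by_cases hc : IsCoreset cost a (precision ε st) (𝒮.target st ρ)
            (listed a (𝒮.output st ρ z))
        · rcases hst' : 𝒮.onAccept st ρ with _ | st'
          · have h2 : st.2 = none := by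
              obtain ⟨T, _ | _ | j⟩ := st <;> simp_all [onAccept]
            have h3 : 𝒮.target st ρ = Finset.univ := by
              rw [← hY.eq_univ h2, target, h2]
            have h4 : precision ε st = ε := by rw [precision, if_pos h2]
            rw [hst'] at h1
            rw [h3, h4] at hc
            simp only [hgood, h3, h4, if_pos hc, Option.elim_none, Fintype.expect_const] at h1 ⊢
            linarith
          · have h2 := ih st' (𝒮.output st ρ z) (ready_of_onAccept hc hst') (by
              intro j hj
              obtain ⟨T, _ | _ | i⟩ := st
              · simp [onAccept] at hst'
              · simp only [onAccept, Option.some.injEq] at hst'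
                subst hst'; simp at hj
              · simp only [onAccept, Option.some.injEq] at hst'
                subst hst'
                simp only [Option.mem_def, Option.some.injEq] at hj
                have := hst (i + 1) rfl
                omega)
            simp only [hgood, if_pos hc, Option.elim_some]
            exact h2
        · have h2 : 0 ≤ 𝔼 ω : Fin k → 𝒮.Seed, (𝒮.onAccept st ρ).elim
              (if IsCoreset cost a ε Finset.univ (listed a (𝒮.output st ρ z)) then (1 : ℝ) else 0)
              (fun st' => ideal 𝒮 a cost w δ ε (List.ofFn ω) st' (𝒮.output st ρ z)) := by
            refine Finset.expect_nonneg fun ω _ => ?_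
            cases 𝒮.onAccept st ρ
            · simp only [Option.elim_none]; split_ifs <;> norm_num
            · exact ideal_nonneg hδ1 _ _ _
          simp only [hgood, if_neg hc]
          linarith
      · simp only [if_neg hacc, Option.elim_some]
        have h2 := ih (onReject st) Y ⟨hY.coreset, fun h3 => hY.eq_univ (by
            simpa [onReject] using h3)⟩ (by
          intro j hj
          obtain ⟨T, _ | i⟩ := st
          · simp [onReject] at hj
          · simp only [onReject, Option.map_some, Option.mem_def, Option.some.injEq] at hj
            have := hst i rfl
            omega)
        linarith [hgood1 ρ]
    rw [expect_fin_succ]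
    simp only [List.ofFn_cons]
    refine le_trans ?_ (Finset.expect_le_expect fun ρ _ => key ρ)
    rw [Finset.expect_sub_distrib, Finset.expect_sub_distrib, Fintype.expect_const]
    have h1 := expect_failBound_le hδ k (h.expect_potential_le hY fun j hj => by
      have := hst j hj; omega)
    have h2 : 1 - δ ≤ 𝔼 ρ, good ρ := by
      rw [expect_prod]
      refine le_trans (Fintype.expect_const (ι := Fin n → Fin (2 ^ 𝒮.bits)) (1 - δ)).ge ?_
      exact Finset.expect_le_expect fun ρ₁ _ => h.le_expect_isCoreset hY ρ₁
    rw [failBound_succ k (h.one_half_le_potential st)]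
    linarith

end Scheme.Fits

/-! ### The machine for given seeds -/

namespace Scheme

variable {n : ℕ} (𝒮 : Scheme n)

/-- The phase after a sequence of outcomes (the last one first; `true` stands for acceptance) of
tries with given seeds. -/
def phase (L : List 𝒮.Seed) (J : ℕ) : List Bool → Phase n
  | [] => (∅, some J)
  | b :: π =>
    match L[π.length]? with
    | none => phase L J π
    | some ρ => if b then (𝒮.onAccept (phase L J π) ρ).getD (phase L J π)
      else onReject (phase L J π)

/-- The largest sample that may be accepted. -/
def capMax : ℕ := min n ⌊1000 * max 𝒮.fine 𝒮.coarse⌋₊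

lemma cap_le_capMax (st : Phase n) : 𝒮.cap st ≤ 𝒮.capMax := by
  refine min_le_min le_rfl (Nat.floor_le_floor ?_)
  unfold size
  split_ifs <;> gcongr
  exacts [le_max_left _ _, le_max_right _ _]

lemma capMax_pos (i : Fin n) : 0 < 𝒮.capMax := by
  refine lt_min i.pos (Nat.floor_pos.mpr ?_)
  have := (𝒮.one_le_fine).trans (le_max_left 𝒮.fine 𝒮.coarse)
  linarith

lemma entries_injective (N : ℕ) : Function.Injective
    (fun (π : {π : List Bool // π.length ≤ N}) (i : Fin N) => π.1[(i : ℕ)]?) := by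
  intro π π' h
  refine Subtype.ext (List.ext_getElem? fun i => ?_)
  by_cases hi : i < N
  · exact congrFun h ⟨i, hi⟩
  · rw [List.getElem?_eq_none (by have := π.2; omega),
      List.getElem?_eq_none (by have := π'.2; omega)]

instance (N : ℕ) : Fintype {π : List Bool // π.length ≤ N} :=
  Fintype.ofInjective _ (entries_injective N)

lemma card_lists_le (N : ℕ) : Fintype.card {π : List Bool // π.length ≤ N} ≤ 3 ^ N := by
  simpa using Fintype.card_le_of_injective _ (entries_injective N)

/-- The searches of the algorithm for given seeds. A state is the sequence of the outcomes so far.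
The code of a marked index `i` with the exponent `κ` is the word `i + n * κ`. If all seeds are used
up, the algorithm gives up with an empty list, unless the output is being sampled. -/
@[reducible] def search (L : List 𝒮.Seed) (J : ℕ) (i₀ : Fin n) (R : ℕ) (hL : L.length < 𝒮.maxWord) :
    Search n where
  State := {π : List Bool // π.length ≤ L.length}
  maxWord := 𝒮.maxWord
  unit := 𝒮.unit
  unit_pos := 𝒮.unit_pos
  sched := schedule n 𝒮.capMax R
  iterMax := n
  sched_le := by
    intro J hJ
    obtain ⟨k, -, hk⟩ := List.mem_flatMap.mp hJ
    rw [List.eq_of_mem_replicate hk]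
    exact groverIters_le_self n k
  capMax := 𝒮.capMax
  idx := i₀
  first := ⟨[], Nat.zero_le _⟩
  depth π := L.length - π.1.length
  depth_lt π := (Nat.sub_le _ _).trans_lt hL
  flag π i := decide (i ∉ (𝒮.phase L J π.1).1)
  pick π i z :=
    match L[π.1.length]? with
    | none => none
    | some ρ =>
      if i ∈ 𝒮.target (𝒮.phase L J π.1) ρ ∧
          (ρ.2 i : ℕ) < 2 ^ (𝒮.bits - expo 𝒮.prec (𝒮.size (𝒮.phase L J π.1)) z)
      then some (Fin.ofNat (𝒮.maxWord + 1)
        (i + n * expo 𝒮.prec (𝒮.size (𝒮.phase L J π.1)) z)) else none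
  item v := (⟨v % n, Nat.mod_lt _ i₀.pos⟩, Fin.ofNat (𝒮.maxWord + 1) (2 ^ ((v : ℕ) / n)))
  cap π := if π.1.length = L.length ∧ (𝒮.phase L J π.1).2 ≠ none then 0
    else 𝒮.cap (𝒮.phase L J π.1)
  cap_le π := by
    split_ifs
    exacts [Nat.zero_le _, 𝒮.cap_le_capMax _]
  onAcc π := if h : π.1.length < L.length ∧ (𝒮.phase L J π.1).2 ≠ none
    then some ⟨true :: π.1, h.1⟩ else none
  onRej π := if h : π.1.length < L.length then some ⟨false :: π.1, h⟩ else none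
  acc_lt := by
    intro π π' h
    split_ifs at h with h1
    obtain rfl := Option.some.inj h
    simp only [List.length_cons]
    omega
  rej_lt := by
    intro π π' h
    split_ifs at h with h1
    obtain rfl := Option.some.inj h
    simp only [List.length_cons]
    omega

end Scheme

section Link

variable {n d : ℕ} {X : Type*} {𝒮 : Scheme n} {a : Fin n → Pt d} {cost : Pt d → X → ℝ≥0}
  {w : Pt d → WSet d → ℝ≥0} {Tprep Tquery : ℕ → ℕ → ℕ} {δ ε : ℝ}
  {L : List 𝒮.Seed} {J : ℕ} {i₀ : Fin n} {R : ℕ} {hL : L.length < 𝒮.maxWord}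

lemma weightedSet_decode (m : QMachine n) (hm : m.scale = 1) (Y : Fin n → m.shape.Word) :
    weightedSet a (m.decode Y) = listed a Y := by
  unfold listed QMachine.decode
  simp [hm]

lemma search_word (π : (𝒮.search L J i₀ R hL).State) (Y : Fin n → 𝒮.Word) (i : Fin n) :
    (𝒮.search L J i₀ R hL).word (weightOracle a w Tprep Tquery) π Y i =
      answers 𝒮 a w (𝒮.phase L J π.1).1 Y i := by
  have h1 := weightedSet_decode (a := a) (𝒮.search L J i₀ R hL).machine rfl Y
  have h2 : (𝒮.search L J i₀ R hL).word (weightOracle a w Tprep Tquery) π Y i =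
      (𝒮.search L J i₀ R hL).machine.encode (w (a i)
        (weightedSet a ((𝒮.search L J i₀ R hL).machine.decode Y) +
          if decide (i ∉ (𝒮.phase L J π.1).1) = true then Finsupp.single (a i) 1 else 0)) := rfl
  rw [h2, h1]
  simp only [decide_eq_true_eq]
  rfl

lemma search_pick {π : (𝒮.search L J i₀ R hL).State} {ρ : 𝒮.Seed}
    (hρ : L[π.1.length]? = some ρ) (i : Fin n) (z : 𝒮.Word) :
    (𝒮.search L J i₀ R hL).pick π i z =
      if i ∈ 𝒮.target (𝒮.phase L J π.1) ρ ∧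
          (ρ.2 i : ℕ) < 2 ^ (𝒮.bits - expo 𝒮.prec (𝒮.size (𝒮.phase L J π.1)) z)
      then some (Fin.ofNat (𝒮.maxWord + 1)
        (i + n * expo 𝒮.prec (𝒮.size (𝒮.phase L J π.1)) z)) else none := by
  simp only [Scheme.search, hρ]

lemma search_marked {π : (𝒮.search L J i₀ R hL).State} {ρ : 𝒮.Seed}
    (hρ : L[π.1.length]? = some ρ) (Y : Fin n → 𝒮.Word) :
    (𝒮.search L J i₀ R hL).marked (weightOracle a w Tprep Tquery) π Y =
      𝒮.kept (𝒮.phase L J π.1) ρ (answers 𝒮 a w (𝒮.phase L J π.1).1 Y) := by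
  ext i
  simp only [Search.marked, Scheme.kept, below, Finset.mem_filter, Finset.mem_univ, true_and]
  rw [search_word, Scheme.exponent]
  simp only [hρ]
  split_ifs with h <;> simp [h]

/-- The code of an index and an exponent is a word. -/
lemma code_lt (hn : n * (𝒮.prec + 1) ≤ 𝒮.maxWord) (st : Phase n) (i : Fin n) (z : ℕ) :
    i + n * expo 𝒮.prec (𝒮.size st) z < 𝒮.maxWord + 1 := by
  have h1 := expo_le (u := 𝒮.prec) z (Scheme.one_le_size (𝒮 := 𝒮) st)
  have h2 := Nat.mul_le_mul_left n h1
  have := i.2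
  rw [mul_add, mul_one] at hn
  omega

lemma search_item (hn : n * (𝒮.prec + 1) ≤ 𝒮.maxWord) (st : Phase n) (i : Fin n) (z : ℕ) :
    (𝒮.search L J i₀ R hL).item (Fin.ofNat (𝒮.maxWord + 1) (i + n * expo 𝒮.prec (𝒮.size st) z)) =
      (i, Fin.ofNat (𝒮.maxWord + 1) (2 ^ expo 𝒮.prec (𝒮.size st) z)) := by
  simp only [Scheme.search, Fin.val_ofNat, Nat.mod_eq_of_lt (code_lt hn st i z)]
  refine Prod.ext (Fin.ext ?_) ?_
  · simp [Nat.mod_eq_of_lt i.2]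
  · simp only
    rw [Nat.add_mul_div_left _ _ i.pos, Nat.div_eq_of_lt i.2, zero_add]

lemma search_result (hn : n * (𝒮.prec + 1) ≤ 𝒮.maxWord) {π : (𝒮.search L J i₀ R hL).State}
    {ρ : 𝒮.Seed} (hρ : L[π.1.length]? = some ρ) (Y : Fin n → 𝒮.Word) :
    (𝒮.search L J i₀ R hL).result (weightOracle a w Tprep Tquery) π Y =
      𝒮.output (𝒮.phase L J π.1) ρ (answers 𝒮 a w (𝒮.phase L J π.1).1 Y) := by
  ext1 i
  rw [Search.result, Scheme.output, search_marked hρ]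
  split_ifs with h
  · rw [search_word, search_pick hρ, if_pos, Option.getD_some, search_item hn]
    · rfl
    · exact Finset.mem_filter.mp h
  · rfl

open Classical in
/-- The value of a configuration is one if the output is a coreset. -/
def coresetValue (cost : Pt d → X → ℝ≥0) (a : Fin n → Pt d) (ε : ℝ) (m : QMachine n)
    (c : Config n m.shape) : ℝ :=
  if IsCoreset cost a ε Finset.univ (weightedSet a (m.decode c.list)) then 1 else 0

lemma coresetValue_nonneg (m : QMachine n) (c : Config n m.shape) :
    0 ≤ coresetValue cost a ε m c := by
  unfold coresetValue; split_ifs <;> norm_num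

/-- The machine is as good as the idealized process. -/
theorem ideal_le_valAt (hn : n * (𝒮.prec + 1) ≤ 𝒮.maxWord) (hδ1 : δ < 1) {k : ℕ}
    (hk : 2 * n ≤ 2 ^ k * δ) (hR : R = 200 * k) (m : ℕ) :
    ∀ (π : (𝒮.search L J i₀ R hL).State), π.1.length + m = L.length →
      ∀ (Y : Fin n → 𝒮.Word) (b : (𝒮.search L J i₀ R hL).Bas)
        (mem : Fin (n + (𝒮.search L J i₀ R hL).capMax) → 𝒮.Word) (t : ℕ),
      (∀ i, Search.Old π mem i) →
        ideal 𝒮 a cost w δ ε (L.drop π.1.length) (𝒮.phase L J π.1) Y ≤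
        (𝒮.search L J i₀ R hL).valAt (weightOracle a w Tprep Tquery)
          (coresetValue cost a ε (𝒮.search L J i₀ R hL).machine)
          ((𝒮.search L J i₀ R hL).draw π 0 0 b) mem (fun _ => 0) (some Y) (Pi.single b 1) t := by
  classical
  set A := 𝒮.search L J i₀ R hL with hA
  set F := coresetValue cost a ε A.machine with hF
  have hF0 : ∀ c, 0 ≤ F c := fun c => coresetValue_nonneg _ c
  induction m with
  | zero =>
    intro π hπ Y b mem t _
    rw [List.drop_eq_nil_of_le (by omega), ideal]
    exact Search.valAt_nonneg hF0 _ _ _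
  | succ m ih =>
    intro π hπ Y b mem t hold
    have hlt : π.1.length < L.length := by omega
    set ρ := L[π.1.length] with hρdef
    have hρ : L[π.1.length]? = some ρ := List.getElem?_eq_getElem hlt
    set st := 𝒮.phase L J π.1 with hst
    set z := answers 𝒮 a w st.1 Y with hz
    have hcap : A.cap π = 𝒮.cap st := if_neg fun h => hlt.ne h.1
    have hmarked : A.marked (weightOracle a w Tprep Tquery) π Y = 𝒮.kept st ρ z :=
      search_marked hρ Y
    have hresult : A.result (weightOracle a w Tprep Tquery) π Y = 𝒮.output st ρ z :=
      search_result hn hρ Y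
    rw [List.drop_eq_getElem_cons hlt, ideal, ← hρdef, ← hz]
    set v : ℝ := if (𝒮.kept st ρ z).card ≤ 𝒮.cap st then
        (𝒮.onAccept st ρ).elim (if IsCoreset cost a ε Finset.univ
          (listed a (𝒮.output st ρ z)) then 1 else 0)
          (fun st' => ideal 𝒮 a cost w δ ε (L.drop (π.1.length + 1)) st' (𝒮.output st ρ z))
        else ideal 𝒮 a cost w δ ε (L.drop (π.1.length + 1)) (Scheme.onReject st) Y with hv
    have hv0 : 0 ≤ v := by
      rw [hv]
      split_ifs <;> cases 𝒮.onAccept st ρ <;> first | exact ideal_nonneg hδ1.le _ _ _ | simp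
    have hfind := le_findProb_schedule (n := n) (C := 𝒮.capMax) (cap := A.cap π)
      (m := (A.marked (weightOracle a w Tprep Tquery) π Y).card) (k := k) (δ := δ)
      (𝒮.capMax_pos i₀) (A.cap_le π) ((Finset.card_le_univ _).trans (Fintype.card_fin n).le)
      hδ1 hk i₀.pos
    rw [← hR] at hfind
    refine (mul_le_mul_of_nonneg_right hfind hv0).trans ?_
    refine Search.le_valAt_draw hF0 ?_ ?_ ?_ A.sched 0 rfl (Nat.zero_le _) [] mem 0 b t
      List.nodup_nil (by simp) rfl (Nat.zero_le _) ⟨by simp, fun i _ => hold i, by simp⟩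
    · intro i z' x hx
      change (𝒮.search L J i₀ R hL).pick π i z' = some x at hx
      rw [search_pick hρ] at hx
      split_ifs at hx
      obtain rfl := Option.some.inj hx
      exact congrArg Prod.fst (search_item hn _ i z')
    · intro hacc b' mem' t' hmem'
      rw [hmarked, hcap] at hacc
      rw [hv, if_pos hacc, hresult]
      by_cases hfin : st.2 = none
      · have h1 : A.onAcc π = none := dif_neg fun h => h.2 hfin
        have h2 : 𝒮.onAccept st ρ = none := by rw [Scheme.onAccept, hfin]
        rw [h2, Option.elim_none, Search.acc, h1, Search.valAt_halt, hF, coresetValue,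
          weightedSet_decode _ rfl]
      · have h1 : A.onAcc π = some ⟨true :: π.1, hlt⟩ := dif_pos ⟨hlt, hfin⟩
        obtain ⟨st', h2⟩ : ∃ st', 𝒮.onAccept st ρ = some st' := by
          obtain ⟨T, _ | _ | j⟩ := st <;> simp_all [Scheme.onAccept]
        have h3 : 𝒮.phase L J (true :: π.1) = st' := by
          rw [Scheme.phase, hρ]
          simp only [if_true, ← hst, h2, Option.getD_some]
        rw [h2, Option.elim_some, Search.acc, h1]
        obtain ⟨t₂, h4⟩ := Search.valAt_eq_of_prep (A := A) (O := weightOracle a w Tprep Tquery)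
          (F := F) (mem := mem') (list := 𝒮.output st ρ z) (loaded := some Y)
          (psi := Pi.single b' 1) (t := t') (q := .prep ⟨true :: π.1, hlt⟩ b')
          (q' := A.draw ⟨true :: π.1, hlt⟩ 0 0 b') rfl
        refine le_trans ?_ h4.ge
        have h5 := ih ⟨true :: π.1, hlt⟩ (by simp only [List.length_cons]; omega)
          (𝒮.output st ρ z) b' mem' t₂ (hmem'.old (A.acc_lt h1))
        simp only [List.length_cons, h3] at h5
        exact h5
    · intro hrej b' mem' t' hmem'
      rw [hmarked, hcap] at hrej
      rw [hv, if_neg hrej.not_ge]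
      have h1 : A.onRej π = some ⟨false :: π.1, hlt⟩ := dif_pos hlt
      have h3 : 𝒮.phase L J (false :: π.1) = Scheme.onReject st := by
        rw [Scheme.phase, hρ]
        simp [hst]
      rw [Search.rej, h1]
      have h5 := ih ⟨false :: π.1, hlt⟩ (by simp only [List.length_cons]; omega)
        Y b' mem' t' (hmem'.old (A.rej_lt h1))
      simp only [List.length_cons, h3] at h5
      exact h5

end Link

/-! ### Bounds for the parameters -/

lemma sum_min_one_le {c : ℝ} {T : ℕ} (hc : 0 ≤ c) (h : c * 0.9 ^ T ≤ 1) (N : ℕ) :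
    ∑ t ∈ Finset.range N, min 1 (c * 0.9 ^ t) ≤ T + 10 := by
  have h1 : ∑ t ∈ Finset.range N, min 1 (c * 0.9 ^ t) ≤
      ∑ t ∈ Finset.range (T + N), min 1 (c * 0.9 ^ t) := by
    refine Finset.sum_le_sum_of_subset_of_nonneg ?_ fun t _ _ => le_min zero_le_one (by positivity)
    exact Finset.range_subset_range.mpr (Nat.le_add_left _ _)
  refine h1.trans ?_
  rw [Finset.sum_range_add]
  refine add_le_add ?_ ?_
  · refine (Finset.sum_le_sum fun t _ => min_le_left _ _).trans (by simp)
  · have h2 : ∀ t ∈ Finset.range N, min 1 (c * 0.9 ^ (T + t)) ≤ (0.9 : ℝ) ^ t := by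
      intro t _
      refine (min_le_right _ _).trans ?_
      rw [pow_add, ← mul_assoc]
      exact mul_le_of_le_one_left (by positivity) h
    refine (Finset.sum_le_sum h2).trans ?_
    rw [geom_sum_eq (by norm_num)]
    have : (0 : ℝ) < 0.9 ^ N := by positivity
    rw [div_le_iff_of_neg (by norm_num)]
    linarith

lemma nine_tenths_pow_le (m : ℕ) : (0.9 : ℝ) ^ (7 * m) ≤ 1 / 2 ^ m := by
  rw [pow_mul, ← one_div_pow]
  exact pow_le_pow_left₀ (by positivity) (by norm_num) m

lemma failBound_le {n k : ℕ} {δ z : ℝ} (hn : 0 < n) (hδ : 0 ≤ δ) (hk : 2 * n ≤ 2 ^ k * δ)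
    (hz : 0 ≤ z) (hzn : z ≤ 4 * n) :
    failBound δ (7 * (k + 2)) z ≤ 77 * Real.logb 2 (2 * n) * δ := by
  have hn' : (1 : ℝ) ≤ n := by exact_mod_cast hn
  set ℓ := Real.logb 2 (2 * n) with hℓ
  have hℓ1 : ℓ = Real.logb 2 n + 1 := by
    rw [hℓ, mul_comm, Real.logb_mul (by positivity) (by norm_num), Real.logb_self_eq_one]
    norm_num
  have hℓ0 : 1 ≤ ℓ := by
    have := Real.logb_nonneg (b := 2) (by norm_num) hn'
    linarith
  have hclog : (Nat.clog 2 n : ℝ) ≤ ℓ := by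
    rw [← Real.natCeil_logb_natCast, hℓ1]
    exact (Nat.ceil_lt_add_one (Real.logb_nonneg (by norm_num) hn')).le
  have h1 : 2 * 0.9 ^ (7 * (k + 2)) * z ≤ δ := by
    have h2 := nine_tenths_pow_le (k + 2)
    have h3 : (0 : ℝ) < 2 ^ k := by positivity
    calc 2 * 0.9 ^ (7 * (k + 2)) * z ≤ 2 * (1 / 2 ^ (k + 2)) * (4 * n) := by gcongr
      _ = 2 * n / 2 ^ k := by rw [pow_add]; field_simp; norm_num
      _ ≤ δ := by rw [div_le_iff₀ h3]; linarith
  have h4 : 2 * z * 0.9 ^ (7 * (Nat.clog 2 n + 3)) ≤ 1 := by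
    have h5 := nine_tenths_pow_le (Nat.clog 2 n + 3)
    have h6 : (n : ℝ) ≤ 2 ^ Nat.clog 2 n := by exact_mod_cast Nat.le_pow_clog (by norm_num) n
    calc 2 * z * 0.9 ^ (7 * (Nat.clog 2 n + 3)) ≤ 2 * (4 * 2 ^ Nat.clog 2 n) *
          (1 / 2 ^ (Nat.clog 2 n + 3)) := by
          gcongr
          linarith
      _ = 1 := by rw [pow_add]; field_simp; norm_num
  have h7 := sum_min_one_le (by positivity) h4 (7 * (k + 2))
  have h8 : ∀ t : ℕ, 2 * 0.9 ^ t * z = 2 * z * 0.9 ^ t := fun t => by ring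
  simp only [failBound, h8] at h1 ⊢
  push_cast at h7
  nlinarith

lemma potential_start_le {n d : ℕ} {X : Type*} {a : Fin n → Pt d} {cost : Pt d → X → ℝ≥0}
    {w : Pt d → WSet d → ℝ≥0} {g : ℝ → ℕ → ℕ → ℝ} {sumw δ : ℝ} (hn : 0 < n)
    (hw : WeightConditions a cost w g sumw δ) (hs : 0 < sumw) :
    potential a w sumw (∅, some (Nat.clog 2 n)) ≤ 4 * n := by
  have hn' : (1 : ℝ) ≤ n := by exact_mod_cast hn
  have h1 : outerWeight a w ∅ / sumw ≤ n := by
    rw [div_le_iff₀ hs, outerWeight]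
    refine (Finset.sum_le_card_nsmul _ _ sumw fun i _ =>
      hw.wt_le (Finset.mem_insert_self i ∅)).trans (by simp)
  simp only [potential]
  set r := √2 ^ Nat.clog 2 n with hr
  have hr1 : 1 ≤ r := one_le_pow₀ (Real.one_le_sqrt.mpr (by norm_num))
  have hrr : r * r = 2 ^ Nat.clog 2 n := by
    rw [hr, ← mul_pow, Real.mul_self_sqrt (by norm_num)]
  have h2 : (n : ℝ) ≤ r * r := by rw [hrr]; exact_mod_cast Nat.le_pow_clog (by norm_num) n
  have h3 : r * r ≤ 2 * n := by
    rw [hrr]; exact_mod_cast two_pow_clog_le hn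
  have h4 : outerWeight a w ∅ / sumw / (10 * r) ≤ r := by
    rw [div_le_iff₀ (by positivity)]
    nlinarith
  nlinarith

/-! ### Bounds for the machine -/

section Size

variable {n k : ℕ} {𝒮 : Scheme n} {L : List 𝒮.Seed} {J : ℕ} {i₀ : Fin n}
  {hL : L.length < 𝒮.maxWord}

lemma search_size (hk : 1 ≤ k) (hn : n ≤ 2 ^ k) (hW : 𝒮.maxWord = 2 ^ (2 * k + 4))
    (hlen : L.length = 7 * (k + 2)) :
    Fintype.card (𝒮.search L J i₀ (200 * k) hL).Q ≤ 2 ^ (92 * k) ∧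
      n + 𝒮.capMax ≤ 2 ^ (92 * k) ∧ 𝒮.maxWord + 1 ≤ 2 ^ (92 * k) ∧
      Fintype.card (𝒮.search L J i₀ (200 * k) hL).Bas ≤ 2 ^ (92 * k) := by
  have hC : 𝒮.capMax ≤ 2 ^ k := (min_le_left _ _).trans hn
  have hk1 : k + 1 ≤ 2 ^ k := Nat.lt_two_pow_self
  have hkp : 1 ≤ 2 ^ k := Nat.one_le_two_pow
  have mono : ∀ {x y : ℕ}, x ≤ y → 2 ^ x ≤ 2 ^ y := fun h => Nat.pow_le_pow_right (by norm_num) h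
  have hadd : ∀ {x m e : ℕ}, x ≤ 2 ^ e → m ≤ 2 ^ e → x + m ≤ 2 ^ (e + 1) := by
    intro x m e h1 h2; rw [pow_succ]; omega
  have hWW : 𝒮.maxWord + 1 ≤ 2 ^ (2 * k + 5) := by
    rw [hW]; exact hadd le_rfl Nat.one_le_two_pow
  have hcell : n + 𝒮.capMax ≤ 2 ^ (k + 1) := hadd hn hC
  have hB : Fintype.card (𝒮.search L J i₀ (200 * k) hL).Bas ≤ 2 ^ (4 * k + 7) := by
    simp only [Search.Bas, Fintype.card_prod, Fintype.card_fin, Fintype.card_bool]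
    calc n * (2 * ((n + 𝒮.capMax) * ((𝒮.maxWord + 1) * 1)))
        ≤ 2 ^ k * (2 * (2 ^ (k + 1) * (2 ^ (2 * k + 5) * 1))) := by gcongr
      _ = 2 ^ (4 * k + 7) := by ring
  have hS : Fintype.card (𝒮.search L J i₀ (200 * k) hL).State ≤ 2 ^ (14 * k + 28) := by
    refine (Scheme.card_lists_le L.length).trans ?_
    rw [hlen]
    calc 3 ^ (7 * (k + 2)) ≤ 4 ^ (7 * (k + 2)) := Nat.pow_le_pow_left (by norm_num) _
      _ = 2 ^ (14 * k + 28) := by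
        rw [show 4 = 2 ^ 2 from rfl, ← pow_mul]; congr 1; ring
  have hD : (schedule n 𝒮.capMax (200 * k)).length ≤ 2 ^ (3 * k + 8) := by
    refine (length_schedule_le _ _ _).trans ?_
    have h1 : Nat.clog 2 n ≤ k := Nat.clog_le_of_le_pow hn
    calc (Nat.clog 2 n + 1) * (𝒮.capMax * (200 * k))
        ≤ 2 ^ k * (2 ^ k * (2 ^ 8 * 2 ^ k)) := by gcongr <;> omega
      _ = 2 ^ (3 * k + 8) := by ring
  have h92 : ∀ {x e : ℕ}, x ≤ 2 ^ e → e ≤ 92 * k → x ≤ 2 ^ (92 * k) := fun h1 h2 =>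
    h1.trans (mono h2)
  refine ⟨?_, h92 hcell (by omega), h92 hWW (by omega), h92 hB (by omega)⟩
  refine Ctl.card_le.trans ?_
  have e1 : Fintype.card (𝒮.search L J i₀ (200 * k) hL).State + 1 ≤ 2 ^ (14 * k + 29) :=
    hadd hS Nat.one_le_two_pow
  have e2 : (schedule n 𝒮.capMax (200 * k)).length + 1 ≤ 2 ^ (3 * k + 9) :=
    hadd hD Nat.one_le_two_pow
  have e3 : 𝒮.capMax + 2 ≤ 2 ^ (k + 2) := hadd (hC.trans (mono (Nat.le_succ _)))
    (by rw [pow_succ]; omega)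
  have e4 : n + 2 ≤ 2 ^ (k + 2) := hadd (hn.trans (mono (Nat.le_succ _)))
    (by rw [pow_succ]; omega)
  have e5 : 𝒮.capMax + 1 ≤ 2 ^ (k + 1) := hadd hC hkp
  have e6 : Fintype.card (𝒮.search L J i₀ (200 * k) hL).Bas + 1 ≤ 2 ^ (4 * k + 8) :=
    hadd hB Nat.one_le_two_pow
  calc _ ≤ 2 ^ 5 * (2 ^ (14 * k + 29) * (2 ^ (3 * k + 9) * (2 ^ (k + 2) * (2 ^ (k + 2) *
        (2 ^ (k + 1) * (2 ^ (4 * k + 8) * 2 ^ (4 * k + 8))))))) := by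
        gcongr
        norm_num
    _ = 2 ^ (28 * k + 64) := by ring
    _ ≤ 2 ^ (92 * k) := mono (by omega)

/-- A bound on the number of steps of the machine. -/
def Scheme.steps (𝒮 : Scheme n) (k : ℕ) : ℕ :=
  (7 * (k + 2) + 1) * (((schedule n 𝒮.capMax (200 * k)).map fun J => 4 * J + 8).sum +
    4 * 𝒮.capMax + 1)

lemma rank_start (hlen : L.length = 7 * (k + 2)) :
    (𝒮.search L J i₀ (200 * k) hL).rk (𝒮.search L J i₀ (200 * k) hL).machine.start =
      𝒮.steps k := by
  rw [Search.rk_num]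
  simp only [Search.rank, Search.trySteps, Search.drawSteps, List.drop_zero, List.length_nil,
    Nat.sub_zero, hlen, Scheme.steps]
  ring

lemma steps_le (hk : 1 ≤ k) (hn0 : 0 < n) (hn : n ≤ 2 ^ k) (i₀ : Fin n) :
    (𝒮.steps k : ℝ) ≤ 6000000 * k ^ 3 * √(n * max 𝒮.fine 𝒮.coarse) := by
  have hk' : (1 : ℝ) ≤ k := by exact_mod_cast hk
  have hn' : (1 : ℝ) ≤ n := by exact_mod_cast hn0
  set C := 𝒮.capMax with hC
  have hC0 : (1 : ℝ) ≤ C := by exact_mod_cast 𝒮.capMax_pos i₀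
  have hCn : (C : ℝ) ≤ n := by exact_mod_cast min_le_left _ _
  have hm1 : 1 ≤ max 𝒮.fine 𝒮.coarse := 𝒮.one_le_fine.trans (le_max_left _ _)
  have hCm : (C : ℝ) ≤ 1000 * max 𝒮.fine 𝒮.coarse :=
    (Nat.cast_le.mpr (min_le_right _ _)).trans (Nat.floor_le (by linarith))
  have h1 := sum_schedule_le (C := C) (200 * k) hn0
  have h2 : (Nat.clog 2 n : ℝ) ≤ k := by exact_mod_cast Nat.clog_le_of_le_pow hn
  have h3 : (C : ℝ) ≤ √(n * C) := Real.le_sqrt_of_sq_le (by nlinarith)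
  have h4 : √((n : ℝ) * C) ≤ 32 * √(n * max 𝒮.fine 𝒮.coarse) := by
    rw [Real.sqrt_le_left (by positivity), mul_pow, Real.sq_sqrt (by positivity)]
    nlinarith
  set Q := √((n : ℝ) * C)
  set D : ℝ := ((((schedule n C (200 * k)).map fun J => 4 * J + 8).sum : ℕ) : ℝ) with hD
  have h5 : D ≤ 7200 * k ^ 2 * Q := by
    refine h1.trans ?_
    push_cast
    calc ((Nat.clog 2 n : ℝ) + 1) * (18 * (200 * k) * Q)
        ≤ (k + k) * (18 * (200 * k) * Q) := by gcongr
      _ = _ := by ring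
  have hk2 : (1 : ℝ) ≤ k ^ 2 := one_le_pow₀ hk'
  have h6 : D + 4 * C + 1 ≤ 7205 * k ^ 2 * Q := by nlinarith
  have h7 : (𝒮.steps k : ℝ) = (7 * (k + 2) + 1) * (D + 4 * C + 1) := by
    rw [Scheme.steps, hD]; push_cast; rfl
  rw [h7]
  calc (7 * ((k : ℝ) + 2) + 1) * (D + 4 * C + 1)
      ≤ (22 * k) * (7205 * k ^ 2 * (32 * √(n * max 𝒮.fine 𝒮.coarse))) := by
        gcongr
        · linarith
        · exact h6.trans (by gcongr)
    _ = 5072320 * (k ^ 3 * √(n * max 𝒮.fine 𝒮.coarse)) := by ring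
    _ ≤ _ := by
      rw [mul_assoc]
      gcongr
      norm_num

end Size

/-! ### The algorithm -/

section Algorithm

variable {n : ℕ} (𝒮 : Scheme n) (i₀ : Fin n) (k : ℕ) (hk : 7 * (k + 2) < 𝒮.maxWord)

/-- The machine for the seeds `ω`. -/
def seedMachine (ω : Fin (7 * (k + 2)) → 𝒮.Seed) : QMachine n :=
  (𝒮.search (List.ofFn ω) (Nat.clog 2 n) i₀ (200 * k) (by rwa [List.length_ofFn])).machine

/-- The algorithm: all seeds are chosen uniformly and independently. -/
def samplingAlgorithm : RandQAlgorithm n where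
  Ω := Fin (7 * (k + 2)) → 𝒮.Seed
  fintype := inferInstance
  prob _ := (Fintype.card (Fin (7 * (k + 2)) → 𝒮.Seed) : ℝ)⁻¹
  prob_nonneg _ := by positivity
  prob_sum := by
    rw [Finset.sum_const, Finset.card_univ, nsmul_eq_mul]
    exact mul_inv_cancel₀ (Nat.cast_ne_zero.mpr Fintype.card_ne_zero)
  machine := seedMachine 𝒮 i₀ k hk

variable {𝒮 i₀ k hk}

lemma samplingAlgorithm_expect (O : WeightOracle n) (N : ℕ)
    (F : (m : QMachine n) → Config n m.shape → ℝ) :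
    (samplingAlgorithm 𝒮 i₀ k hk).expect O N F =
      𝔼 ω, (seedMachine 𝒮 i₀ k hk ω).expect O (F _) N (seedMachine 𝒮 i₀ k hk ω).initConfig := by
  rw [Fintype.expect_eq_sum_div_card, div_eq_inv_mul, Finset.mul_sum]
  rfl

/-- A property of all final configurations has probability one, and a quantity that is bounded in
all of them has a bounded expectation. -/
lemma expect_mem_Icc_of_sure {O : WeightOracle n} {P₁ P₂ T₁ T₂ : ℕ}
    (hP₁ : ⌊1000 * 𝒮.coarse⌋₊ ≤ P₁) (hP₂ : ⌊1000 * 𝒮.fine⌋₊ ≤ P₂)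
    (hT₁ : ∀ r ≤ P₁, O.prepTime r ≤ T₁) (hT₂ : ∀ r ≤ P₁, O.queryTime r ≤ T₂) (hT : 1 ≤ T₂)
    {F : (m : QMachine n) → Config n m.shape → ℝ} {x y : ℝ}
    (hF : ∀ (m : QMachine n) (c : Config n m.shape), (m.code c.pc).IsHalt →
      listSize c.list ≤ P₂ → c.time ≤ T₁ * (7 * (k + 2) + 1) + T₂ * 𝒮.steps k →
      F m c ∈ Set.Icc x y) :
    (samplingAlgorithm 𝒮 i₀ k hk).expect O (𝒮.steps k) F ∈ Set.Icc x y := by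
  have key : ∀ ω, (seedMachine 𝒮 i₀ k hk ω).expect O (F _) (𝒮.steps k)
      (seedMachine 𝒮 i₀ k hk ω).initConfig ∈ Set.Icc x y := by
    intro ω
    have hlen : (List.ofFn ω).length = 7 * (k + 2) := List.length_ofFn
    have hL : (List.ofFn ω).length < 𝒮.maxWord := by rwa [hlen]
    set A := 𝒮.search (List.ofFn ω) (Nat.clog 2 n) i₀ (200 * k) hL with hA
    have hstart : A.rk A.machine.start = 𝒮.steps k := rank_start hlen
    change A.machine.expect O (F _) (𝒮.steps k) A.machine.initConfig ∈ Set.Icc x y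
    refine A.ranked.expect_mem_Icc
      (Inv := A.Inv P₁ P₂ T₁ T₂ (T₁ * (7 * (k + 2) + 1) + T₂ * 𝒮.steps k)) ?_ ?_ hstart.le ?_ ?_
    · refine A.inv_succ ?_ ?_ hT₁ hT₂ hT
      · intro π π' h
        have h1 : (𝒮.phase (List.ofFn ω) (Nat.clog 2 n) π.1).2 ≠ none := by
          intro h2
          have : A.onAcc π = none := dif_neg fun h3 => h3.2 h2
          rw [this] at h
          simp at h
        change (if _ then 0 else _) ≤ P₁
        split_ifs
        · exact Nat.zero_le _
        · refine (min_le_right _ _).trans ?_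
          rwa [Scheme.size, if_neg h1]
      · intro π h
        change (if _ then 0 else _) ≤ P₂
        split_ifs with h1
        · exact Nat.zero_le _
        · have h2 : (𝒮.phase (List.ofFn ω) (Nat.clog 2 n) π.1).2 = none := by
            by_contra h2
            have h3 : π.1.length < (List.ofFn ω).length :=
              lt_of_le_of_ne π.2 fun h4 => h1 ⟨h4, h2⟩
            have : A.onAcc π = some ⟨true :: π.1, h3⟩ := dif_pos ⟨h3, h2⟩
            rw [this] at h
            simp at h
          refine (min_le_right _ _).trans ?_
          rwa [Scheme.size, if_pos h2]
    · intro c hc hhalt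
      refine hF _ c hhalt ?_ ?_
      · obtain ⟨q, hq⟩ := A.num.surjective c.pc
        obtain ⟨h1, -, -⟩ := hc
        rw [← hq, Equiv.symm_apply_apply] at h1
        rw [← hq, Search.code_num] at hhalt
        cases q
        case putLog π l e b b' =>
          -- The log has room for the samples that may be accepted.
          have h2 : (e : ℕ) < A.capMax := h1.2.trans_le (A.cap_le π)
          rw [Search.program, dif_pos h2] at hhalt
          exact hhalt.elim
        case halt => exact h1
        all_goals exact hhalt.elim
      · have := hc.2.2
        omega
    · simp only [QMachine.Normalized, QMachine.initConfig]
      rw [Finset.sum_eq_single A.machine.initBasis] <;> simp +contextual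
    · refine ⟨?_, fun Y hY => by simp [QMachine.initConfig] at hY, ?_⟩
      · change A.ListBound P₁ P₂ (A.num.symm (A.num (.prep A.first A.machine.initBasis))) _
        rw [Equiv.symm_apply_apply]
        exact Search.listSize_zero.le.trans (Nat.zero_le _)
      · have h1 : A.rank (A.num.symm A.machine.start) = 𝒮.steps k := hstart
        have h2 : A.prepsLeft (A.num.symm A.machine.start) = 7 * (k + 2) + 1 := by
          change A.prepsLeft (A.num.symm (A.num (.prep A.first A.machine.initBasis))) = _
          rw [Equiv.symm_apply_apply]
          change (List.ofFn ω).length - 0 + 1 = _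
          rw [hlen, Nat.sub_zero]
        change 0 + T₁ * A.prepsLeft (A.num.symm A.machine.start) +
          T₂ * A.rank (A.num.symm A.machine.start) ≤ _
        rw [h1, h2, zero_add]
  rw [samplingAlgorithm_expect]
  constructor
  · refine le_trans (Fintype.expect_const (ι := Fin (7 * (k + 2)) → 𝒮.Seed) x).ge ?_
    exact Finset.expect_le_expect fun ω _ => (key ω).1
  · refine le_trans ?_ (Fintype.expect_const (ι := Fin (7 * (k + 2)) → 𝒮.Seed) y).le
    exact Finset.expect_le_expect fun ω _ => (key ω).2

/-- The algorithm succeeds with high probability. -/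
lemma le_expect_coresetValue {d : ℕ} {X : Type*} {a : Fin n → Pt d} {cost : Pt d → X → ℝ≥0}
    {w : Pt d → WSet d → ℝ≥0} {g : ℝ → ℕ → ℕ → ℝ} {sumw δ ε : ℝ} {Tprep Tquery : ℕ → ℕ → ℕ}
    (h : 𝒮.Fits a cost w g sumw δ ε) (hδ : 0 ≤ δ) (hδ1 : δ < 1) (hkδ : 2 * n ≤ 2 ^ k * δ)
    (hn : n * (𝒮.prec + 1) ≤ 𝒮.maxWord) (hbits : Nat.clog 2 n + 7 * (k + 2) ≤ 𝒮.bits) :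
    1 - 77 * Real.logb 2 (2 * n) * δ ≤
      (samplingAlgorithm 𝒮 i₀ k hk).expect (weightOracle a w Tprep Tquery) (𝒮.steps k)
        (coresetValue cost a ε) := by
  set st : Phase n := (∅, some (Nat.clog 2 n)) with hst
  have hready : Ready a cost st (fun _ => (0 : 𝒮.Word)) := by
    refine ⟨?_, by simp [hst]⟩
    rw [listed_zero]
    refine ⟨by simp, fun x => ?_⟩
    simp [hst, unitSet, totalCost]
  have h1 := h.le_expect_ideal hδ hδ1.le (7 * (k + 2)) st (fun _ => 0) hready
    (by simpa [hst] using hbits)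
  have h2 := failBound_le i₀.pos hδ hkδ
    ((by norm_num : (0 : ℝ) ≤ 1 / 2).trans (h.one_half_le_potential st))
    (potential_start_le i₀.pos h.conditions h.sumw_pos)
  rw [samplingAlgorithm_expect]
  refine (sub_le_sub_left h2 1).trans (h1.trans (Finset.expect_le_expect fun ω _ => ?_))
  have hlen : (List.ofFn ω).length = 7 * (k + 2) := List.length_ofFn
  have hL : (List.ofFn ω).length < 𝒮.maxWord := by rwa [hlen]
  set A := 𝒮.search (List.ofFn ω) (Nat.clog 2 n) i₀ (200 * k) hL with hA
  change _ ≤ A.machine.expect (weightOracle a w Tprep Tquery) (coresetValue cost a ε A.machine)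
    (𝒮.steps k) A.machine.initConfig
  rw [A.ranked.expect_eq_val (rank_start hlen).le]
  obtain ⟨t, h3⟩ := Search.valAt_eq_of_prep (A := A) (O := weightOracle a w Tprep Tquery)
    (F := coresetValue cost a ε A.machine) (mem := fun _ => 0) (list := fun _ => 0)
    (loaded := none) (psi := Pi.single A.machine.initBasis 1) (t := 0)
    (q := .prep A.first A.machine.initBasis) (q' := A.draw A.first 0 0 A.machine.initBasis) rfl
  refine le_trans ?_ h3.ge
  exact ideal_le_valAt hn hδ1 hkδ rfl (7 * (k + 2)) ⟨[], Nat.zero_le _⟩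
    ((zero_add _).trans hlen.symm) _ _ _ _ fun i => Or.inl rfl

end Algorithm

/-- An integer close to the binary logarithm. -/
lemma exists_nat_near_logb {x : ℝ} (hx : 2 ≤ x) : ∃ k : ℕ, 1 ≤ k ∧ x ≤ 2 ^ k ∧ 2 ^ k ≤ x ^ 2 ∧
    (k : ℝ) ≤ 2 * Real.logb 2 x ∧ 1 ≤ Real.logb 2 x := by
  have h0 : 0 < x := by linarith
  have h1 : 1 ≤ Real.logb 2 x := by
    rw [Real.le_logb_iff_rpow_le (by norm_num) h0, Real.rpow_one]
    exact hx
  have h2 := Nat.le_ceil (Real.logb 2 x)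
  have h3 := (Nat.ceil_lt_add_one (by linarith : 0 ≤ Real.logb 2 x)).le
  set k := ⌈Real.logb 2 x⌉₊
  refine ⟨k, by exact_mod_cast h1.trans h2, ?_, ?_, by linarith, h1⟩
  · rw [Real.logb_le_iff_le_rpow (by norm_num) h0, Real.rpow_natCast] at h2
    exact h2
  · have h4 : (2 : ℝ) ^ (k : ℝ) ≤ 2 ^ (Real.logb 2 x + 1) :=
      Real.rpow_le_rpow_of_exponent_le (by norm_num) h3
    rw [Real.rpow_natCast, Real.rpow_add (by norm_num), Real.rpow_one,
      Real.rpow_logb (by norm_num) (by norm_num) h0] at h4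
    nlinarith

/-- The parameters of the algorithm. -/
def samplingScheme (n k : ℕ) (sumw s s' : ℝ) (hsum : sumw ≠ 0) (hs : 1 ≤ s) (hs' : 1 ≤ s') :
    Scheme n where
  bits := Nat.clog 2 n + 7 * (k + 2) + k
  prec := k
  maxWord := 2 ^ (2 * k + 4)
  unit := |sumw| / 2 ^ k
  coarse := s'
  fine := s
  prec_le := Nat.le_add_left _ _
  unit_pos := div_pos (abs_pos.mpr hsum) (by positivity)
  one_le_coarse := hs'
  one_le_fine := hs

end

theorem mainTheorem1 :
    ∃ K : ℕ, ∀ (n d : ℕ) (ε δ : ℝ) (g : ℝ → ℕ → ℕ → ℝ) (sumw s s' : ℝ),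
      1 ≤ n → 0 < ε → ε < 1 → 0 < δ → δ < 1 →
      s = g ε n d * sumw → s' = g 0.01 n d * sumw → 1 ≤ s → 1 ≤ s' →
      ∃ alg : RandQAlgorithm n,
        alg.SizeAtMost ((2 * n / δ) ^ K) ∧
        ∀ (X : Type*) (cost : Pt d → X → ℝ≥0) (w : Pt d → WSet d → ℝ≥0) (a : Fin n → Pt d),
          Function.Injective a → WeightConditions a cost w g sumw δ →
          ∀ Tprep Tquery : ℕ → ℕ → ℕ,
            Monotone (fun r => Tprep r d) → Monotone (fun r => Tquery r d) →
            (∀ r, 1 ≤ Tquery r d) →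
            ∃ N : ℕ,
              -- the algorithm always halts, within the stated time
              alg.probability (weightOracle a w Tprep Tquery) N (fun m c =>
                (m.code c.pc).IsHalt ∧
                (c.time : ℝ) ≤ K * Real.logb 2 (2 * n / δ) ^ K *
                  (Tprep ⌈K * s'⌉₊ d + √(n * max s s') * Tquery ⌈K * s'⌉₊ d)) = 1 ∧
              -- with high probability the output is an `ε`-coreset
              1 - K * Real.logb 2 (2 * n) ^ K * δ ≤
                alg.probability (weightOracle a w Tprep Tquery) N (fun m c =>
                  IsCoreset cost a ε Finset.univ (weightedSet a (m.decode c.list))) ∧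
              -- the expected size of the output is `O(s)`
              alg.expect (weightOracle a w Tprep Tquery) N (fun _ c => (listSize c.list : ℝ)) ≤
                K * s := by
  -- The constants that occur are `184` (size), `44` and `4.8 * 10 ^ 7` (time), `77` (failure
  -- probability) and `1000` (size of the output).
  obtain ⟨K, hK⟩ : ∃ K : ℕ, 100000000 ≤ K := ⟨_, le_rfl⟩
  have hKr : (100000000 : ℝ) ≤ K := by exact_mod_cast hK
  refine ⟨K, fun n d ε δ g sumw s s' hn hε hε1 hδ hδ1 hs hs' hs1 hs1' => ?_⟩
  have hn' : (1 : ℝ) ≤ n := by exact_mod_cast hn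
  have hx : 2 ≤ 2 * n / δ := by
    rw [le_div_iff₀ hδ]; nlinarith
  obtain ⟨k, hk1, hkx, hkx2, hkΛ, hΛ⟩ := exists_nat_near_logb hx
  set x := 2 * n / δ with hxdef
  set Λ := Real.logb 2 x
  have hsum : sumw ≠ 0 := by rintro rfl; rw [hs, mul_zero] at hs1; linarith
  set 𝒮 := samplingScheme n k sumw s s' hsum hs1 hs1' with h𝒮
  have hkδ : 2 * n ≤ 2 ^ k * δ := by rwa [hxdef, div_le_iff₀ hδ] at hkx
  have hn2 : n ≤ 2 ^ k := by
    have h1 : (2 : ℝ) ^ k * δ ≤ 2 ^ k := mul_le_of_le_one_right (by positivity) hδ1.le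
    have h2 : (n : ℝ) ≤ 2 ^ k := by linarith
    exact_mod_cast h2
  have hk2 : k + 1 ≤ 2 ^ k := Nat.lt_two_pow_self
  have hword : n * (k + 1) ≤ 𝒮.maxWord := by
    calc n * (k + 1) ≤ 2 ^ k * 2 ^ k := Nat.mul_le_mul hn2 hk2
      _ = 2 ^ (k + k) := by rw [pow_add]
      _ ≤ 2 ^ (2 * k + 4) := Nat.pow_le_pow_right (by norm_num) (by omega)
  have hlen : 7 * (k + 2) < 𝒮.maxWord := by
    calc 7 * (k + 2) < 2 ^ k * 2 ^ 4 * 2 := by omega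
      _ = 2 ^ (k + 5) := by ring
      _ ≤ 2 ^ (2 * k + 4) := Nat.pow_le_pow_right (by norm_num) (by omega)
  refine ⟨samplingAlgorithm 𝒮 ⟨0, hn⟩ k hlen, fun ω => ?_, ?_⟩
  · have h1 : ∀ {y : ℕ}, y ≤ 2 ^ (92 * k) → (y : ℝ) ≤ x ^ K := by
      intro y hy
      have h2 : (y : ℝ) ≤ 2 ^ (92 * k) := by exact_mod_cast hy
      calc (y : ℝ) ≤ (2 ^ k) ^ 92 := by rwa [← pow_mul, mul_comm k]
        _ ≤ (x ^ 2) ^ 92 := by gcongr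
        _ = x ^ 184 := by rw [← pow_mul]
        _ ≤ x ^ K := pow_le_pow_right₀ (by linarith) (by omega)
    have h2 := search_size (𝒮 := 𝒮) (J := Nat.clog 2 n) (i₀ := ⟨0, hn⟩) (L := List.ofFn ω)
      (hL := List.length_ofFn.trans_lt hlen) hk1 hn2 rfl List.length_ofFn
    exact ⟨h1 h2.1, h1 h2.2.1, h1 h2.2.2.1, h1 h2.2.2.2⟩
  intro X cost w a _ hw Tprep Tquery hTp hTq hTq1
  have hsum0 : 0 < sumw := by
    refine lt_of_le_of_ne ?_ hsum.symm
    simpa using hw.consistent_total ∅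
  have hfits : 𝒮.Fits a cost w g sumw δ ε :=
    { conditions := hw
      eps_pos := hε
      eps_lt := hε1
      coarse_eq := hs'
      fine_eq := hs
      sumw_eq := by
        change sumw = |sumw| / 2 ^ k * 2 ^ k
        rw [abs_of_pos hsum0]
        field_simp
      le_two_pow := hn2
      two_pow_le := Nat.pow_le_pow_right (by norm_num) (by change k + 1 ≤ 2 * k + 4; omega) }
  have hP₁ : ⌊1000 * 𝒮.coarse⌋₊ ≤ ⌈K * s'⌉₊ := by
    refine (Nat.floor_le_floor ?_).trans (Nat.floor_le_ceil _)
    change 1000 * s' ≤ K * s'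
    gcongr
    linarith
  have hT₁ : ∀ r ≤ ⌈K * s'⌉₊, (weightOracle a w Tprep Tquery).prepTime r ≤ Tprep ⌈K * s'⌉₊ d :=
    fun r hr => hTp hr
  have hT₂ : ∀ r ≤ ⌈K * s'⌉₊, (weightOracle a w Tprep Tquery).queryTime r ≤ Tquery ⌈K * s'⌉₊ d :=
    fun r hr => hTq hr
  have hΛK : ∀ j ≤ K, Λ ^ j ≤ Λ ^ K := fun j hj => pow_le_pow_right₀ hΛ hj
  refine ⟨𝒮.steps k, ?_, ?_, ?_⟩
  · have h1 : (samplingAlgorithm 𝒮 ⟨0, hn⟩ k hlen).probability (weightOracle a w Tprep Tquery)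
        (𝒮.steps k) (fun m c => (m.code c.pc).IsHalt ∧ (c.time : ℝ) ≤ K * Λ ^ K *
          (Tprep ⌈K * s'⌉₊ d + √(n * max s s') * Tquery ⌈K * s'⌉₊ d)) ∈ Set.Icc 1 1 := by
      refine expect_mem_Icc_of_sure hP₁ le_rfl hT₁ hT₂ (hTq1 _) fun m c hhalt _ htime => ?_
      suffices htime' : (c.time : ℝ) ≤ K * Λ ^ K *
          (Tprep ⌈K * s'⌉₊ d + √(n * max s s') * Tquery ⌈K * s'⌉₊ d) by
        rw [if_pos ⟨hhalt, htime'⟩]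
        exact ⟨le_rfl, le_rfl⟩
      have hk0 : (1 : ℝ) ≤ k := by exact_mod_cast hk1
      have h2 : (𝒮.steps k : ℝ) ≤ 6000000 * k ^ 3 * √(n * max s s') :=
        steps_le hk1 hn hn2 ⟨0, hn⟩
      have h3 : (k : ℝ) ^ 3 ≤ 8 * Λ ^ 3 := by
        calc (k : ℝ) ^ 3 ≤ (2 * Λ) ^ 3 := by gcongr
          _ = 8 * Λ ^ 3 := by ring
      have h4 : (7 * ((k : ℝ) + 2) + 1) ≤ K * Λ ^ K := by
        calc 7 * ((k : ℝ) + 2) + 1 ≤ 44 * Λ ^ 1 := by rw [pow_one]; linarith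
          _ ≤ K * Λ ^ K :=
            mul_le_mul (by linarith) (hΛK 1 (by omega)) (by positivity) (by positivity)
      have h5 : (𝒮.steps k : ℝ) ≤ K * Λ ^ K * √(n * max s s') := by
        refine h2.trans (mul_le_mul_of_nonneg_right ?_ (Real.sqrt_nonneg _))
        calc 6000000 * (k : ℝ) ^ 3 ≤ 6000000 * (8 * Λ ^ 3) := by gcongr
          _ = 48000000 * Λ ^ 3 := by ring
          _ ≤ K * Λ ^ K :=
            mul_le_mul (by linarith) (hΛK 3 (by omega)) (by positivity) (by positivity)
      have h6 : (c.time : ℝ) ≤ Tprep ⌈K * s'⌉₊ d * (7 * (k + 2) + 1) +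
          Tquery ⌈K * s'⌉₊ d * 𝒮.steps k := by exact_mod_cast htime
      calc (c.time : ℝ) ≤ Tprep ⌈K * s'⌉₊ d * (K * Λ ^ K) +
            Tquery ⌈K * s'⌉₊ d * (K * Λ ^ K * √(n * max s s')) := h6.trans (by gcongr)
        _ = _ := by ring
    exact le_antisymm h1.2 h1.1
  · refine le_trans ?_ (le_expect_coresetValue hfits hδ.le hδ1 hkδ hword (Nat.le_add_right _ _))
    have hℓ : 1 ≤ Real.logb 2 (2 * n) := by
      rw [Real.le_logb_iff_rpow_le (by norm_num) (by positivity), Real.rpow_one]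
      linarith
    refine sub_le_sub_left (mul_le_mul_of_nonneg_right ?_ hδ.le) 1
    calc 77 * Real.logb 2 (2 * n) ≤ K * Real.logb 2 (2 * n) := by gcongr; linarith
      _ = K * Real.logb 2 (2 * n) ^ 1 := by rw [pow_one]
      _ ≤ K * Real.logb 2 (2 * n) ^ K := by
        gcongr
        omega
  · have h1 := (expect_mem_Icc_of_sure (𝒮 := 𝒮) (i₀ := ⟨0, hn⟩) (k := k) (hk := hlen)
      (O := weightOracle a w Tprep Tquery) (x := 0) (y := ⌊1000 * s⌋₊)
      (F := fun _ c => (listSize c.list : ℝ)) hP₁ le_rfl hT₁ hT₂ (hTq1 _)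
      fun m c _ hsize _ => ⟨Nat.cast_nonneg _, Nat.cast_le.mpr hsize⟩).2
    refine h1.trans ((Nat.floor_le (by linarith)).trans ?_)
    gcongr
    linarith
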